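/- **Setting.** Let $1<p<2$ and $\omega>0$. Let $g:(0,\infty)\to(0,\infty)$ be continuously differentiable and strictly convex, with $g(d)\to+\infty$ as $d\to0^+$ and $g(d)/d\to+\infty$ as $d\to+\infty$. Let $r:(0,1]\to\mathbb R$ be smooth, increasing and convex, with $r,r',r'',r'''$ bounded, $\inf r>0$ and $mR\le r'(R)\le MR$ on $(0,1]$ for some $0<m<M$. Put $u(x)=\frac{r(|x|)}{|x|}x$ for $x\in\mathbb R^2$, $0<|x|\le1$. For $S\subset\mathbb R^2$ let $$E_1(v;S)=\omega\int_S|\nabla v|^p\,dx,\qquad E_2(v;S)=\int_S g(\det\nabla v)\,dx,\qquad E(v;S)=\int_S\big(\omega|\nabla v|^p+g(\det\nabla v)\big)\,dx,$$ with $|\cdot|$ the Frobenius norm. For $\epsilon,\tau>0$ with $\epsilon+\tau\le1$ let $\Omega_{(\epsilon,\tau)}=\{\epsilon\le|x|\le\epsilon+\tau\}$ and $A(\epsilon,\tau)=(\epsilon+\tau)^{2-p}-\epsilon^{2-p}$. **Elements.** Let $\hat T$ be the triangle with vertices $(0,0),(1,0),(0,1)$, with barycentric coordinates $\lambda_1=1-\hat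 x_1-\hat x_2$, $\lambda_2=\hat x_1$, $\lambda_3=\hat x_2$. Three vertices $a_i$ with polar coordinates $(\rho_i,\theta_i)$ define edge nodes $a_{ij}$ ($i<j$) with polar coordinates $(\frac{\rho_i+\rho_j}2,\frac{\theta_i+\theta_j}2)$. For a map $v$ set $\hat\Pi v=\sum_i\lambda_i(2\lambda_i-1)v(a_i)+\sum_{i<j}4\lambda_i\lambda_jv(a_{ij})$ on $\hat T$. The element is $T=F_T(\hat T)$ with $F_T=\hat\Pi\,\mathrm{id}$, and the iso-parametric interpolant on $T$ is $\Pi v=\hat\Pi v\circ F_T^{-1}$. For an integer $N\ge1$ the representative elements have the vertices $(\rho_i,\theta_i)$, $i=1,2,3$: - A: $(\epsilon,0),\ (\epsilon+\tau,-\frac\pi N),\ (\epsilon+\tau,\frac\pi N)$; - B: $(\epsilon+\tau,0),\ (\epsilon,\frac\pi N),\ (\epsilon,-\frac\pi N)$; - C: $(\epsilon,0),\ (\epsilon+\tau,0),\ (\epsilon,\frac\pi N)$; - D: $(\epsilon,0),\ (\epsilon,-\frac\pi N),\ (\epsilon+\tau,0)$. A layer $\mathcal J$ consists either of types A and B, or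 of types A, C and D. For each type that occurs it contains the $N$ rotations of the representative, by the angles $\frac{2k\pi}N$ for type A and $\frac{(2k+1)\pi}N$ for types B, C, D, $0\le k<N$. Let $\Omega^{\mathcal J}_{(\epsilon,\tau)}$ be the union of its elements, and let $E_i(\Pi u;\Omega^{\mathcal J}_{(\epsilon,\tau)})$ and $E(\Pi u;\Omega^{\mathcal J}_{(\epsilon,\tau)})$ be the sums over the elements $T$ of $E_i(\Pi u;T)$ and $E(\Pi u;T)$. **Theorem.** There is $\delta>0$ such that, calling $(\epsilon,\tau,N)$ *fine* if $\epsilon,\tau>0$, $\epsilon+\tau\le1$, $N\ge1$, $N^{-1}\le\delta$ and $\frac\epsilon\tau N^{-4}\le\delta$, the following holds. 1. For both kinds of layers and all fine $(\epsilon,\tau,N)$, every $F_T$ is injective on $\hat T$, the energies below are finite, and $$E_1(\Pi u;\Omega^{\mathcal J}_{(\epsilon,\tau)})=E_1(u;\Omega^{\mathcal J}_{(\epsilon,\tau)})\Big(1+O\big(\tau^2+N^{-2}+\tfrac\epsilon\tau N^{-4}\big)\Big),$$ $$E(u;\Omega^{\mathcal J}_{(\epsilon,\tau)})=E(u;\Omega_{(\epsilon,\tau)})\Big(1+O\big(\tau^2+N^{-2}+\tfrac\epsilon\tau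 N^{-4}\big)\Big),$$ and $C^{-1}A(\epsilon,\tau)\le E(u;S)\le CA(\epsilon,\tau)$ for $S=\Omega^{\mathcal J}_{(\epsilon,\tau)}$ and for $S=\Omega_{(\epsilon,\tau)}$. The constant $C>0$ and the constants in $O(\cdot)$ do not depend on $\epsilon,\tau,N$ or the kind of layer. 2. For all real $d>0$ and $D$, and for both kinds of layers and all fine $(\epsilon,\tau,N)$ such that $d\le\det\nabla\Pi u\le D$ a.e. on every element, $E_2(\Pi u;T)$ is finite for every element $T$, and $$E_2(\Pi u;\Omega^{\mathcal J}_{(\epsilon,\tau)})=E_2(u;\Omega^{\mathcal J}_{(\epsilon,\tau)})+O\big(\tau^3+(\epsilon+\tau)\tau N^{-2}+N^{-4}\big),$$ $$E(\Pi u;\Omega^{\mathcal J}_{(\epsilon,\tau)})=E(u;\Omega^{\mathcal J}_{(\epsilon,\tau)})\Big(1+O\big(\tau^2+N^{-2}+\tfrac{N^{-4}}\tau\big)\Big),$$ with constants in $O(\cdot)$ that depend on $d,D$ but not on $\epsilon,\tau,N$ or the kind of layer. 3. There are $C_1,C_2,C_3,d>0$ and $D$ such that, whenever $\epsilon,\tau>0$,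 $\epsilon+\tau\le1$, $N\ge1$, $\tau\le C_1\epsilon^{1/2}$ and $N^{-1}\le\min\{C_2(\epsilon\tau)^{1/4},C_3\}$, the triple $(\epsilon,\tau,N)$ is fine and $d\le\det\nabla\Pi u\le D$ a.e. on every element of both kinds of layers. In particular the estimates of 2 hold under these mesh conditions. -/

import Mathlib

open Set MeasureTheory Filter Topology

noncomputable section

/-- The Euclidean plane. -/
abbrev Plane : Type := EuclideanSpace ℝ (Fin 2)

/-- The point with polar coordinates `(ρ, θ)`. -/
def polarPoint (ρ θ : ℝ) : Plane := !₂[ρ * Real.cos θ, ρ * Real.sin θ]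

/-! ### Quadratic iso-parametric elements -/

/-- The reference triangle with vertices `(0,0)`, `(1,0)`, `(0,1)`. -/
def refTriangle : Set Plane := {x | 0 ≤ x 0 ∧ 0 ≤ x 1 ∧ x 0 + x 1 ≤ 1}

/-- Barycentric coordinates of the reference triangle. -/
def bary (i : Fin 3) (x : Plane) : ℝ := ![1 - x 0 - x 1, x 0, x 1] i

/-- The three vertices of a curved triangle, given in polar coordinates about the origin. -/
structure PolarTriangle where
  rad : Fin 3 → ℝ
  ang : Fin 3 → ℝ

namespace PolarTriangle

/-- The vertex `a_i`. -/
def vertex (T : PolarTriangle) (i : Fin 3) : Plane := polarPoint (T.rad i) (T.ang i)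

/-- The edge node `a_ij`: radius and angle are the averages of those of `a_i` and `a_j`. -/
def edgeNode (T : PolarTriangle) (i j : Fin 3) : Plane :=
  polarPoint ((T.rad i + T.rad j) / 2) ((T.ang i + T.ang j) / 2)

/-- The quadratic Lagrange interpolant, as a map on the reference triangle, of the values of `v`
at the three vertices and the three edge nodes of `T`. -/
def lagrange (T : PolarTriangle) (v : Plane → Plane) (x : Plane) : Plane :=
  (∑ i, (bary i x * (2 * bary i x - 1)) • v (T.vertex i)) +
    ∑ i, ∑ j ∈ Finset.Ioi i, (4 * bary i x * bary j x) • v (T.edgeNode i j)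

/-- The geometric map `F_T` of the element. -/
def geomMap (T : PolarTriangle) : Plane → Plane := T.lagrange id

/-- The curved triangular element `T = F_T(refTriangle)`. -/
def carrier (T : PolarTriangle) : Set Plane := T.geomMap '' refTriangle

/-- The iso-parametric interpolant `Π v` on the element: the quadratic Lagrange interpolant
composed with the inverse of `F_T`. -/
def interp (T : PolarTriangle) (v : Plane → Plane) : Plane → Plane :=
  fun x => T.lagrange v (Function.invFunOn T.geomMap refTriangle x)

end PolarTriangle

/-! ### One layer of elements over the annulus `ε ≤ |x| ≤ ε + τ` -/

/-- The four types of curved elements. -/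
inductive ElementType
  | A | B | C | D
  deriving DecidableEq

/-- The two kinds of layers: elements of types A, B, or elements of types A, C, D. -/
inductive LayerKind
  | AB | ACD

/-- The types of the elements that occur in a layer. -/
def LayerKind.types : LayerKind → Finset ElementType
  | .AB => {.A, .B}
  | .ACD => {.A, .C, .D}

/-- The representative element of each type, rotated by the angle `c`. -/
def repElement (ε τ : ℝ) (N : ℕ) (c : ℝ) : ElementType → PolarTriangle
  | .A => ⟨![ε, ε + τ, ε + τ], ![c, c - Real.pi / N, c + Real.pi / N]⟩
  | .B => ⟨![ε + τ, ε, ε], ![c, c + Real.pi / N, c - Real.pi / N]⟩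
  | .C => ⟨![ε, ε + τ, ε], ![c, c, c + Real.pi / N]⟩
  | .D => ⟨![ε, ε, ε + τ], ![c, c - Real.pi / N, c]⟩

/-- The angle by which the `k`-th element of each type is rotated: elements of type A sit at the
angles `2kπ/N`, and those of types B, C, D at the angles `(2k+1)π/N` in between. -/
def elementAngle (N : ℕ) (k : Fin N) : ElementType → ℝ
  | .A => 2 * (k : ℝ) * Real.pi / N
  | _ => (2 * (k : ℝ) + 1) * Real.pi / N

/-- The element of type `t` and number `k`. -/
def layerElement (ε τ : ℝ) (N : ℕ) (e : ElementType × Fin N) : PolarTriangle :=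
  repElement ε τ N (elementAngle N e.2 e.1) e.1

/-- The index set of the elements of a layer: `N` elements of each type that occurs. -/
def layerIndex (κ : LayerKind) (N : ℕ) : Finset (ElementType × Fin N) :=
  κ.types ×ˢ Finset.univ

/-- The region covered by the elements of the layer. -/
def layerRegion (κ : LayerKind) (ε τ : ℝ) (N : ℕ) : Set Plane :=
  ⋃ e ∈ layerIndex κ N, (layerElement ε τ N e).carrier

/-- The annulus `ε ≤ |x| ≤ ε + τ`. -/
def annulus (ε τ : ℝ) : Set Plane := {x | ε ≤ ‖x‖ ∧ ‖x‖ ≤ ε + τ}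

/-! ### Energies -/

/-- The Frobenius norm of a linear map of the plane. -/
def frobNorm (L : Plane →L[ℝ] Plane) : ℝ :=
  Real.sqrt (∑ i, ∑ j, (L (EuclideanSpace.single j (1 : ℝ)) i) ^ 2)

/-- The density `ω |∇v|^p`. -/
def density₁ (p ω : ℝ) (v : Plane → Plane) (x : Plane) : ℝ := ω * frobNorm (fderiv ℝ v x) ^ p

/-- The density `g (det ∇v)`. -/
def density₂ (g : ℝ → ℝ) (v : Plane → Plane) (x : Plane) : ℝ := g (fderiv ℝ v x).det

/-- `E₁(v; S) = ω ∫_S |∇v|^p`. -/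
def energy₁ (p ω : ℝ) (v : Plane → Plane) (S : Set Plane) : ℝ := ∫ x in S, density₁ p ω v x

/-- `E₂(v; S) = ∫_S g (det ∇v)`. -/
def energy₂ (g : ℝ → ℝ) (v : Plane → Plane) (S : Set Plane) : ℝ := ∫ x in S, density₂ g v x

/-- `E(v; S) = ∫_S (ω |∇v|^p + g (det ∇v))`. -/
def energy (p ω : ℝ) (g : ℝ → ℝ) (v : Plane → Plane) (S : Set Plane) : ℝ :=
  ∫ x in S, (density₁ p ω v x + density₂ g v x)

/-- `E₁` of the interpolant on the elements of the layer. -/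
def interpEnergy₁ (p ω : ℝ) (u : Plane → Plane) (κ : LayerKind) (ε τ : ℝ) (N : ℕ) : ℝ :=
  ∑ e ∈ layerIndex κ N,
    energy₁ p ω ((layerElement ε τ N e).interp u) (layerElement ε τ N e).carrier

/-- `E₂` of the interpolant on the elements of the layer. -/
def interpEnergy₂ (g : ℝ → ℝ) (u : Plane → Plane) (κ : LayerKind) (ε τ : ℝ) (N : ℕ) : ℝ :=
  ∑ e ∈ layerIndex κ N,
    energy₂ g ((layerElement ε τ N e).interp u) (layerElement ε τ N e).carrier

/-- `E` of the interpolant on the elements of the layer. -/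
def interpEnergy (p ω : ℝ) (g : ℝ → ℝ) (u : Plane → Plane) (κ : LayerKind) (ε τ : ℝ) (N : ℕ) :
    ℝ :=
  ∑ e ∈ layerIndex κ N,
    energy p ω g ((layerElement ε τ N e).interp u) (layerElement ε τ N e).carrier

/-- `A(ε, τ) = (ε + τ)^(2 - p) - ε^(2 - p)`. -/
def layerSize (p ε τ : ℝ) : ℝ := (ε + τ) ^ (2 - p) - ε ^ (2 - p)

/-! ### Data -/

/-- The compressibility function `g : (0,∞) → (0,∞)`. -/
structure IsCompressibility (g : ℝ → ℝ) : Prop where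
  pos : ∀ d, 0 < d → 0 < g d
  contDiff : ContDiffOn ℝ 1 g (Ioi 0)
  strictConvex : StrictConvexOn ℝ (Ioi 0) g
  tendsto_zero : Tendsto g (𝓝[>] 0) atTop
  superlinear : Tendsto (fun d => g d / d) atTop atTop

/-- The radial profile of a cavity deformation, a function on `(0,1]`. -/
structure IsCavityProfile (r : ℝ → ℝ) : Prop where
  smooth : ContDiffOn ℝ (⊤ : ℕ∞) r (Ioc 0 1)
  monotone : MonotoneOn r (Ioc 0 1)
  convex : ConvexOn ℝ (Ioc 0 1) r
  bounded : ∃ B : ℝ, ∀ j ≤ 3, ∀ R ∈ Ioc (0 : ℝ) 1, |iteratedDerivWithin j r (Ioc 0 1) R| ≤ B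
  inf_pos : ∃ c > 0, ∀ R ∈ Ioc (0 : ℝ) 1, c ≤ r R
  deriv_bounds : ∃ m M : ℝ, 0 < m ∧ m < M ∧ ∀ R ∈ Ioc (0 : ℝ) 1,
    m * R ≤ derivWithin r (Ioc 0 1) R ∧ derivWithin r (Ioc 0 1) R ≤ M * R

/-- The radially symmetric deformation `u(x) = r(|x|) x / |x|`. -/
def radialMap (r : ℝ → ℝ) (x : Plane) : Plane := (r ‖x‖ / ‖x‖) • x

/-- Parameters of a layer inside the unit disc. -/
structure LayerParams (ε τ : ℝ) (N : ℕ) : Prop where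
  eps_pos : 0 < ε
  tau_pos : 0 < τ
  le_one : ε + τ ≤ 1
  N_pos : 0 < N

/-- The mesh of the layer is fine to the degree `δ`: `1/N ≤ δ` and `(ε/τ) N⁻⁴ ≤ δ`. -/
structure FineLayer (δ ε τ : ℝ) (N : ℕ) : Prop extends LayerParams ε τ N where
  inv_N_le : 1 / (N : ℝ) ≤ δ
  ratio_le : ε / τ * (1 / (N : ℝ) ^ 4) ≤ δ

/-- On every element of the layer, `d ≤ det ∇(Π u) ≤ D` almost everywhere. -/
def DetBounds (d D : ℝ) (u : Plane → Plane) (κ : LayerKind) (ε τ : ℝ) (N : ℕ) : Prop :=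
  ∀ e ∈ layerIndex κ N, ∀ᵐ x ∂(volume.restrict (layerElement ε τ N e).carrier),
    d ≤ (fderiv ℝ ((layerElement ε τ N e).interp u) x).det ∧
      (fderiv ℝ ((layerElement ε τ N e).interp u) x).det ≤ D

end

set_option linter.unusedVariables false
noncomputable section

/-! ### Linear maps of the plane in coordinates -/

/-! All energies of the interpolant are pulled back to the reference triangle, where both `F_T` and
the Lagrange interpolant of `u` are quadratic polynomials. The gradient of `Π u` is the quotient of
their derivatives, so its determinant is a ratio of Jacobians, and its Frobenius norm is that of a
product with an adjugate, divided by the Jacobian of `F_T`.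

The map `u` and the identity both send the point `(ρ, θ)` to `(f ρ, θ)`, with `f = r` and `f = id`.
In the frame rotated by the angle of the element, the partial derivatives therefore have closed
forms in the profile values, `κ = 1 - cos (π/(2N))` and `S = sin (π/(2N))`. Let `ρ` be the affine
interpolation of the radius on the reference triangle, and divide by the natural area scale. Then
the Jacobian of `F_T` is close to `ρ`, that of the interpolant to `r(ρ) r'(ρ)`, and the Frobenius
numerator to `r(ρ)² + (ρ r'(ρ))²`. The errors have three sources: `τ²` from quadratic interpolation
of `r`; `κ`, of order `N⁻²`, from replacing arcs by parabolas; and `κ² (ε+τ)/τ`, from radial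
displacements of size `κ²` times the radius, which have to be compared with the thickness `τ`. The
off-diagonal entries are of size `S`, but they enter only through their squares, which are of order
`κ`. This is `layer_approx`, obtained from `iso_approx` and `corner_approx`.

The comparison densities depend on `ρ` only. The radius has weight `s` on elements of type A and `1
- s` on the others, so these weights add up to one. The comparison sum over the layer is therefore
exactly `4 N S ∫ R f(R) dR` (`sum_reference`), and `4 N S` differs from `2π` by a factor `1 +
O(N⁻²)`. For `E₁` the pointwise comparison is relative, with weights `ρ^(1-p)` whose integral is the
layer size `A` up to a factor. For `E₂` it is absolute, since `g` is Lipschitz on a compact interval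
that contains all the determinants.

The exact energies do not require the elements to be disjoint. The union of the elements lies
between two annuli whose boundary circles differ from those of the layer by a relative amount
`O(N⁻⁴)`. The inclusions follow from monotonicity of the radius on a half-sector, formed by half of
an element of type A and its neighbour, and from a connectedness argument (`sector_cover`). The
shells have energy `O(A (N⁻² + (ε/τ) N⁻⁴))`, so for small `δ` they do not spoil the comparability of
the energies with `A`.

Orientation is preserved once the absolute Jacobian errors are below a small multiple of `ε`, hence
of `ρ`; the mesh conditions of the third part are what this needs. -/

theorem plane_eq_sum (x : Plane) :
    x = x 0 • EuclideanSpace.single 0 (1 : ℝ) + x 1 • EuclideanSpace.single 1 (1 : ℝ) := by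
  ext i
  fin_cases i <;> simp

theorem plane_det_eq (L : Plane →L[ℝ] Plane) :
    L.det = L (EuclideanSpace.single 0 1) 0 * L (EuclideanSpace.single 1 1) 1 -
      L (EuclideanSpace.single 1 1) 0 * L (EuclideanSpace.single 0 1) 1 := by
  have h := LinearMap.det_toMatrix (EuclideanSpace.basisFun (Fin 2) ℝ).toBasis
    (L : Plane →ₗ[ℝ] Plane)
  rw [ContinuousLinearMap.det, ← h, Matrix.det_fin_two]
  simp [LinearMap.toMatrix_apply]

theorem frobNorm_eq (L : Plane →L[ℝ] Plane) :
    frobNorm L = Real.sqrt (L (EuclideanSpace.single 0 1) 0 ^ 2 +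
      L (EuclideanSpace.single 1 1) 0 ^ 2 + L (EuclideanSpace.single 0 1) 1 ^ 2 +
      L (EuclideanSpace.single 1 1) 1 ^ 2) := by
  simp only [frobNorm, Fin.sum_univ_two]
  congr 1
  ring

/-! ### The reference triangle -/

theorem refTriangle_convex : Convex ℝ refTriangle := by
  intro x hx y hy a b ha hb hab
  obtain ⟨h0, h1, h2⟩ := hx
  obtain ⟨k0, k1, k2⟩ := hy
  refine ⟨?_, ?_, ?_⟩ <;> simp only [PiLp.add_apply, PiLp.smul_apply, smul_eq_mul]
  · positivity
  · positivity
  · nlinarith [mul_le_mul_of_nonneg_left h2 ha, mul_le_mul_of_nonneg_left k2 hb]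

theorem continuous_coord (i : Fin 2) : Continuous fun x : Plane => x i := by fun_prop

theorem refTriangle_isClosed : IsClosed refTriangle := by
  have h0 := continuous_coord 0
  have h1 := continuous_coord 1
  exact (isClosed_le continuous_const h0).inter
    ((isClosed_le continuous_const h1).inter (isClosed_le (h0.add h1) continuous_const))

theorem refTriangle_isCompact : IsCompact refTriangle := by
  refine Metric.isCompact_of_isClosed_isBounded refTriangle_isClosed ?_
  refine (Metric.isBounded_closedBall (x := (0 : Plane)) (r := 2)).subset fun x hx => ?_
  obtain ⟨h0, h1, h2⟩ := hx
  rw [mem_closedBall_zero_iff, EuclideanSpace.norm_eq, Fin.sum_univ_two, Real.norm_eq_abs,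
    Real.norm_eq_abs, sq_abs, sq_abs]
  refine Real.sqrt_le_iff.mpr ⟨by norm_num, ?_⟩
  nlinarith

theorem refTriangle_diff_interior : volume (refTriangle \ interior refTriangle) = 0 := by
  have h := refTriangle_convex.addHaar_frontier (μ := (volume : Measure Plane))
  rwa [frontier, refTriangle_isClosed.closure_eq] at h

namespace PolarTriangle

variable (T : PolarTriangle) (v : Plane → Plane)

/-! ### Quadratic Lagrange interpolation -/

/-- The derivative of the Lagrange interpolant along the first coordinate axis. -/
def part₀ (x : Plane) : Plane :=
  (1 - 4 * (1 - x 0 - x 1)) • v (T.vertex 0) + (4 * x 0 - 1) • v (T.vertex 1) +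
    (4 * (1 - x 0 - x 1 - x 0)) • v (T.edgeNode 0 1) - (4 * x 1) • v (T.edgeNode 0 2) +
    (4 * x 1) • v (T.edgeNode 1 2)

/-- The derivative of the Lagrange interpolant along the second coordinate axis. -/
def part₁ (x : Plane) : Plane :=
  (1 - 4 * (1 - x 0 - x 1)) • v (T.vertex 0) + (4 * x 1 - 1) • v (T.vertex 2) +
    (4 * (1 - x 0 - x 1 - x 1)) • v (T.edgeNode 0 2) - (4 * x 0) • v (T.edgeNode 0 1) +
    (4 * x 0) • v (T.edgeNode 1 2)

theorem lagrange_eq (x : Plane) :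
    T.lagrange v x = ((1 - x 0 - x 1) * (2 * (1 - x 0 - x 1) - 1)) • v (T.vertex 0) +
      (x 0 * (2 * x 0 - 1)) • v (T.vertex 1) + (x 1 * (2 * x 1 - 1)) • v (T.vertex 2) +
      (4 * (1 - x 0 - x 1) * x 0) • v (T.edgeNode 0 1) +
      (4 * (1 - x 0 - x 1) * x 1) • v (T.edgeNode 0 2) +
      (4 * x 0 * x 1) • v (T.edgeNode 1 2) := by
  have e0 : Finset.Ioi (0 : Fin 3) = {1, 2} := by decide
  have e1 : Finset.Ioi (1 : Fin 3) = {2} := by decide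
  have e2 : Finset.Ioi (2 : Fin 3) = ∅ := by decide
  simp [lagrange, Fin.sum_univ_three, e0, e1, e2, bary, add_assoc]

theorem lagrange_apply (x : Plane) (i : Fin 2) :
    T.lagrange v x i = (1 - x 0 - x 1) * (2 * (1 - x 0 - x 1) - 1) * v (T.vertex 0) i +
      x 0 * (2 * x 0 - 1) * v (T.vertex 1) i + x 1 * (2 * x 1 - 1) * v (T.vertex 2) i +
      4 * (1 - x 0 - x 1) * x 0 * v (T.edgeNode 0 1) i +
      4 * (1 - x 0 - x 1) * x 1 * v (T.edgeNode 0 2) i +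
      4 * x 0 * x 1 * v (T.edgeNode 1 2) i := by
  simp [lagrange_eq]

theorem part₀_apply (x : Plane) (i : Fin 2) :
    T.part₀ v x i = (1 - 4 * (1 - x 0 - x 1)) * v (T.vertex 0) i +
      (4 * x 0 - 1) * v (T.vertex 1) i + 4 * (1 - x 0 - x 1 - x 0) * v (T.edgeNode 0 1) i -
      4 * x 1 * v (T.edgeNode 0 2) i + 4 * x 1 * v (T.edgeNode 1 2) i := by
  simp [part₀]

theorem part₁_apply (x : Plane) (i : Fin 2) :
    T.part₁ v x i = (1 - 4 * (1 - x 0 - x 1)) * v (T.vertex 0) i +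
      (4 * x 1 - 1) * v (T.vertex 2) i + 4 * (1 - x 0 - x 1 - x 1) * v (T.edgeNode 0 2) i -
      4 * x 0 * v (T.edgeNode 0 1) i + 4 * x 0 * v (T.edgeNode 1 2) i := by
  simp [part₁]

/-- The derivative of the Lagrange interpolant. -/
def lagDeriv (x : Plane) : Plane →L[ℝ] Plane :=
  (EuclideanSpace.proj 0 : Plane →L[ℝ] ℝ).smulRight (T.part₀ v x) +
    (EuclideanSpace.proj 1 : Plane →L[ℝ] ℝ).smulRight (T.part₁ v x)

theorem lagDeriv_apply (x y : Plane) :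
    T.lagDeriv v x y = y 0 • T.part₀ v x + y 1 • T.part₁ v x := by
  simp [lagDeriv]

/-- A quadratic map has no remainder in the midpoint rule. This identity gives both strict
differentiability and, where the Jacobian does not vanish, injectivity. -/
theorem lagrange_sub (x y : Plane) :
    T.lagrange v x - T.lagrange v y = T.lagDeriv v ((1 / 2 : ℝ) • x + (1 / 2 : ℝ) • y) (x - y) := by
  ext i
  simp only [lagDeriv_apply, PiLp.sub_apply, PiLp.add_apply, PiLp.smul_apply, smul_eq_mul,
    lagrange_apply, part₀_apply, part₁_apply]
  ring

theorem continuous_part₀ : Continuous (T.part₀ v) := by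
  have h0 := continuous_coord 0
  have h1 := continuous_coord 1
  unfold part₀
  fun_prop

theorem continuous_part₁ : Continuous (T.part₁ v) := by
  have h0 := continuous_coord 0
  have h1 := continuous_coord 1
  unfold part₁
  fun_prop

theorem continuous_lagDeriv : Continuous (T.lagDeriv v) := by
  have h0 := T.continuous_part₀ v
  have h1 := T.continuous_part₁ v
  unfold lagDeriv
  fun_prop

theorem lagrange_hasStrictFDerivAt (x : Plane) :
    HasStrictFDerivAt (T.lagrange v) (T.lagDeriv v x) x := by
  rw [hasStrictFDerivAt_iff_isLittleO]
  have key : ∀ z : Plane × Plane, T.lagrange v z.1 - T.lagrange v z.2 - T.lagDeriv v x (z.1 - z.2)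
      = (T.lagDeriv v ((1 / 2 : ℝ) • z.1 + (1 / 2 : ℝ) • z.2) - T.lagDeriv v x) (z.1 - z.2) := by
    intro z
    rw [lagrange_sub, sub_apply]
  simp only [key]
  have hc : Tendsto (fun z : Plane × Plane =>
      T.lagDeriv v ((1 / 2 : ℝ) • z.1 + (1 / 2 : ℝ) • z.2) - T.lagDeriv v x) (𝓝 (x, x)) (𝓝 0) := by
    have h := T.continuous_lagDeriv v
    have h2 : Continuous (fun z : Plane × Plane =>
      T.lagDeriv v ((1 / 2 : ℝ) • z.1 + (1 / 2 : ℝ) • z.2) - T.lagDeriv v x) := by fun_prop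
    have h3 := h2.tendsto (x, x)
    have e : (1 / 2 : ℝ) • x + (1 / 2 : ℝ) • x = x := by
      rw [← add_smul]; norm_num
    simpa only [e, sub_self] using h3
  rw [Asymptotics.isLittleO_iff]
  intro c hc0
  have := (Metric.tendsto_nhds.mp hc) c hc0
  filter_upwards [this] with z hz
  rw [dist_zero_right] at hz
  refine (ContinuousLinearMap.le_opNorm _ _).trans ?_
  gcongr

theorem continuous_lagrange : Continuous (T.lagrange v) :=
  continuous_iff_continuousAt.mpr fun x =>
    (T.lagrange_hasStrictFDerivAt v x).hasFDerivAt.continuousAt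

/-- The Jacobian determinant of the Lagrange interpolant. -/
def jac (x : Plane) : ℝ :=
  T.part₀ v x 0 * T.part₁ v x 1 - T.part₁ v x 0 * T.part₀ v x 1

/-- The squared Frobenius norm of the product of the derivative of the Lagrange interpolant of `v`
and the adjugate of the derivative of the geometric map. -/
def frobNum (x : Plane) : ℝ :=
  (T.part₀ v x 0 * T.part₁ id x 1 - T.part₁ v x 0 * T.part₀ id x 1) ^ 2 +
  (T.part₁ v x 0 * T.part₀ id x 0 - T.part₀ v x 0 * T.part₁ id x 0) ^ 2 +
  (T.part₀ v x 1 * T.part₁ id x 1 - T.part₁ v x 1 * T.part₀ id x 1) ^ 2 +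
  (T.part₁ v x 1 * T.part₀ id x 0 - T.part₀ v x 1 * T.part₁ id x 0) ^ 2

theorem det_lagDeriv (x : Plane) : (T.lagDeriv v x).det = T.jac v x := by
  rw [plane_det_eq]
  simp [lagDeriv_apply, jac]

theorem continuous_jac : Continuous (T.jac v) := by
  have h0 := T.continuous_part₀ v
  have h1 := T.continuous_part₁ v
  have := continuous_coord
  unfold jac
  fun_prop

theorem continuous_frobNum : Continuous (T.frobNum v) := by
  have h0 := T.continuous_part₀ v
  have h1 := T.continuous_part₁ v
  have h2 := T.continuous_part₀ id
  have h3 := T.continuous_part₁ id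
  unfold frobNum
  fun_prop

theorem frobNum_nonneg (x : Plane) : 0 ≤ T.frobNum v x := by
  unfold frobNum
  positivity

/-! ### The iso-parametric interpolant -/

variable {T}

/-- By the midpoint identity, equal images mean that the derivative at the midpoint kills `x - y`.
The midpoint stays in the convex triangle, where the derivative is invertible, so Cramer's rule
gives `x = y`. -/
theorem geomMap_injOn (hJ : ∀ x ∈ refTriangle, T.jac id x ≠ 0) :
    InjOn T.geomMap refTriangle := by
  intro x hx y hy hxy
  set z : Plane := (1 / 2 : ℝ) • x + (1 / 2 : ℝ) • y with hz
  have hzT : z ∈ refTriangle := refTriangle_convex hx hy (by norm_num) (by norm_num) (by norm_num)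
  have h := T.lagrange_sub id x y
  rw [show T.lagrange id x = T.geomMap x from rfl, show T.lagrange id y = T.geomMap y from rfl,
    hxy, sub_self, ← hz, lagDeriv_apply] at h
  have h0 := congrArg (fun w : Plane => w 0) h
  have h1 := congrArg (fun w : Plane => w 1) h
  simp only [PiLp.zero_apply, PiLp.sub_apply, PiLp.add_apply, PiLp.smul_apply, smul_eq_mul]
    at h0 h1
  have hj := hJ z hzT
  unfold jac at hj
  have e0 : x 0 - y 0 = 0 := by
    refine (mul_eq_zero.mp (?_ : (x 0 - y 0) * _ = 0)).resolve_right hj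
    linear_combination -h0 * T.part₁ id z 1 + h1 * T.part₁ id z 0
  have e1 : x 1 - y 1 = 0 := by
    refine (mul_eq_zero.mp (?_ : (x 1 - y 1) * _ = 0)).resolve_right hj
    linear_combination h0 * T.part₀ id z 1 - h1 * T.part₀ id z 0
  ext i
  fin_cases i
  · exact sub_eq_zero.mp e0
  · exact sub_eq_zero.mp e1

/-- The chosen inverse of `F_T` is a left inverse only on the triangle. At interior points this
holds on a neighbourhood, so the local inverse theorem differentiates it and the chain rule applies.
-/
theorem fderiv_interp_comp (hJ : ∀ x ∈ refTriangle, T.jac id x ≠ 0) {x : Plane}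
    (hx : x ∈ interior refTriangle) :
    (fderiv ℝ (T.interp v) (T.geomMap x)).comp (T.lagDeriv id x) = T.lagDeriv v x := by
  have hdet : (T.lagDeriv id x).det ≠ 0 := by
    rw [det_lagDeriv]; exact hJ x (interior_subset hx)
  have hF := T.lagrange_hasStrictFDerivAt id x
  set e := (T.lagDeriv id x).toContinuousLinearEquivOfDetNeZero hdet with he
  have hF' : HasStrictFDerivAt T.geomMap (e : Plane →L[ℝ] Plane) x := by
    rw [he, ContinuousLinearMap.coe_toContinuousLinearEquivOfDetNeZero]
    exact hF
  have hinv : ∀ᶠ y in 𝓝 x, Function.invFunOn T.geomMap refTriangle (T.geomMap y) = y := by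
    filter_upwards [mem_interior_iff_mem_nhds.mp hx] with y hy
    exact (geomMap_injOn hJ).leftInvOn_invFunOn hy
  have hG := hF'.to_local_left_inverse hinv
  have hx' : Function.invFunOn T.geomMap refTriangle (T.geomMap x) = x := hinv.self_of_nhds
  have hV : HasFDerivAt (T.lagrange v) (T.lagDeriv v x)
      (Function.invFunOn T.geomMap refTriangle (T.geomMap x)) := by
    rw [hx']; exact (T.lagrange_hasStrictFDerivAt v x).hasFDerivAt
  have hI : HasFDerivAt (T.interp v) _ (T.geomMap x) := hV.comp (T.geomMap x) hG.hasFDerivAt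
  rw [hI.fderiv]
  ext y : 1
  have : (e.symm : Plane →L[ℝ] Plane) (T.lagDeriv id x y) = y := by
    have : T.lagDeriv id x y = e y := by
      rw [he]; rfl
    rw [this]; simp
  simp only [ContinuousLinearMap.comp_apply, this]

theorem fderiv_interp_apply (hJ : ∀ x ∈ refTriangle, T.jac id x ≠ 0) {x : Plane}
    (hx : x ∈ interior refTriangle) (i : Fin 2) :
    fderiv ℝ (T.interp v) (T.geomMap x) (EuclideanSpace.single 0 1) i * T.jac id x =
        T.part₀ v x i * T.part₁ id x 1 - T.part₁ v x i * T.part₀ id x 1 ∧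
      fderiv ℝ (T.interp v) (T.geomMap x) (EuclideanSpace.single 1 1) i * T.jac id x =
        T.part₁ v x i * T.part₀ id x 0 - T.part₀ v x i * T.part₁ id x 0 := by
  set L := fderiv ℝ (T.interp v) (T.geomMap x) with hL
  have h := fderiv_interp_comp (v := v) hJ hx
  rw [← hL] at h
  have h0 : L (T.part₀ id x) = T.part₀ v x := by
    have := congrArg (fun M : Plane →L[ℝ] Plane => M (EuclideanSpace.single 0 1)) h
    simpa [lagDeriv_apply] using this
  have h1 : L (T.part₁ id x) = T.part₁ v x := by
    have := congrArg (fun M : Plane →L[ℝ] Plane => M (EuclideanSpace.single 1 1)) h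
    simpa [lagDeriv_apply] using this
  have h0' := congrArg (fun w : Plane => w i) h0
  have h1' := congrArg (fun w : Plane => w i) h1
  rw [plane_eq_sum (T.part₀ id x)] at h0'
  rw [plane_eq_sum (T.part₁ id x)] at h1'
  simp only [map_add, map_smul, PiLp.add_apply, PiLp.smul_apply, smul_eq_mul] at h0' h1'
  unfold jac
  constructor
  · rw [← h0', ← h1']; ring
  · rw [← h0', ← h1']; ring

theorem det_fderiv_interp (hJ : ∀ x ∈ refTriangle, T.jac id x ≠ 0) {x : Plane}
    (hx : x ∈ interior refTriangle) :
    (fderiv ℝ (T.interp v) (T.geomMap x)).det = T.jac v x / T.jac id x := by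
  have hj := hJ x (interior_subset hx)
  have h := fderiv_interp_comp (v := v) hJ hx
  have h2 := congrArg ContinuousLinearMap.det h
  rw [det_lagDeriv, ContinuousLinearMap.det, ContinuousLinearMap.toLinearMap_comp,
    LinearMap.det_comp] at h2
  rw [eq_div_iff hj, ← h2]
  congr 1
  exact (det_lagDeriv T id x).symm

/-- The inverse of the derivative of `F_T` is its adjugate over the Jacobian; keeping the quotient
unexpanded leaves a polynomial numerator to estimate. -/
theorem frobNorm_fderiv_interp (hJ : ∀ x ∈ refTriangle, T.jac id x ≠ 0) {x : Plane}
    (hx : x ∈ interior refTriangle) :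
    frobNorm (fderiv ℝ (T.interp v) (T.geomMap x)) =
      Real.sqrt (T.frobNum v x / T.jac id x ^ 2) := by
  have hj := hJ x (interior_subset hx)
  rw [frobNorm_eq]
  congr 1
  obtain ⟨a, b⟩ := fderiv_interp_apply (v := v) hJ hx 0
  obtain ⟨c, d⟩ := fderiv_interp_apply (v := v) hJ hx 1
  rw [eq_div_iff (pow_ne_zero 2 hj), frobNum, ← a, ← b, ← c, ← d]
  ring

/-! ### Change of variables on an element -/

/-- The gradient of the interpolant is computed at interior points only; the boundary of a convex
set is null, so nothing is lost in the integrals. -/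
theorem ae_interior : ∀ᵐ x ∂(volume.restrict refTriangle), x ∈ interior refTriangle := by
  rw [ae_restrict_iff' refTriangle_isClosed.measurableSet, ae_iff]
  convert refTriangle_diff_interior using 2
  ext x
  simp

theorem integral_carrier (hJ : ∀ x ∈ refTriangle, T.jac id x ≠ 0) (f : Plane → ℝ) :
    ∫ x in T.carrier, f x = ∫ x in refTriangle, |T.jac id x| * f (T.geomMap x) := by
  have h := integral_image_eq_integral_abs_det_fderiv_smul volume
    refTriangle_isClosed.measurableSet
    (fun x _ => (T.lagrange_hasStrictFDerivAt id x).hasFDerivAt.hasFDerivWithinAt)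
    (geomMap_injOn hJ) f
  simp only [det_lagDeriv, smul_eq_mul] at h
  exact h

theorem integrableOn_carrier (hJ : ∀ x ∈ refTriangle, T.jac id x ≠ 0) (f : Plane → ℝ) :
    IntegrableOn f T.carrier ↔
      IntegrableOn (fun x => |T.jac id x| * f (T.geomMap x)) refTriangle := by
  have h := integrableOn_image_iff_integrableOn_abs_det_fderiv_smul volume
    refTriangle_isClosed.measurableSet
    (fun x _ => (T.lagrange_hasStrictFDerivAt id x).hasFDerivAt.hasFDerivWithinAt)
    (geomMap_injOn hJ) f
  simp only [det_lagDeriv, smul_eq_mul] at h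
  exact h

/-- Lebesgue measure on the element is the image under `F_T` of the measure with density the
absolute Jacobian. This density vanishes nowhere on the triangle, so the null sets correspond. -/
theorem ae_carrier_iff (hJ : ∀ x ∈ refTriangle, T.jac id x ≠ 0) (q : Plane → Prop) :
    (∀ᵐ x ∂(volume.restrict T.carrier), q x) ↔
      ∀ᵐ x ∂(volume.restrict refTriangle), q (T.geomMap x) := by
  have hm : MeasurableSet refTriangle := refTriangle_isClosed.measurableSet
  have hd : ∀ s ⊆ refTriangle, ∀ x ∈ s,
      HasFDerivWithinAt T.geomMap (T.lagDeriv id x) s x := fun s _ x _ =>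
    (T.lagrange_hasStrictFDerivAt id x).hasFDerivAt.hasFDerivWithinAt
  have hemb : MeasurableEmbedding (refTriangle.domRestrict T.geomMap) :=
    measurableEmbedding_of_fderivWithin hm (hd refTriangle subset_rfl) (geomMap_injOn hJ)
  have hres := restrict_map_withDensity_abs_det_fderiv_eq_addHaar volume hm
    (hd refTriangle subset_rfl) (geomMap_injOn hJ)
  change (∀ᵐ x ∂(volume.restrict (T.geomMap '' refTriangle)), q x) ↔ _
  rw [← hres, hemb.ae_map_iff]
  have e1 : (∀ᵐ x : refTriangle ∂(Measure.comap (↑)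
      (volume.withDensity fun x => ENNReal.ofReal |(T.lagDeriv id x).det|)),
        q (refTriangle.domRestrict T.geomMap x)) ↔
      ∀ᵐ x ∂((volume.withDensity fun x =>
        ENNReal.ofReal |(T.lagDeriv id x).det|).restrict refTriangle), q (T.geomMap x) := by
    rw [← map_comap_subtype_coe hm, (MeasurableEmbedding.subtype_coe hm).ae_map_iff]
    rfl
  rw [e1, restrict_withDensity hm]
  have hmeas : Measurable fun x => ENNReal.ofReal |(T.lagDeriv id x).det| := by
    simp only [det_lagDeriv]
    exact (T.continuous_jac id).abs.measurable.ennreal_ofReal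
  rw [ae_withDensity_iff hmeas]
  rw [ae_restrict_iff' hm, ae_restrict_iff' hm]
  refine eventually_congr (Eventually.of_forall fun x => ?_)
  refine forall_congr' fun hx => ?_
  have : ENNReal.ofReal |(T.lagDeriv id x).det| ≠ 0 := by
    rw [det_lagDeriv]
    simpa using hJ x hx
  simp [this]

end PolarTriangle
end
noncomputable section

/-! ### Bounds for sums and products -/

theorem abs_mul_le_mul {a b A B : ℝ} (ha : |a| ≤ A) (hb : |b| ≤ B) : |a * b| ≤ A * B := by
  rw [abs_mul]
  exact mul_le_mul ha hb (abs_nonneg _) ((abs_nonneg _).trans ha)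

theorem abs_add_le_add {a b A B : ℝ} (ha : |a| ≤ A) (hb : |b| ≤ B) : |a + b| ≤ A + B :=
  (abs_add_le a b).trans (add_le_add ha hb)

theorem abs_sq_sub_sq_le {a b A B : ℝ} (h : |a - b| ≤ A) (hb : |b| ≤ B) :
    |a ^ 2 - b ^ 2| ≤ A * (2 * B + A) := by
  have : a ^ 2 - b ^ 2 = (a - b) * (2 * b + (a - b)) := by ring
  rw [this]
  refine abs_mul_le_mul h (abs_add_le_add ?_ h)
  rw [abs_mul, abs_two]
  linarith

/-! ### Normalized estimates on isosceles elements -/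

section Iso

variable {B σ τ κ k₀ S w t φ ρ u a k A L R R' : ℝ}

/-- The quantities that enter the estimates on an isosceles element: `κ = 1 - cos (h/2)`,
`S = sin (h/2)`, `k = κ / Δ` for the increment `Δ` of the radius, `φ` the radius of the base, and
the data `u`, `a`, `A`, `L` of the interpolated profile, with its value `R` and derivative `R'`. -/
structure IsoData (B σ τ κ k₀ S w t φ ρ u a k A L R R' : ℝ) : Prop where
  one_le_B : 1 ≤ B
  σ_le : σ ≤ 1
  τ_nonneg : 0 ≤ τ
  τ_le : τ ≤ σ
  κ_nonneg : 0 ≤ κ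
  k₀_nonneg : 0 ≤ k₀
  small : κ + κ * σ * k₀ ≤ 1 / 40
  S_sq : S ^ 2 = κ * (2 - κ)
  w_nonneg : 0 ≤ w
  w_le : w ≤ 1
  abs_t : |t| ≤ w
  φ_nonneg : 0 ≤ φ
  φ_le : φ ≤ σ
  φ_mul : φ * w ≤ ρ
  ρ_nonneg : 0 ≤ ρ
  ρ_le : ρ ≤ σ
  abs_k : |k| ≤ k₀
  abs_u : |u| ≤ B
  abs_a : |a| ≤ B * σ
  abs_A : |A - R'| ≤ B * τ ^ 2
  abs_L : |L - R| ≤ B * τ ^ 2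
  abs_R : |R| ≤ B
  abs_R' : |R'| ≤ B * σ

namespace IsoData

theorem σ_nonneg (H : IsoData B σ τ κ k₀ S w t φ ρ u a k A L R R') : 0 ≤ σ :=
  H.τ_nonneg.trans H.τ_le

theorem κ_le (H : IsoData B σ τ κ k₀ S w t φ ρ u a k A L R R') : κ ≤ 1 / 40 := by
  have := mul_nonneg (mul_nonneg H.κ_nonneg H.σ_nonneg) H.k₀_nonneg
  linarith [H.small]

theorem abs_one_sub (H : IsoData B σ τ κ k₀ S w t φ ρ u a k A L R R') : |1 - 2 * w| ≤ 1 :=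
  abs_le.mpr ⟨by linarith [H.w_le], by linarith [H.w_nonneg]⟩

theorem abs_κ (H : IsoData B σ τ κ k₀ S w t φ ρ u a k A L R R') : |κ| ≤ κ :=
  (abs_of_nonneg H.κ_nonneg).le

theorem abs_κ_mul (H : IsoData B σ τ κ k₀ S w t φ ρ u a k A L R R') :
    |κ * k * φ| ≤ κ * σ * k₀ := by
  have := abs_mul_le_mul (abs_mul_le_mul H.abs_κ H.abs_k)
    ((abs_of_nonneg H.φ_nonneg).le.trans H.φ_le)
  linarith

theorem abs_t_sq (H : IsoData B σ τ κ k₀ S w t φ ρ u a k A L R R') : |t ^ 2| ≤ 1 := by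
  rw [abs_of_nonneg (sq_nonneg t), ← sq_abs]
  exact pow_le_one₀ (abs_nonneg _) (H.abs_t.trans H.w_le)

/-- Near the apex the base radius `φ` may be much larger than the local radius `ρ`. The factor `t² ≤
w` compensates, because `φ w ≤ ρ`. -/
theorem abs_φ_t_sq (H : IsoData B σ τ κ k₀ S w t φ ρ u a k A L R R') : |φ * t ^ 2| ≤ ρ := by
  rw [abs_of_nonneg (mul_nonneg H.φ_nonneg (sq_nonneg t))]
  refine le_trans (mul_le_mul_of_nonneg_left ?_ H.φ_nonneg) H.φ_mul
  rw [← sq_abs]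
  calc |t| ^ 2 = |t| * |t| := sq _
    _ ≤ w * 1 := mul_le_mul H.abs_t (H.abs_t.trans H.w_le) (abs_nonneg _) H.w_nonneg
    _ = w := mul_one w

/-- The radial derivative of the first component, normalized. -/
theorem abs_radial (H : IsoData B σ τ κ k₀ S w t φ ρ u a k A L R R') :
    |(1 + (1 - 2 * w) * (2 * κ - 2 * (κ * k * φ))) - 1| ≤ 2 * (κ + κ * σ * k₀) := by
  have h1 : |2 * κ - 2 * (κ * k * φ)| ≤ 2 * (κ + κ * σ * k₀) := by
    have e := abs_add_le_add H.abs_κ ((abs_neg (κ * k * φ)).le.trans H.abs_κ_mul)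
    have : 2 * κ - 2 * (κ * k * φ) = 2 * (κ + -(κ * k * φ)) := by ring
    rw [this, abs_mul, abs_two]
    linarith
  have := abs_mul_le_mul H.abs_one_sub h1
  rw [add_sub_cancel_left]
  linarith

theorem abs_q (H : IsoData B σ τ κ k₀ S w t φ ρ u a k A L R R') :
    |4 * κ - 2 * κ ^ 2| ≤ 4 * κ := by
  rw [abs_of_nonneg] <;> nlinarith [H.κ_nonneg, H.κ_le]

theorem abs_q_mul (H : IsoData B σ τ κ k₀ S w t φ ρ u a k A L R R') :
    |(4 * κ - 2 * κ ^ 2) * (1 - 2 * (k * φ))| ≤ 8 * (κ + κ * σ * k₀) := by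
  have h1 : |k * φ| ≤ k₀ * σ :=
    abs_mul_le_mul H.abs_k ((abs_of_nonneg H.φ_nonneg).le.trans H.φ_le)
  have h2 : |1 - 2 * (k * φ)| ≤ 1 + 2 * (k₀ * σ) := by
    rw [abs_le] at h1 ⊢
    constructor <;> linarith [mul_nonneg H.k₀_nonneg H.σ_nonneg]
  have := abs_mul_le_mul H.abs_q h2
  nlinarith [H.κ_nonneg]

theorem abs_p (H : IsoData B σ τ κ k₀ S w t φ ρ u a k A L R R') :
    |(ρ + (1 - 2 * w) * (κ * φ)) - ρ| ≤ κ * φ := by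
  have := abs_mul_le_mul H.abs_one_sub
    (abs_of_nonneg (mul_nonneg H.κ_nonneg H.φ_nonneg)).le
  rw [add_sub_cancel_left]
  linarith

/-- The Jacobian of the geometric map, normalized. -/
theorem abs_jac (H : IsoData B σ τ κ k₀ S w t φ ρ u a k A L R R') :
    |((1 + (1 - 2 * w) * (2 * κ - 2 * (κ * k * φ))) * (ρ + (1 - 2 * w) * (κ * φ)) +
        2 * (4 * κ - 2 * κ ^ 2) * φ * (1 - 2 * (k * φ)) * t ^ 2) - ρ| ≤
      18 * (κ + κ * σ * k₀) * ρ + 2 * (κ * φ) := by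
  set x₁ := 1 + (1 - 2 * w) * (2 * κ - 2 * (κ * k * φ)) with hx₁
  set p := ρ + (1 - 2 * w) * (κ * φ) with hp
  set e := κ + κ * σ * k₀ with he
  have h1 := H.abs_radial
  have h2 := H.abs_p
  have h3 := H.abs_q_mul
  rw [← hx₁, ← he] at h1
  rw [← hp] at h2
  rw [← he] at h3
  have e1 : x₁ * p + 2 * (4 * κ - 2 * κ ^ 2) * φ * (1 - 2 * (k * φ)) * t ^ 2 - ρ =
      ((x₁ - 1) * (ρ + (p - ρ)) + (p - ρ)) +
        2 * (((4 * κ - 2 * κ ^ 2) * (1 - 2 * (k * φ))) * (φ * t ^ 2)) := by ring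
  rw [e1]
  have h4 := abs_mul_le_mul h1 (abs_add_le_add (abs_of_nonneg H.ρ_nonneg).le h2)
  have h5 := abs_mul_le_mul (abs_two (α := ℝ)).le (abs_mul_le_mul h3 H.abs_φ_t_sq)
  have h6 := abs_add_le_add (abs_add_le_add h4 h2) h5
  have h7 : e * (κ * φ) ≤ 1 / 40 * (κ * φ) :=
    mul_le_mul_of_nonneg_right H.small (mul_nonneg H.κ_nonneg H.φ_nonneg)
  nlinarith [mul_nonneg H.κ_nonneg H.φ_nonneg]

/-- The two-sided estimate contains `κ φ`, which `ρ` does not control near the apex. From below that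
term is harmless: it is negative only for large `w`, where `φ w ≤ ρ` bounds it. -/
theorem jac_lower (H : IsoData B σ τ κ k₀ S w t φ ρ u a k A L R R') :
    ρ / 2 ≤ (1 + (1 - 2 * w) * (2 * κ - 2 * (κ * k * φ))) * (ρ + (1 - 2 * w) * (κ * φ)) +
        2 * (4 * κ - 2 * κ ^ 2) * φ * (1 - 2 * (k * φ)) * t ^ 2 := by
  have h1 := H.abs_radial
  have h3 := H.abs_q_mul
  set x₁ := 1 + (1 - 2 * w) * (2 * κ - 2 * (κ * k * φ)) with hx₁
  set p := ρ + (1 - 2 * w) * (κ * φ) with hp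
  set e := κ + κ * σ * k₀ with he
  have hs : e ≤ 1 / 40 := H.small
  have h5 := abs_mul_le_mul h3 H.abs_φ_t_sq
  have hx : 1 - 2 * e ≤ x₁ := by linarith [(abs_le.mp h1).1]
  have hp' : (1 - κ) * ρ ≤ p := by
    have : -ρ ≤ (1 - 2 * w) * φ := by nlinarith [H.φ_mul, H.φ_nonneg, H.w_le]
    have := mul_le_mul_of_nonneg_left this H.κ_nonneg
    rw [hp]; linarith
  have hκ := H.κ_le
  have hp2 : 39 / 40 * ρ ≤ p := by
    have := mul_le_mul_of_nonneg_right hκ H.ρ_nonneg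
    linarith
  have h6 : 38 / 40 * (39 / 40 * ρ) ≤ x₁ * p := by
    refine mul_le_mul (by linarith) hp2 (by linarith [H.ρ_nonneg]) (by linarith)
  have h7 : e * ρ ≤ 1 / 40 * ρ := mul_le_mul_of_nonneg_right hs H.ρ_nonneg
  have h8 := (abs_le.mp h5).1
  have e1 : 2 * (4 * κ - 2 * κ ^ 2) * φ * (1 - 2 * (k * φ)) * t ^ 2 =
      2 * (((4 * κ - 2 * κ ^ 2) * (1 - 2 * (k * φ))) * (φ * t ^ 2)) := by ring
  rw [e1]
  nlinarith [H.ρ_nonneg]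

theorem abs_A₁ (H : IsoData B σ τ κ k₀ S w t φ ρ u a k A L R R') :
    |A + (1 - 2 * w) * (4 * (κ * a) - 2 * (κ * k * u)) - R'| ≤
      4 * B * (τ ^ 2 + κ * σ + κ * k₀) := by
  have h1 := abs_mul_le_mul H.abs_κ H.abs_a
  have h2 := abs_mul_le_mul (abs_mul_le_mul H.abs_κ H.abs_k) H.abs_u
  have h3 : |4 * (κ * a) - 2 * (κ * k * u)| ≤ 4 * (κ * (B * σ)) + 2 * (κ * k₀ * B) := by
    rw [abs_le] at h1 h2 ⊢
    constructor <;> linarith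
  have h4 := abs_add_le_add H.abs_A (abs_mul_le_mul H.abs_one_sub h3)
  have e1 : A + (1 - 2 * w) * (4 * (κ * a) - 2 * (κ * k * u)) - R' =
      (A - R') + (1 - 2 * w) * (4 * (κ * a) - 2 * (κ * k * u)) := by ring
  rw [e1]
  have hB : 0 ≤ B := by linarith [H.one_le_B]
  nlinarith [mul_nonneg hB (sq_nonneg τ),
    mul_nonneg hB (mul_nonneg H.κ_nonneg H.k₀_nonneg)]

theorem abs_B₁ (H : IsoData B σ τ κ k₀ S w t φ ρ u a k A L R R') :
    |L + (1 - 2 * w) * (κ * u) - R| ≤ B * (τ ^ 2 + κ) := by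
  have h1 := abs_add_le_add H.abs_L (abs_mul_le_mul H.abs_one_sub (abs_mul_le_mul H.abs_κ H.abs_u))
  have e1 : L + (1 - 2 * w) * (κ * u) - R = (L - R) + (1 - 2 * w) * (κ * u) := by ring
  rw [e1]
  linarith

theorem abs_q_B₁' (H : IsoData B σ τ κ k₀ S w t φ ρ u a k A L R R') :
    |(4 * κ - 2 * κ ^ 2) * (2 * a - 2 * (k * u))| ≤ 8 * B * (κ * σ + κ * k₀) := by
  have h2 := abs_mul_le_mul H.abs_k H.abs_u
  have h1 := H.abs_a
  have h3 : |2 * a - 2 * (k * u)| ≤ 2 * (B * σ) + 2 * (k₀ * B) := by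
    rw [abs_le] at h1 h2 ⊢
    constructor <;> linarith
  have := abs_mul_le_mul H.abs_q h3
  linarith

theorem τ_sq_le (H : IsoData B σ τ κ k₀ S w t φ ρ u a k A L R R') : τ ^ 2 ≤ 1 :=
  pow_le_one₀ H.τ_nonneg (H.τ_le.trans H.σ_le)

theorem S_sq_le (H : IsoData B σ τ κ k₀ S w t φ ρ u a k A L R R') : S ^ 2 ≤ 2 * κ := by
  rw [H.S_sq]
  nlinarith [H.κ_nonneg]

/-- The Jacobian of the interpolant, normalized. -/
theorem abs_jac_interp (H : IsoData B σ τ κ k₀ S w t φ ρ u a k A L R R') :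
    |(A + (1 - 2 * w) * (4 * (κ * a) - 2 * (κ * k * u))) * (L + (1 - 2 * w) * (κ * u)) +
        2 * (4 * κ - 2 * κ ^ 2) * u * (2 * a - 2 * (k * u)) * t ^ 2 - R * R'| ≤
      29 * B ^ 2 * (τ ^ 2 + κ * σ + κ * k₀) := by
  have h1 := H.abs_A₁
  have h2 := H.abs_B₁
  have h3 := H.abs_q_B₁'
  set A₁ := A + (1 - 2 * w) * (4 * (κ * a) - 2 * (κ * k * u)) with hA₁
  set B₁ := L + (1 - 2 * w) * (κ * u) with hB₁
  set e₂ := τ ^ 2 + κ * σ + κ * k₀ with he₂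
  have e1 : A₁ * B₁ + 2 * (4 * κ - 2 * κ ^ 2) * u * (2 * a - 2 * (k * u)) * t ^ 2 - R * R' =
      (((B₁ - R) * (R' + (A₁ - R'))) + R * (A₁ - R')) +
        2 * (u * ((4 * κ - 2 * κ ^ 2) * (2 * a - 2 * (k * u))) * t ^ 2) := by ring
  rw [e1]
  have h4 := abs_add_le_add (abs_add_le_add (abs_mul_le_mul h2 (abs_add_le_add H.abs_R' h1))
    (abs_mul_le_mul H.abs_R h1))
    (abs_mul_le_mul (abs_two (α := ℝ)).le (abs_mul_le_mul (abs_mul_le_mul H.abs_u h3) H.abs_t_sq))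
  refine h4.trans ?_
  have hB : 0 ≤ B := by linarith [H.one_le_B]
  have hκk := mul_nonneg H.κ_nonneg H.k₀_nonneg
  have hκσ := mul_nonneg H.κ_nonneg H.σ_nonneg
  have g1 : (τ ^ 2 + κ) * σ ≤ e₂ := by
    have := mul_le_mul_of_nonneg_left H.σ_le (sq_nonneg τ)
    rw [he₂]; linarith
  have g2 : (τ ^ 2 + κ) * e₂ ≤ 2 * e₂ := by
    refine mul_le_mul_of_nonneg_right ?_ (by positivity)
    linarith [H.τ_sq_le, H.κ_le]
  have g3 : κ * σ + κ * k₀ ≤ e₂ := by rw [he₂]; linarith [sq_nonneg τ]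
  have hB2 : 0 ≤ B ^ 2 := sq_nonneg B
  have i1 := mul_le_mul_of_nonneg_left g1 hB2
  have i2 := mul_le_mul_of_nonneg_left g2 hB2
  have i3 := mul_le_mul_of_nonneg_left g3 hB2
  nlinarith

set_option maxHeartbeats 800000 in
/-- The squared Frobenius norm of the gradient of the interpolant, normalized. -/
theorem abs_frob (H : IsoData B σ τ κ k₀ S w t φ ρ u a k A L R R') {m₁₁ m₁₂ m₂₁ m₂₂ : ℝ}
    (h₁₁ : m₁₁ = (A + (1 - 2 * w) * (4 * (κ * a) - 2 * (κ * k * u))) *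
        (ρ + (1 - 2 * w) * (κ * φ)) +
      2 * (4 * κ - 2 * κ ^ 2) * u * (1 - 2 * (k * φ)) * t ^ 2)
    (h₁₂ : m₁₂ = 2 * t * S * (φ * (A + (1 - 2 * w) * (4 * (κ * a) - 2 * (κ * k * u))) -
      u * (1 + (1 - 2 * w) * (2 * κ - 2 * (κ * k * φ)))))
    (h₂₁ : m₂₁ = 4 * t * S * (1 - κ) * (a * φ - u / 2))
    (h₂₂ : m₂₂ = (L + (1 - 2 * w) * (κ * u)) * (1 + (1 - 2 * w) * (2 * κ - 2 * (κ * k * φ))) +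
      2 * (4 * κ - 2 * κ ^ 2) * φ * (2 * a - 2 * (k * u)) * t ^ 2) :
    |m₁₁ ^ 2 + m₁₂ ^ 2 + m₂₁ ^ 2 + m₂₂ ^ 2 - (R ^ 2 + (ρ * R') ^ 2)| ≤
      2000 * B ^ 2 * (τ ^ 2 + (κ + κ * σ * k₀)) := by
  have hA := H.abs_A₁
  have hL := H.abs_B₁
  have hx := H.abs_radial
  have hp := H.abs_p
  have hq := H.abs_q_mul
  have hq' := H.abs_q_B₁'
  set A₁ := A + (1 - 2 * w) * (4 * (κ * a) - 2 * (κ * k * u)) with hA₁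
  set B₁ := L + (1 - 2 * w) * (κ * u) with hB₁
  set x₁ := 1 + (1 - 2 * w) * (2 * κ - 2 * (κ * k * φ)) with hx₁
  set p := ρ + (1 - 2 * w) * (κ * φ) with hp₁
  set e := κ + κ * σ * k₀ with he
  have hB : 0 ≤ B := by linarith [H.one_le_B]
  have hκ := H.κ_nonneg
  have hσ := H.σ_nonneg
  have hk := H.k₀_nonneg
  have hκσk : 0 ≤ κ * σ * k₀ := by positivity
  have hκe : κ ≤ e := by rw [he]; linarith
  have he0 : 0 ≤ e := by linarith
  have hes : e ≤ 1 / 40 := H.small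
  have hτ2 := H.τ_sq_le
  have hτ0 := sq_nonneg τ
  have hE : τ ^ 2 + e ≤ 41 / 40 := by linarith
  have hE0 : 0 ≤ τ ^ 2 + e := by linarith
  have hφ1 : |φ| ≤ σ := (abs_of_nonneg H.φ_nonneg).le.trans H.φ_le
  have hκφ : κ * φ ≤ κ := mul_le_of_le_one_right hκ (H.φ_le.trans H.σ_le)
  have hκφσ : κ * φ ≤ κ * σ := mul_le_mul_of_nonneg_left H.φ_le hκ
  have hρ : |ρ| ≤ σ := (abs_of_nonneg H.ρ_nonneg).le.trans H.ρ_le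
  -- The term `κ k₀` alone is not bounded by `e`. It always meets a factor `ρ` or `φ`, at most `σ`,
  -- and `κ σ k₀` is part of `e`.
  have hσE : (τ ^ 2 + κ * σ + κ * k₀) * σ ≤ τ ^ 2 + e := by
    have := mul_le_mul_of_nonneg_left H.σ_le hτ0
    have := mul_le_mul_of_nonneg_left H.σ_le (mul_nonneg hκ hσ)
    have := mul_le_mul_of_nonneg_left H.σ_le (mul_nonneg hκ hσ)
    have := mul_le_mul_of_nonneg_left H.σ_le hκ
    rw [he]; linarith
  -- the four entries
  have b11 : |m₁₁ - ρ * R'| ≤ 25 * B * (τ ^ 2 + e) := by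
    have e1 : m₁₁ - ρ * R' = ((A₁ - R') * (ρ + (p - ρ)) + R' * (p - ρ)) +
        2 * (u * ((4 * κ - 2 * κ ^ 2) * (1 - 2 * (k * φ))) * t ^ 2) := by
      rw [h₁₁]; ring
    rw [e1]
    have h := abs_add_le_add (abs_add_le_add (abs_mul_le_mul hA (abs_add_le_add hρ hp))
      (abs_mul_le_mul H.abs_R' hp))
      (abs_mul_le_mul (abs_two (α := ℝ)).le (abs_mul_le_mul (abs_mul_le_mul H.abs_u hq) H.abs_t_sq))
    refine h.trans ?_
    have g0 : σ + κ * φ ≤ 2 * σ := by linarith [mul_le_mul_of_nonneg_right H.κ_le hσ]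
    have g1 : 4 * B * (τ ^ 2 + κ * σ + κ * k₀) * (σ + κ * φ) ≤
        4 * B * (τ ^ 2 + κ * σ + κ * k₀) * (2 * σ) :=
      mul_le_mul_of_nonneg_left g0 (by positivity)
    have g2 := mul_le_mul_of_nonneg_left hσE hB
    have g3 : B * σ * (κ * φ) ≤ B * 1 * e := by
      refine mul_le_mul (mul_le_mul_of_nonneg_left H.σ_le hB) (by linarith)
        (mul_nonneg hκ H.φ_nonneg) (by linarith)
    linarith [mul_nonneg hB hτ0]
  -- The off-diagonal entries carry a factor `S`, and `S² ≤ 2κ`. Boundedness of the remaining factor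
  -- is therefore enough.
  have b12 : m₁₂ ^ 2 ≤ 512 * B ^ 2 * e := by
    have g1 : |φ * A₁| ≤ 6 * B := by
      have h := abs_mul_le_mul hφ1 (abs_add_le_add H.abs_R' hA)
      rw [show φ * A₁ = φ * (R' + (A₁ - R')) by ring]
      refine h.trans ?_
      have h2 : σ * (B * σ) ≤ B := by
        have := mul_le_mul_of_nonneg_left (mul_le_one₀ H.σ_le hσ H.σ_le) hB
        linarith
      have h3 := mul_le_mul_of_nonneg_left (hσE.trans hE) hB
      linarith
    have g2 : |u * x₁| ≤ 2 * B := by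
      have h := abs_mul_le_mul H.abs_u (abs_add_le_add (abs_one (α := ℝ)).le hx)
      rw [show u * x₁ = u * (1 + (x₁ - 1)) by ring]
      refine h.trans ?_
      linarith [mul_le_mul_of_nonneg_left hes hB]
    have g3 : |φ * A₁ - u * x₁| ≤ 8 * B := by
      rw [abs_le] at g1 g2 ⊢
      constructor <;> linarith
    have g4 : (φ * A₁ - u * x₁) ^ 2 ≤ 64 * B ^ 2 := by
      rw [← sq_abs]
      have := pow_le_pow_left₀ (abs_nonneg _) g3 2
      linarith
    have g5 : m₁₂ ^ 2 = 4 * (t ^ 2 * S ^ 2 * (φ * A₁ - u * x₁) ^ 2) := by rw [h₁₂]; ring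
    have g6 : t ^ 2 * S ^ 2 ≤ 1 * (2 * e) := by
      refine mul_le_mul ?_ (by linarith [H.S_sq_le]) (sq_nonneg _) (by norm_num)
      have := H.abs_t_sq
      rwa [abs_of_nonneg (sq_nonneg t)] at this
    have g7 := mul_le_mul g6 g4 (sq_nonneg _) (by linarith)
    rw [g5]; linarith
  have b21 : m₂₁ ^ 2 ≤ 72 * B ^ 2 * e := by
    have g1 : |a * φ - u / 2| ≤ 3 / 2 * B := by
      have h := abs_mul_le_mul H.abs_a hφ1
      have h2 : B * σ * σ ≤ B := by
        have := mul_le_mul_of_nonneg_left (mul_le_one₀ H.σ_le hσ H.σ_le) hB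
        linarith
      have h3 := H.abs_u
      rw [abs_le] at h h3 ⊢
      constructor <;> linarith
    have g4 : (a * φ - u / 2) ^ 2 ≤ 9 / 4 * B ^ 2 := by
      rw [← sq_abs]
      have := pow_le_pow_left₀ (abs_nonneg _) g1 2
      linarith
    have g5 : m₂₁ ^ 2 = 16 * (t ^ 2 * S ^ 2 * ((1 - κ) ^ 2 * (a * φ - u / 2) ^ 2)) := by
      rw [h₂₁]; ring
    have g6 : t ^ 2 * S ^ 2 ≤ 1 * (2 * e) := by
      refine mul_le_mul ?_ (by linarith [H.S_sq_le]) (sq_nonneg _) (by norm_num)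
      have := H.abs_t_sq
      rwa [abs_of_nonneg (sq_nonneg t)] at this
    have g8 : (1 - κ) ^ 2 ≤ 1 := by nlinarith [H.κ_le]
    have g9 := mul_le_mul g8 g4 (sq_nonneg _) (by norm_num)
    have g7 := mul_le_mul g6 g9 (by positivity) (by linarith)
    rw [g5]; linarith
  have b22 : |m₂₂ - R| ≤ 20 * B * (τ ^ 2 + e) := by
    have e1 : m₂₂ - R = ((B₁ - R) * (1 + (x₁ - 1)) + R * (x₁ - 1)) +
        2 * (((4 * κ - 2 * κ ^ 2) * (2 * a - 2 * (k * u))) * φ * t ^ 2) := by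
      rw [h₂₂]; ring
    rw [e1]
    have h := abs_add_le_add (abs_add_le_add
      (abs_mul_le_mul hL (abs_add_le_add (abs_one (α := ℝ)).le hx)) (abs_mul_le_mul H.abs_R hx))
      (abs_mul_le_mul (abs_two (α := ℝ)).le (abs_mul_le_mul (abs_mul_le_mul hq' hφ1) H.abs_t_sq))
    refine h.trans ?_
    have g1 : B * (τ ^ 2 + κ) * (1 + 2 * e) ≤ B * (τ ^ 2 + e) * 2 := by
      refine mul_le_mul (mul_le_mul_of_nonneg_left (by linarith) hB) (by linarith) (by linarith)
        (by positivity)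
    have g2 : (κ * σ + κ * k₀) * σ ≤ e := by
      have := mul_le_mul_of_nonneg_left (mul_le_one₀ H.σ_le hσ H.σ_le) hκ
      rw [he]; linarith
    have g3 := mul_le_mul_of_nonneg_left g2 hB
    linarith [mul_nonneg hB hτ0]
  have hρR : |ρ * R'| ≤ B := by
    have h := abs_mul_le_mul hρ H.abs_R'
    have := mul_le_mul_of_nonneg_left (mul_le_one₀ H.σ_le hσ H.σ_le) hB
    linarith
  have c11 := abs_sq_sub_sq_le b11 hρR
  have c22 := abs_sq_sub_sq_le b22 H.abs_R
  have e1 : m₁₁ ^ 2 + m₁₂ ^ 2 + m₂₁ ^ 2 + m₂₂ ^ 2 - (R ^ 2 + (ρ * R') ^ 2) =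
      ((m₁₁ ^ 2 - (ρ * R') ^ 2) + (m₂₂ ^ 2 - R ^ 2)) + (m₁₂ ^ 2 + m₂₁ ^ 2) := by ring
  rw [e1]
  have d := abs_add_le_add (abs_add_le_add c11 c22)
    (abs_of_nonneg (by positivity : 0 ≤ m₁₂ ^ 2 + m₂₁ ^ 2)).le
  refine d.trans ?_
  have hB2 : 0 ≤ B ^ 2 := sq_nonneg B
  have hBE : 0 ≤ B ^ 2 * (τ ^ 2 + e) := by positivity
  have f1 : B ^ 2 * (τ ^ 2 + e) * (τ ^ 2 + e) ≤ B ^ 2 * (τ ^ 2 + e) * (41 / 40) :=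
    mul_le_mul_of_nonneg_left hE hBE
  linarith [mul_nonneg hB2 hτ0]

end IsoData

end Iso
end
noncomputable section

theorem abs_sub_le_add {a b A B : ℝ} (ha : |a| ≤ A) (hb : |b| ≤ B) : |a - b| ≤ A + B :=
  (abs_sub a b).trans (add_le_add ha hb)

/-! ### Normalized estimates on corner elements -/

section Corner

variable {B σ τ κ S m s t ε u a A L R R' : ℝ}

/-- The quantities that enter the estimates on a corner element: `κ = 1 - cos (h/2)`,
`S = sin (h/2)`, `κ = S * m`, and the data `u`, `a`, `A`, `L` of the interpolated profile, with
its value `R` and derivative `R'` at the radius `ε + τ * s`. -/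
structure CornerData (B σ τ κ S m s t ε u a A L R R' : ℝ) : Prop where
  one_le_B : 1 ≤ B
  σ_eq : σ = ε + τ
  σ_le : σ ≤ 1
  τ_nonneg : 0 ≤ τ
  ε_nonneg : 0 ≤ ε
  κ_nonneg : 0 ≤ κ
  small : κ ≤ 1 / 40
  S_sq : S ^ 2 = κ * (2 - κ)
  m_sq : m ^ 2 ≤ κ
  s_nonneg : 0 ≤ s
  s_le : s ≤ 1
  t_nonneg : 0 ≤ t
  t_le : t ≤ 1
  abs_u : |u| ≤ B
  abs_a : |a| ≤ B * σ
  abs_A : |A - R'| ≤ B * τ ^ 2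
  abs_L : |L - R| ≤ B * τ ^ 2
  abs_R : |R| ≤ B
  abs_R' : |R'| ≤ B * σ

namespace CornerData

theorem ρ_le (H : CornerData B σ τ κ S m s t ε u a A L R R') : ε + τ * s ≤ σ := by
  rw [H.σ_eq]; nlinarith [H.τ_nonneg, H.s_le]

theorem ε_le (H : CornerData B σ τ κ S m s t ε u a A L R R') : ε ≤ ε + τ * s := by
  nlinarith [H.τ_nonneg, H.s_nonneg]

theorem τs_nonneg (H : CornerData B σ τ κ S m s t ε u a A L R R') : 0 ≤ τ * s :=
  mul_nonneg H.τ_nonneg H.s_nonneg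

theorem τ_sq_le (H : CornerData B σ τ κ S m s t ε u a A L R R') : τ ^ 2 ≤ 1 :=
  pow_le_one₀ H.τ_nonneg (by linarith [H.σ_eq, H.σ_le, H.ε_nonneg])

theorem κt_nonneg (H : CornerData B σ τ κ S m s t ε u a A L R R') : 0 ≤ κ * t :=
  mul_nonneg H.κ_nonneg H.t_nonneg

theorem κt_le (H : CornerData B σ τ κ S m s t ε u a A L R R') : κ * t ≤ κ :=
  mul_le_of_le_one_right H.κ_nonneg H.t_le

theorem abs_n (H : CornerData B σ τ κ S m s t ε u a A L R R') : |κ + 4 * (1 - κ) * t| ≤ 5 := by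
  have := H.small
  have := H.κ_nonneg
  have := H.t_nonneg
  have := H.t_le
  have := H.κt_nonneg
  have := H.κt_le
  rw [abs_le]
  constructor <;> linarith

theorem abs_l (H : CornerData B σ τ κ S m s t ε u a A L R R') : |κ * (1 - 4 * t)| ≤ 3 * κ := by
  have := H.κt_nonneg
  have := H.κt_le
  have := H.κ_nonneg
  rw [abs_le]
  constructor <;> linarith

theorem abs_κt (H : CornerData B σ τ κ S m s t ε u a A L R R') : |κ * t| ≤ κ := by
  rw [abs_of_nonneg H.κt_nonneg]; exact H.κt_le

theorem abs_ε (H : CornerData B σ τ κ S m s t ε u a A L R R') : |ε| ≤ ε + τ * s := by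
  rw [abs_of_nonneg H.ε_nonneg]; exact H.ε_le

theorem abs_N (H : CornerData B σ τ κ S m s t ε u a A L R R') :
    |ε * (κ + 4 * (1 - κ) * t) + τ * s| ≤ 5 * (ε + τ * s) := by
  have h := abs_add_le_add (abs_mul_le_mul (abs_of_nonneg H.ε_nonneg).le H.abs_n)
    (abs_of_nonneg H.τs_nonneg).le
  linarith [H.τs_nonneg]

theorem abs_ρl (H : CornerData B σ τ κ S m s t ε u a A L R R') :
    |ε * (κ * (1 - 4 * t))| ≤ 3 * κ * (ε + τ * s) := by
  have h := abs_mul_le_mul H.abs_ε H.abs_l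
  linarith

/-- The Jacobian of the geometric map, normalized. -/
theorem abs_jac (H : CornerData B σ τ κ S m s t ε u a A L R R') :
    |((1 - 2 * (κ * t)) * ((ε + τ * s) + ε * (κ * (1 - 4 * t))) +
        2 * (κ * t) * (ε * (κ + 4 * (1 - κ) * t) + τ * s)) - (ε + τ * s)| ≤
      16 * κ * (ε + τ * s) := by
  set ρ := ε + τ * s with hρ
  have h1 := H.abs_ρl
  have h2 := H.abs_N
  have h3 := H.abs_κt
  have hκ := H.κ_nonneg
  have hρ0 : 0 ≤ ρ := H.ε_nonneg.trans H.ε_le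
  rw [← hρ] at h1 h2
  have h4 := abs_add_le_add (abs_sub_le_add h1 (abs_mul_le_mul (abs_two (α := ℝ)).le
    (abs_mul_le_mul h3 (abs_add_le_add (abs_of_nonneg hρ0).le h1))))
    (abs_mul_le_mul (abs_two (α := ℝ)).le (abs_mul_le_mul h3 h2))
  have e1 : ((1 - 2 * (κ * t)) * (ρ + ε * (κ * (1 - 4 * t))) +
        2 * (κ * t) * (ε * (κ + 4 * (1 - κ) * t) + τ * s)) - ρ =
      (ε * (κ * (1 - 4 * t)) - 2 * ((κ * t) * (ρ + ε * (κ * (1 - 4 * t))))) +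
        2 * ((κ * t) * (ε * (κ + 4 * (1 - κ) * t) + τ * s)) := by ring
  rw [e1]
  refine h4.trans ?_
  have : κ * (κ * ρ) ≤ 1 / 40 * (κ * ρ) :=
    mul_le_mul_of_nonneg_right H.small (mul_nonneg hκ hρ0)
  linarith [mul_nonneg hκ hρ0]

/-- On corner elements the Jacobian error is proportional to the local radius itself, so the
two-sided bound already suffices when `κ ≤ 1/40`. -/
theorem jac_lower (H : CornerData B σ τ κ S m s t ε u a A L R R') :
    (ε + τ * s) / 2 ≤ (1 - 2 * (κ * t)) * ((ε + τ * s) + ε * (κ * (1 - 4 * t))) +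
        2 * (κ * t) * (ε * (κ + 4 * (1 - κ) * t) + τ * s) := by
  have h := (abs_le.mp H.abs_jac).1
  have := mul_le_mul_of_nonneg_right H.small (H.ε_nonneg.trans H.ε_le)
  linarith [H.ε_nonneg.trans H.ε_le]

theorem abs_A₁ (H : CornerData B σ τ κ S m s t ε u a A L R R') :
    |A - 4 * (a * (κ * t)) - R'| ≤ B * τ ^ 2 + 4 * B * (κ * σ) := by
  have h := abs_sub_le_add H.abs_A (abs_mul_le_mul (abs_of_nonneg (by norm_num : (0 : ℝ) ≤ 4)).le
    (abs_mul_le_mul H.abs_a H.abs_κt))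
  rw [show A - 4 * (a * (κ * t)) - R' = A - R' - 4 * (a * (κ * t)) by ring]
  linarith

theorem abs_B₁ (H : CornerData B σ τ κ S m s t ε u a A L R R') :
    |L + u * (κ * (1 - 4 * t)) - R| ≤ B * τ ^ 2 + 3 * B * κ := by
  have h := abs_add_le_add H.abs_L (abs_mul_le_mul H.abs_u H.abs_l)
  rw [show L + u * (κ * (1 - 4 * t)) - R = L - R + u * (κ * (1 - 4 * t)) by ring]
  linarith

theorem abs_P (H : CornerData B σ τ κ S m s t ε u a A L R R') :
    |u * (κ + 4 * (1 - κ) * t) + 2 * (a * (τ * s))| ≤ 7 * B := by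
  have hB : 0 ≤ B := by linarith [H.one_le_B]
  have hσ : 0 ≤ σ := by linarith [H.σ_eq, H.ε_nonneg, H.τ_nonneg]
  have hτs : τ * s ≤ 1 := by linarith [H.ρ_le, H.σ_le, H.ε_nonneg]
  have h := abs_add_le_add (abs_mul_le_mul H.abs_u H.abs_n)
    (abs_mul_le_mul (abs_two (α := ℝ)).le
      (abs_mul_le_mul H.abs_a ((abs_of_nonneg H.τs_nonneg).le.trans hτs)))
  linarith [mul_le_mul_of_nonneg_left H.σ_le hB]

/-- The Jacobian of the interpolant, normalized. -/
theorem abs_jac_interp (H : CornerData B σ τ κ S m s t ε u a A L R R') :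
    |((A - 4 * (a * (κ * t))) * (L + u * (κ * (1 - 4 * t))) +
        4 * (a * (κ * t)) * (u * (κ + 4 * (1 - κ) * t) + 2 * (a * (τ * s)))) - R * R'| ≤
      60 * B ^ 2 * (τ ^ 2 + κ * σ) := by
  have h1 := H.abs_A₁
  have h2 := H.abs_B₁
  have h3 := H.abs_P
  set A₁ := A - 4 * (a * (κ * t)) with hA₁
  set B₁ := L + u * (κ * (1 - 4 * t)) with hB₁
  set P := u * (κ + 4 * (1 - κ) * t) + 2 * (a * (τ * s)) with hP
  have e1 : A₁ * B₁ + 4 * (a * (κ * t)) * P - R * R' =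
      (((B₁ - R) * (R' + (A₁ - R'))) + R * (A₁ - R')) + 4 * (a * (κ * t) * P) := by ring
  rw [e1]
  have h4 := abs_add_le_add (abs_add_le_add (abs_mul_le_mul h2 (abs_add_le_add H.abs_R' h1))
    (abs_mul_le_mul H.abs_R h1)) (abs_mul_le_mul (abs_of_nonneg (by norm_num : (0 : ℝ) ≤ 4)).le
      (abs_mul_le_mul (abs_mul_le_mul H.abs_a H.abs_κt) h3))
  refine h4.trans ?_
  have hB : 0 ≤ B := by linarith [H.one_le_B]
  have hB2 : 0 ≤ B ^ 2 := sq_nonneg B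
  have hσ : 0 ≤ σ := by linarith [H.σ_eq, H.ε_nonneg, H.τ_nonneg]
  have hκσ := mul_nonneg H.κ_nonneg hσ
  have hτ0 := sq_nonneg τ
  have g1 : (τ ^ 2 + 3 * κ) * σ ≤ τ ^ 2 + 3 * (κ * σ) := by
    linarith [mul_le_mul_of_nonneg_left H.σ_le hτ0]
  have g2 : (τ ^ 2 + 3 * κ) * (τ ^ 2 + 4 * (κ * σ)) ≤ 2 * (τ ^ 2 + 4 * (κ * σ)) := by
    refine mul_le_mul_of_nonneg_right ?_ (by linarith)
    linarith [H.τ_sq_le, H.small]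
  have i1 := mul_le_mul_of_nonneg_left g1 hB2
  have i2 := mul_le_mul_of_nonneg_left g2 hB2
  linarith [mul_nonneg hB2 hκσ, mul_nonneg hB2 hτ0]

set_option maxHeartbeats 400000 in
/-- The squared Frobenius norm of the gradient of the interpolant, normalized. -/
theorem abs_frob (H : CornerData B σ τ κ S m s t ε u a A L R R') {m₁₁ m₁₂ m₂₁ m₂₂ : ℝ}
    (h₁₁ : m₁₁ = (A - 4 * (a * (κ * t))) * ((ε + τ * s) + ε * (κ * (1 - 4 * t))) +
      2 * (κ * t) * (u * (κ + 4 * (1 - κ) * t) + 2 * (a * (τ * s))))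
    (h₁₂ : m₁₂ = m * ((A - 4 * (a * (κ * t))) * (ε * (κ + 4 * (1 - κ) * t) + τ * s) -
      (u * (κ + 4 * (1 - κ) * t) + 2 * (a * (τ * s))) * (1 - 2 * (κ * t))))
    (h₂₁ : m₂₁ = 2 * S * t * (2 * a * ((ε + τ * s) + ε * (κ * (1 - 4 * t))) -
      (L + u * (κ * (1 - 4 * t)))))
    (h₂₂ : m₂₂ = 4 * (a * (κ * t)) * (ε * (κ + 4 * (1 - κ) * t) + τ * s) +
      (L + u * (κ * (1 - 4 * t))) * (1 - 2 * (κ * t))) :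
    |m₁₁ ^ 2 + m₁₂ ^ 2 + m₂₁ ^ 2 + m₂₂ ^ 2 - (R ^ 2 + ((ε + τ * s) * R') ^ 2)| ≤
      10000 * B ^ 2 * (τ ^ 2 + κ) := by
  have hA := H.abs_A₁
  have hL := H.abs_B₁
  have hP := H.abs_P
  have hN := H.abs_N
  have hl := H.abs_ρl
  have hκt := H.abs_κt
  have hρσ := H.ρ_le
  have hρ0 : 0 ≤ ε + τ * s := H.ε_nonneg.trans H.ε_le
  set A₁ := A - 4 * (a * (κ * t)) with hA₁
  set B₁ := L + u * (κ * (1 - 4 * t)) with hB₁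
  set P := u * (κ + 4 * (1 - κ) * t) + 2 * (a * (τ * s)) with hP'
  set N := ε * (κ + 4 * (1 - κ) * t) + τ * s with hN'
  set l := ε * (κ * (1 - 4 * t)) with hl'
  set ρ := ε + τ * s with hρ
  have hB : 0 ≤ B := by linarith [H.one_le_B]
  have hB2 : 0 ≤ B ^ 2 := sq_nonneg B
  have hσ1 := H.σ_le
  have hρ1 : ρ ≤ 1 := hρσ.trans hσ1
  have hσ : 0 ≤ σ := hρ0.trans hρσ
  have hκ := H.κ_nonneg
  have hκs := H.small
  have hτ0 := sq_nonneg τ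
  have hτ1 := H.τ_sq_le
  have hBτ := mul_nonneg hB hτ0
  have hBκ := mul_nonneg hB hκ
  have hBσ : B * σ ≤ B := mul_le_of_le_one_right hB hσ1
  have hκσ : κ * σ ≤ κ := mul_le_of_le_one_right hκ hσ1
  have hBκσ : B * (κ * σ) ≤ B * κ := mul_le_mul_of_nonneg_left hκσ hB
  have hBκs : B * κ ≤ B * (1 / 40) := mul_le_mul_of_nonneg_left hκs hB
  have hBτ1 : B * τ ^ 2 ≤ B * 1 := mul_le_mul_of_nonneg_left hτ1 hB
  have hE : τ ^ 2 + κ ≤ 41 / 40 := by linarith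
  have hE0 : 0 ≤ τ ^ 2 + κ := by linarith
  have hA' : |A₁ - R'| ≤ 4 * B * (τ ^ 2 + κ) := hA.trans (by linarith)
  have hL' : |B₁ - R| ≤ 3 * B * (τ ^ 2 + κ) := hL.trans (by linarith)
  have hA3 : |A₁| ≤ 3 * B := by
    have := abs_add_le_add (H.abs_R'.trans hBσ) hA
    rw [add_sub_cancel] at this
    linarith
  have hL3 : |B₁| ≤ 3 * B := by
    have := abs_add_le_add H.abs_R hL
    rw [add_sub_cancel] at this
    linarith
  have hl3 : |l| ≤ 3 * κ := hl.trans (mul_le_of_le_one_right (by linarith) hρ1)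
  have hN5 : |N| ≤ 5 := hN.trans (by linarith)
  have hρl : |ρ + l| ≤ 2 := (abs_add_le_add (abs_of_nonneg hρ0).le hl3).trans (by linarith)
  have ha : |a| ≤ B := H.abs_a.trans hBσ
  have hone : |1 - 2 * (κ * t)| ≤ 1 := by
    rw [abs_le]; constructor <;> linarith [H.κt_nonneg, H.κt_le]
  have ht2 : t ^ 2 ≤ 1 := pow_le_one₀ H.t_nonneg H.t_le
  have b11 : |m₁₁ - ρ * R'| ≤ 25 * B * (τ ^ 2 + κ) := by
    have e1 : m₁₁ - ρ * R' = ((A₁ - R') * (ρ + l) + R' * l) + 2 * ((κ * t) * P) := by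
      rw [h₁₁]; ring
    rw [e1]
    have h := abs_add_le_add (abs_add_le_add (abs_mul_le_mul hA' hρl)
      (abs_mul_le_mul (H.abs_R'.trans hBσ) hl3))
      (abs_mul_le_mul (abs_two (α := ℝ)).le (abs_mul_le_mul hκt hP))
    linarith only [h, hBτ, hBκ]
  -- Here the small factor is `m = κ / S` instead of `S`; its square is at most `κ` as well.
  have b12 : m₁₂ ^ 2 ≤ 625 * B ^ 2 * κ := by
    have g1 : |A₁ * N - P * (1 - 2 * (κ * t))| ≤ 25 * B := by
      have h := abs_sub_le_add (abs_mul_le_mul hA3 hN5) (abs_mul_le_mul hP hone)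
      linarith only [h, hB]
    have g4 := pow_le_pow_left₀ (abs_nonneg _) g1 2
    rw [sq_abs] at g4
    have g7 := mul_le_mul H.m_sq g4 (sq_nonneg _) hκ
    rw [h₁₂, mul_pow]; linarith only [g7]
  have b21 : m₂₁ ^ 2 ≤ 400 * B ^ 2 * κ := by
    have g1 : |2 * a * (ρ + l) - B₁| ≤ 7 * B := by
      have h := abs_sub_le_add (abs_mul_le_mul (abs_mul_le_mul (abs_two (α := ℝ)).le ha) hρl) hL3
      linarith only [h, hB]
    have g4 := pow_le_pow_left₀ (abs_nonneg _) g1 2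
    rw [sq_abs] at g4
    have g5 : m₂₁ ^ 2 = 4 * (t ^ 2 * S ^ 2 * (2 * a * (ρ + l) - B₁) ^ 2) := by rw [h₂₁]; ring
    have hS : S ^ 2 ≤ 2 * κ := by rw [H.S_sq]; linarith only [sq_nonneg κ]
    have g6 : t ^ 2 * S ^ 2 ≤ 1 * (2 * κ) := mul_le_mul ht2 hS (sq_nonneg _) (by norm_num)
    have g7 := mul_le_mul g6 g4 (sq_nonneg _) (by linarith only [hκ])
    rw [g5]; linarith only [g7, mul_nonneg hB2 hκ]
  have b22 : |m₂₂ - R| ≤ 30 * B * (τ ^ 2 + κ) := by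
    have e1 : m₂₂ - R = (4 * (a * (κ * t) * N) + (B₁ - R)) - 2 * (B₁ * (κ * t)) := by
      rw [h₂₂]; ring
    rw [e1]
    have h := abs_sub_le_add (abs_add_le_add
      (abs_mul_le_mul (abs_of_nonneg (by norm_num : (0 : ℝ) ≤ 4)).le
        (abs_mul_le_mul (abs_mul_le_mul ha hκt) hN5)) hL')
      (abs_mul_le_mul (abs_two (α := ℝ)).le (abs_mul_le_mul hL3 hκt))
    linarith only [h, hBτ, hBκ]
  have hρR : |ρ * R'| ≤ B := by
    have h := abs_mul_le_mul ((abs_of_nonneg hρ0).le.trans hρ1) (H.abs_R'.trans hBσ)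
    linarith only [h, hB]
  have c11 := abs_sq_sub_sq_le b11 hρR
  have c22 := abs_sq_sub_sq_le b22 H.abs_R
  have e1 : m₁₁ ^ 2 + m₁₂ ^ 2 + m₂₁ ^ 2 + m₂₂ ^ 2 - (R ^ 2 + (ρ * R') ^ 2) =
      ((m₁₁ ^ 2 - (ρ * R') ^ 2) + (m₂₂ ^ 2 - R ^ 2)) + (m₁₂ ^ 2 + m₂₁ ^ 2) := by ring
  rw [e1]
  have d := abs_add_le_add (abs_add_le_add c11 c22)
    (abs_of_nonneg (by positivity : 0 ≤ m₁₂ ^ 2 + m₂₁ ^ 2)).le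
  refine d.trans ?_
  have hBE : 0 ≤ B ^ 2 * (τ ^ 2 + κ) := by positivity
  have f1 : B ^ 2 * (τ ^ 2 + κ) * (τ ^ 2 + κ) ≤ B ^ 2 * (τ ^ 2 + κ) * (41 / 40) :=
    mul_le_mul_of_nonneg_left hE hBE
  linarith only [f1, b12, b21, mul_nonneg hB2 hτ0, mul_nonneg hB2 hκ]

end CornerData
end Corner
end
noncomputable section

/-! ### The radial profile -/

/-- Bounds and Taylor estimates for a profile `r` with first and second derivatives `r'`, `r''`. -/
structure ProfileBounds (r r' r'' : ℝ → ℝ) (c B : ℝ) : Prop where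
  c_pos : 0 < c
  one_le_B : 1 ≤ B
  le_r : ∀ R ∈ Ioc (0 : ℝ) 1, c ≤ r R
  r_le : ∀ R ∈ Ioc (0 : ℝ) 1, r R ≤ B
  le_r' : ∀ R ∈ Ioc (0 : ℝ) 1, c * R ≤ r' R
  r'_le : ∀ R ∈ Ioc (0 : ℝ) 1, r' R ≤ B * R
  hasDerivAt : ∀ R ∈ Ioo (0 : ℝ) 1, HasDerivAt r (r' R) R
  cont_r : ContinuousOn r (Ioc 0 1)
  cont_r' : ContinuousOn r' (Ioc 0 1)
  taylor : ∀ x ∈ Ioc (0 : ℝ) 1, ∀ y ∈ Ioc (0 : ℝ) 1,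
    |r y - r x - r' x * (y - x) - r'' x / 2 * (y - x) ^ 2| ≤ B * |y - x| ^ 3
  taylor_one : ∀ x ∈ Ioc (0 : ℝ) 1, ∀ y ∈ Ioc (0 : ℝ) 1,
    |r y - r x - r' x * (y - x)| ≤ B * |y - x| ^ 2
  lipschitz : ∀ σ ≤ 1, ∀ x ∈ Ioc (0 : ℝ) σ, ∀ y ∈ Ioc (0 : ℝ) σ, |r y - r x| ≤ B * σ * |y - x|

theorem abs_sub_le_of_hasDerivWithinAt {s : Set ℝ} (hs : Convex ℝ s) {f f' : ℝ → ℝ} {C x y : ℝ}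
    (hf : ∀ z ∈ s, HasDerivWithinAt f (f' z) s z) (hx : x ∈ s) (hy : y ∈ s)
    (hC : ∀ z ∈ segment ℝ x y, |f' z| ≤ C) : |f y - f x| ≤ C * |y - x| := by
  have hsub : segment ℝ x y ⊆ s := hs.segment_subset hx hy
  exact (convex_segment x y).norm_image_sub_le_of_norm_hasDerivWithin_le
    (fun z hz => (hf z (hsub hz)).mono hsub) hC (left_mem_segment ℝ x y) (right_mem_segment ℝ x y)

theorem abs_sub_le_of_mem_segment {x y z : ℝ} (hz : z ∈ segment ℝ x y) : |z - x| ≤ |y - x| := by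
  rw [segment_eq_uIcc] at hz
  exact Set.abs_sub_left_of_mem_uIcc hz

/-- The bound on the third derivative makes the second one Lipschitz; the mean value inequality,
applied repeatedly to Taylor remainders, yields the expansions. The factor `σ` in the Lipschitz
bound on `(0, σ]` comes from `r'(R) ≤ M R`. -/
theorem IsCavityProfile.exists_bounds {r : ℝ → ℝ} (hr : IsCavityProfile r) :
    ∃ r'' c B, ProfileBounds r (derivWithin r (Ioc 0 1)) r'' c B := by
  obtain ⟨B, hB⟩ := hr.bounded
  obtain ⟨c, hc, hcr⟩ := hr.inf_pos
  obtain ⟨m, M, hm, hmM, hmr⟩ := hr.deriv_bounds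
  set s : Set ℝ := Ioc 0 1 with hs
  have hconv : Convex ℝ s := convex_Ioc 0 1
  have huniq : UniqueDiffOn ℝ s := uniqueDiffOn_Ioc 0 1
  set D : ℕ → ℝ → ℝ := fun j => iteratedDerivWithin j r s with hD
  have hdiff : ∀ j, ∀ z ∈ s, HasDerivWithinAt (D j) (D (j + 1) z) s z := by
    intro j z hz
    have h := (hr.smooth.differentiableOn_iteratedDerivWithin (m := j)
      (by exact_mod_cast ENat.natCast_lt_top j) huniq) z hz
    have := h.hasDerivWithinAt
    have e : D (j + 1) z = derivWithin (D j) s z := by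
      simp only [hD]; rw [iteratedDerivWithin_succ]
    rw [e]; exact this
  have h0 : D 0 = r := iteratedDerivWithin_zero
  have h1 : D 1 = derivWithin r s := by
    exact iteratedDerivWithin_one
  have hcont : ∀ j, ContinuousOn (D j) s := fun j z hz => (hdiff j z hz).continuousWithinAt
  have hC0 : 0 ≤ B := (abs_nonneg _).trans (hB 0 (by norm_num) 1 ⟨one_pos, le_rfl⟩)
  have hlip2 : ∀ x ∈ s, ∀ y ∈ s, |D 2 y - D 2 x| ≤ B * |y - x| := fun x hx y hy =>
    abs_sub_le_of_hasDerivWithinAt hconv (hdiff 2) hx hy fun z hz =>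
      hB 3 le_rfl z (hconv.segment_subset hx hy hz)
  have htay1 : ∀ x ∈ s, ∀ y ∈ s, |D 1 y - D 1 x - D 2 x * (y - x)| ≤ B * |y - x| ^ 2 := by
    intro x hx y hy
    have h := abs_sub_le_of_hasDerivWithinAt hconv (f := fun z => D 1 z - D 2 x * (z - x))
      (f' := fun z => D 2 z - D 2 x * 1) (C := B * |y - x|)
      (fun z hz => (hdiff 1 z hz).sub
        (((hasDerivWithinAt_id z s).sub_const x).const_mul (D 2 x))) hx hy (fun z hz => by
        rw [mul_one]
        exact (hlip2 x hx z (hconv.segment_subset hx hy hz)).trans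
          (mul_le_mul_of_nonneg_left (abs_sub_le_of_mem_segment hz) hC0))
    simp only [sub_self, mul_zero, sub_zero] at h
    calc _ = |D 1 y - D 2 x * (y - x) - D 1 x| := by congr 1; ring
      _ ≤ _ := h
      _ = _ := by ring
  have htay2 : ∀ x ∈ s, ∀ y ∈ s,
      |D 0 y - D 0 x - D 1 x * (y - x) - D 2 x / 2 * (y - x) ^ 2| ≤ B * |y - x| ^ 3 := by
    intro x hx y hy
    have h := abs_sub_le_of_hasDerivWithinAt hconv
      (f := fun z => D 0 z - D 1 x * (z - x) - D 2 x / 2 * (z - x) ^ 2)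
      (f' := fun z => D 1 z - D 1 x * 1 - D 2 x / 2 * (2 * (z - x) ^ 1 * 1)) (C := B * |y - x| ^ 2)
      (fun z hz => ((hdiff 0 z hz).sub
        (((hasDerivWithinAt_id z s).sub_const x).const_mul (D 1 x))).sub
        ((((hasDerivWithinAt_id z s).sub_const x).pow 2).const_mul (D 2 x / 2))) hx hy
        (fun z hz => by
        rw [show D 1 z - D 1 x * 1 - D 2 x / 2 * (2 * (z - x) ^ 1 * 1) =
          D 1 z - D 1 x - D 2 x * (z - x) by ring]
        refine (htay1 x hx z (hconv.segment_subset hx hy hz)).trans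
          (mul_le_mul_of_nonneg_left ?_ hC0)
        exact pow_le_pow_left₀ (abs_nonneg _) (abs_sub_le_of_mem_segment hz) 2)
    simp only [sub_self, mul_zero, sub_zero] at h
    calc _ = |D 0 y - D 1 x * (y - x) - D 2 x / 2 * (y - x) ^ 2 -
          (D 0 x - D 2 x / 2 * 0 ^ 2)| := by
          congr 1; ring
      _ ≤ _ := h
      _ = _ := by ring
  have hlip1 : ∀ x ∈ s, ∀ y ∈ s, |D 1 y - D 1 x| ≤ B * |y - x| := fun x hx y hy =>
    abs_sub_le_of_hasDerivWithinAt hconv (hdiff 1) hx hy fun z hz =>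
      hB 2 (by norm_num) z (hconv.segment_subset hx hy hz)
  have htayl : ∀ x ∈ s, ∀ y ∈ s, |D 0 y - D 0 x - D 1 x * (y - x)| ≤ B * |y - x| ^ 2 := by
    intro x hx y hy
    have h := abs_sub_le_of_hasDerivWithinAt hconv (f := fun z => D 0 z - D 1 x * (z - x))
      (f' := fun z => D 1 z - D 1 x * 1) (C := B * |y - x|)
      (fun z hz => (hdiff 0 z hz).sub
        (((hasDerivWithinAt_id z s).sub_const x).const_mul (D 1 x))) hx hy (fun z hz => by
        rw [mul_one]
        exact (hlip1 x hx z (hconv.segment_subset hx hy hz)).trans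
          (mul_le_mul_of_nonneg_left (abs_sub_le_of_mem_segment hz) hC0))
    simp only [sub_self, mul_zero, sub_zero] at h
    calc _ = |D 0 y - D 1 x * (y - x) - D 0 x| := by congr 1; ring
      _ ≤ _ := h
      _ = _ := by ring
  set B' := max (max B M) 1 with hB'
  have hBB : B ≤ B' := (le_max_left _ _).trans (le_max_left _ _)
  have hMB : M ≤ B' := (le_max_right _ _).trans (le_max_left _ _)
  rw [h0, h1] at htayl htay2
  -- One lower constant serves for `r` and `r'(R)/R`, and one upper constant, made at least `1`, for
  -- all the upper bounds.
  refine ⟨D 2, min c m, B', ?_⟩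
  refine
    { c_pos := lt_min hc hm
      one_le_B := le_max_right _ _
      le_r := fun R hR => (min_le_left _ _).trans (hcr R hR)
      r_le := fun R hR => ?_
      le_r' := fun R hR =>
        (mul_le_mul_of_nonneg_right (min_le_right _ _) hR.1.le).trans (hmr R hR).1
      r'_le := fun R hR => (hmr R hR).2.trans (mul_le_mul_of_nonneg_right hMB hR.1.le)
      hasDerivAt := fun R hR => ?_
      cont_r := h0 ▸ hcont 0
      cont_r' := h1 ▸ hcont 1
      taylor := fun x hx y hy => (htay2 x hx y hy).trans
        (mul_le_mul_of_nonneg_right hBB (by positivity))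
      taylor_one := fun x hx y hy => (htayl x hx y hy).trans
        (mul_le_mul_of_nonneg_right hBB (by positivity))
      lipschitz := fun σ hσ x hx y hy => ?_ }
  · have := hB 0 (by norm_num) R hR
    change |D 0 R| ≤ B at this
    rw [h0] at this
    exact (le_abs_self _).trans (this.trans hBB)
  · have h := hdiff 0 R ⟨hR.1, hR.2.le⟩
    rw [h0, zero_add, h1] at h
    exact h.hasDerivAt (Ioc_mem_nhds hR.1 hR.2)
  · have hsub : Ioc (0 : ℝ) σ ⊆ s := Ioc_subset_Ioc_right hσ
    refine abs_sub_le_of_hasDerivWithinAt (s := s) hconv (f' := D 1)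
      (fun z hz => by have := hdiff 0 z hz; rwa [h0] at this) (hsub hx) (hsub hy) fun z hz => ?_
    have hz' : z ∈ Ioc 0 σ := (convex_Ioc 0 σ).segment_subset hx hy hz
    rw [h1, abs_of_nonneg ((mul_nonneg hm.le hz'.1.le).trans (hmr z (hsub hz')).1)]
    refine (hmr z (hsub hz')).2.trans ?_
    exact mul_le_mul hMB hz'.2 hz'.1.le (by linarith [le_max_right (max B M) 1])

namespace ProfileBounds

variable {r r' r'' : ℝ → ℝ} {c B : ℝ}

theorem B_nonneg (H : ProfileBounds r r' r'' c B) : 0 ≤ B := zero_le_one.trans H.one_le_B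

theorem abs_r (H : ProfileBounds r r' r'' c B) {R : ℝ} (hR : R ∈ Ioc (0 : ℝ) 1) : |r R| ≤ B := by
  rw [abs_of_nonneg (H.c_pos.le.trans (H.le_r R hR))]
  exact H.r_le R hR

theorem abs_r' (H : ProfileBounds r r' r'' c B) {R : ℝ} (hR : R ∈ Ioc (0 : ℝ) 1) :
    |r' R| ≤ B * R := by
  rw [abs_of_nonneg ((mul_nonneg H.c_pos.le hR.1.le).trans (H.le_r' R hR))]
  exact H.r'_le R hR

/-- The derivative of the quadratic interpolant of the profile. -/
theorem abs_quadratic_deriv (H : ProfileBounds r r' r'' c B) {x y w : ℝ} (hx : x ∈ Ioc (0 : ℝ) 1)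
    (hy : y ∈ Ioc (0 : ℝ) 1) (hw : 0 ≤ w) (hw1 : w ≤ 1) :
    |(4 * r ((x + y) / 2) - 3 * r x - r y) * (1 - 2 * w) + 2 * w * (r y - r x) -
      (y - x) * r' (x + (y - x) * w)| ≤ 10 * B * |y - x| ^ 3 := by
  set ρ := x + (y - x) * w with hρ
  have hmem : ∀ a : ℝ, 0 ≤ a → a ≤ 1 → x + (y - x) * a ∈ Ioc (0 : ℝ) 1 := by
    intro a ha ha1
    have := (convex_Ioc (0 : ℝ) 1) hx hy (sub_nonneg.mpr ha1) ha (by ring)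
    simp only [smul_eq_mul] at this
    convert this using 1
    ring
  have hρm : ρ ∈ Ioc (0 : ℝ) 1 := hmem w hw hw1
  have hm : (x + y) / 2 ∈ Ioc (0 : ℝ) 1 := by
    have := hmem (1 / 2) (by norm_num) (by norm_num)
    convert this using 1
    ring
  have hB := H.B_nonneg
  have key : ∀ z ∈ Ioc (0 : ℝ) 1, |z - ρ| ≤ |y - x| →
      |r z - r ρ - r' ρ * (z - ρ) - r'' ρ / 2 * (z - ρ) ^ 2| ≤ B * |y - x| ^ 3 := fun z hz hzd =>
    (H.taylor ρ hρm z hz).trans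
      (mul_le_mul_of_nonneg_left (pow_le_pow_left₀ (abs_nonneg _) hzd 3) hB)
  have hd : ∀ z a : ℝ, z - ρ = (y - x) * a → |a| ≤ 1 → |z - ρ| ≤ |y - x| := by
    intro z a hz ha
    rw [hz, abs_mul]
    exact mul_le_of_le_one_right (abs_nonneg _) ha
  have k0 := key x hx (hd x (-w) (by rw [hρ]; ring) (by rw [abs_neg, abs_of_nonneg hw]; exact hw1))
  have k1 := key y hy (hd y (1 - w) (by rw [hρ]; ring)
    (by rw [abs_of_nonneg] <;> linarith))
  have k2 := key _ hm (hd _ (1 / 2 - w) (by rw [hρ]; ring)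
    (by rw [abs_le]; constructor <;> linarith))
  -- The expression combines the values at `x`, `y` and the midpoint with these three weights. The
  -- rule is exact on quadratics, so only the Taylor remainders about `ρ` survive, with total weight
  -- at most `3 + 3 + 4 = 10`.
  have a0 : |-3 + 4 * w| ≤ 3 := by rw [abs_le]; constructor <;> linarith
  have a1 : |4 * w - 1| ≤ 3 := by rw [abs_le]; constructor <;> linarith
  have a2 : |4 * (1 - 2 * w)| ≤ 4 := by rw [abs_le]; constructor <;> linarith
  have h := abs_add_le_add (abs_add_le_add (abs_mul_le_mul a0 k0) (abs_mul_le_mul a1 k1))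
    (abs_mul_le_mul a2 k2)
  refine le_trans (le_of_eq ?_) (h.trans (le_of_eq (by ring)))
  congr 1
  have hw' : (y - x) * w = ρ - x := by rw [hρ]; ring
  have e : ρ = x + (y - x) * w := hρ
  clear_value ρ
  subst e
  ring

/-- The linear interpolant of the profile through the end point and the midpoint. -/
theorem abs_linear_interp (H : ProfileBounds r r' r'' c B) {x y w : ℝ} (hx : x ∈ Ioc (0 : ℝ) 1)
    (hy : y ∈ Ioc (0 : ℝ) 1) (hw : 0 ≤ w) (hw1 : w ≤ 1) :
    |(1 - w) * (2 * r ((x + y) / 2) - r y) + w * r y - r (x + (y - x) * w)| ≤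
      10 * B * |y - x| ^ 2 := by
  set ρ := x + (y - x) * w with hρ
  have hmem : ∀ a : ℝ, 0 ≤ a → a ≤ 1 → x + (y - x) * a ∈ Ioc (0 : ℝ) 1 := by
    intro a ha ha1
    have := (convex_Ioc (0 : ℝ) 1) hx hy (sub_nonneg.mpr ha1) ha (by ring)
    simp only [smul_eq_mul] at this
    convert this using 1
    ring
  have hρm : ρ ∈ Ioc (0 : ℝ) 1 := hmem w hw hw1
  have hm : (x + y) / 2 ∈ Ioc (0 : ℝ) 1 := by
    have := hmem (1 / 2) (by norm_num) (by norm_num)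
    convert this using 1
    ring
  have hB := H.B_nonneg
  have key : ∀ z ∈ Ioc (0 : ℝ) 1, |z - ρ| ≤ |y - x| →
      |r z - r ρ - r' ρ * (z - ρ)| ≤ B * |y - x| ^ 2 := fun z hz hzd =>
    (H.taylor_one ρ hρm z hz).trans
      (mul_le_mul_of_nonneg_left (pow_le_pow_left₀ (abs_nonneg _) hzd 2) hB)
  have hd : ∀ z a : ℝ, z - ρ = (y - x) * a → |a| ≤ 1 → |z - ρ| ≤ |y - x| := by
    intro z a hz ha
    rw [hz, abs_mul]
    exact mul_le_of_le_one_right (abs_nonneg _) ha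
  have k1 := key y hy (hd y (1 - w) (by rw [hρ]; ring)
    (by rw [abs_of_nonneg] <;> linarith))
  have k2 := key _ hm (hd _ (1 / 2 - w) (by rw [hρ]; ring)
    (by rw [abs_le]; constructor <;> linarith))
  -- The weights of the values at `y` and at the midpoint sum to one and reproduce affine functions,
  -- so first-order Taylor remainders suffice.
  have a1 : |2 * w - 1| ≤ 1 := by rw [abs_le]; constructor <;> linarith
  have a2 : |2 * (1 - w)| ≤ 2 := by rw [abs_le]; constructor <;> linarith
  have h := abs_add_le_add (abs_mul_le_mul a1 k1) (abs_mul_le_mul a2 k2)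
  have hBy : 0 ≤ B * |y - x| ^ 2 := by positivity
  refine le_trans (le_of_eq ?_) (h.trans (by linarith))
  congr 1
  have e : ρ = x + (y - x) * w := hρ
  clear_value ρ
  subst e
  ring

end ProfileBounds
end
noncomputable section

/-! ### Radial maps at the nodes -/

/-- `v` maps the point with polar coordinates `(ρ, θ)` to that with coordinates `(f ρ, θ)`. -/
def IsPolarMap (f : ℝ → ℝ) (v : Plane → Plane) : Prop :=
  ∀ ρ > 0, ∀ θ, v (polarPoint ρ θ) = polarPoint (f ρ) θ

theorem isPolarMap_id : IsPolarMap id id := fun _ _ _ => rfl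

theorem norm_polarPoint {ρ : ℝ} (hρ : 0 ≤ ρ) (θ : ℝ) : ‖polarPoint ρ θ‖ = ρ := by
  rw [EuclideanSpace.norm_eq, Fin.sum_univ_two]
  simp only [polarPoint, PiLp.toLp_apply, Matrix.cons_val_zero, Matrix.cons_val_one,
    Real.norm_eq_abs, sq_abs]
  rw [show (ρ * Real.cos θ) ^ 2 + (ρ * Real.sin θ) ^ 2 =
    ρ ^ 2 * (Real.cos θ ^ 2 + Real.sin θ ^ 2) by ring, Real.cos_sq_add_sin_sq, mul_one,
    Real.sqrt_sq hρ]

theorem isPolarMap_radialMap (r : ℝ → ℝ) : IsPolarMap r (radialMap r) := by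
  intro ρ hρ θ
  rw [radialMap, norm_polarPoint hρ.le]
  ext i
  fin_cases i <;> simp [polarPoint] <;> field_simp

@[simp] theorem polarPoint_zero (ρ θ : ℝ) : polarPoint ρ θ 0 = ρ * Real.cos θ := rfl

@[simp] theorem polarPoint_one (ρ θ : ℝ) : polarPoint ρ θ 1 = ρ * Real.sin θ := rfl

/-! ### Rotated frames -/

namespace PolarTriangle

variable {T : PolarTriangle} {v : Plane → Plane} {x : Plane}

/-- The partial derivatives of the interpolant are the rotations by the angle `c` of the vectors
`(a₀, b₀)` and `(a₁, b₁)`. -/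
structure HasParts (T : PolarTriangle) (v : Plane → Plane) (x : Plane) (c a₀ b₀ a₁ b₁ : ℝ) :
    Prop where
  h₀₀ : T.part₀ v x 0 = Real.cos c * a₀ - Real.sin c * b₀
  h₀₁ : T.part₀ v x 1 = Real.sin c * a₀ + Real.cos c * b₀
  h₁₀ : T.part₁ v x 0 = Real.cos c * a₁ - Real.sin c * b₁
  h₁₁ : T.part₁ v x 1 = Real.sin c * a₁ + Real.cos c * b₁

theorem HasParts.jac_eq {c a₀ b₀ a₁ b₁ : ℝ} (H : HasParts T v x c a₀ b₀ a₁ b₁) :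
    T.jac v x = a₀ * b₁ - a₁ * b₀ := by
  rw [jac, H.h₀₀, H.h₀₁, H.h₁₀, H.h₁₁]
  linear_combination (a₀ * b₁ - a₁ * b₀) * Real.cos_sq_add_sin_sq c

theorem HasParts.frobNum_eq {c a₀ b₀ a₁ b₁ A₀ B₀ A₁ B₁ : ℝ} (H : HasParts T v x c a₀ b₀ a₁ b₁)
    (H' : HasParts T id x c A₀ B₀ A₁ B₁) :
    T.frobNum v x = (a₀ * B₁ - a₁ * B₀) ^ 2 + (a₁ * A₀ - a₀ * A₁) ^ 2 +
      (b₀ * B₁ - b₁ * B₀) ^ 2 + (b₁ * A₀ - b₀ * A₁) ^ 2 := by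
  have h : T.frobNum v x = (Real.cos c ^ 2 + Real.sin c ^ 2) ^ 2 *
      ((a₀ * B₁ - a₁ * B₀) ^ 2 + (a₁ * A₀ - a₀ * A₁) ^ 2 +
        (b₀ * B₁ - b₁ * B₀) ^ 2 + (b₁ * A₀ - b₀ * A₁) ^ 2) := by
    rw [frobNum, H.h₀₀, H.h₀₁, H.h₁₀, H.h₁₁, H'.h₀₀, H'.h₀₁, H'.h₁₀, H'.h₁₁]
    ring
  rw [h, Real.cos_sq_add_sin_sq, one_pow, one_mul]

end PolarTriangle

/-! ### Isosceles elements -/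

/-- The element with apex radius `φ₀`, base radius `φ₁`, axis at the angle `c`. -/
def isoElement (φ₀ φ₁ c h : ℝ) : PolarTriangle := ⟨![φ₀, φ₁, φ₁], ![c, c - h, c + h]⟩

/-- The element with vertices at `(ε, c)`, `(ε + τ, c)` and `(ε, c + h)`. -/
def cornerElement (ε τ c h : ℝ) : PolarTriangle := ⟨![ε, ε + τ, ε], ![c, c, c + h]⟩

/-- The element with vertices at `(ε, c)`, `(ε, c + h)` and `(ε + τ, c)`. -/
def cornerElement' (ε τ c h : ℝ) : PolarTriangle := ⟨![ε, ε, ε + τ], ![c, c + h, c]⟩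

section Nodes

variable {f : ℝ → ℝ} {v : Plane → Plane} {φ₀ φ₁ c h ε τ : ℝ}

theorem iso_nodes (hv : IsPolarMap f v) (h₀ : 0 < φ₀) (h₁ : 0 < φ₁) :
    v ((isoElement φ₀ φ₁ c h).vertex 0) = polarPoint (f φ₀) c ∧
    v ((isoElement φ₀ φ₁ c h).vertex 1) = polarPoint (f φ₁) (c - h) ∧
    v ((isoElement φ₀ φ₁ c h).vertex 2) = polarPoint (f φ₁) (c + h) ∧
    v ((isoElement φ₀ φ₁ c h).edgeNode 0 1) = polarPoint (f ((φ₀ + φ₁) / 2)) (c - h / 2) ∧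
    v ((isoElement φ₀ φ₁ c h).edgeNode 0 2) = polarPoint (f ((φ₀ + φ₁) / 2)) (c + h / 2) ∧
    v ((isoElement φ₀ φ₁ c h).edgeNode 1 2) = polarPoint (f φ₁) c := by
  have e1 : (c + (c - h)) / 2 = c - h / 2 := by ring
  have e2 : (c + (c + h)) / 2 = c + h / 2 := by ring
  have e3 : (c - h + (c + h)) / 2 = c := by ring
  have e4 : (φ₁ + φ₁) / 2 = φ₁ := by ring
  have hm : 0 < (φ₀ + φ₁) / 2 := by positivity
  refine ⟨?_, ?_, ?_, ?_, ?_, ?_⟩ <;>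
    simp [PolarTriangle.vertex, PolarTriangle.edgeNode, isoElement, e1, e2, e4, hv _ h₀,
      hv _ h₁, hv _ hm]

theorem corner_nodes (hv : IsPolarMap f v) (hε : 0 < ε) (hτ : 0 < τ) :
    v ((cornerElement ε τ c h).vertex 0) = polarPoint (f ε) c ∧
    v ((cornerElement ε τ c h).vertex 1) = polarPoint (f (ε + τ)) c ∧
    v ((cornerElement ε τ c h).vertex 2) = polarPoint (f ε) (c + h) ∧
    v ((cornerElement ε τ c h).edgeNode 0 1) = polarPoint (f ((ε + (ε + τ)) / 2)) c ∧
    v ((cornerElement ε τ c h).edgeNode 0 2) = polarPoint (f ε) (c + h / 2) ∧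
    v ((cornerElement ε τ c h).edgeNode 1 2) =
      polarPoint (f ((ε + (ε + τ)) / 2)) (c + h / 2) := by
  have e2 : (c + (c + h)) / 2 = c + h / 2 := by ring
  have e3 : (c + c) / 2 = c := by ring
  have e4 : (ε + ε) / 2 = ε := by ring
  have e5 : (ε + τ + ε) / 2 = (ε + (ε + τ)) / 2 := by ring
  have hm : 0 < (ε + (ε + τ)) / 2 := by positivity
  have h1 : 0 < ε + τ := by positivity
  refine ⟨?_, ?_, ?_, ?_, ?_, ?_⟩ <;>
    simp [PolarTriangle.vertex, PolarTriangle.edgeNode, cornerElement, e2, e3, e4, e5, hv _ hε,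
      hv _ h1, hv _ hm]

theorem corner_nodes' (hv : IsPolarMap f v) (hε : 0 < ε) (hτ : 0 < τ) :
    v ((cornerElement' ε τ c h).vertex 0) = polarPoint (f ε) c ∧
    v ((cornerElement' ε τ c h).vertex 1) = polarPoint (f ε) (c + h) ∧
    v ((cornerElement' ε τ c h).vertex 2) = polarPoint (f (ε + τ)) c ∧
    v ((cornerElement' ε τ c h).edgeNode 0 1) = polarPoint (f ε) (c + h / 2) ∧
    v ((cornerElement' ε τ c h).edgeNode 0 2) = polarPoint (f ((ε + (ε + τ)) / 2)) c ∧
    v ((cornerElement' ε τ c h).edgeNode 1 2) =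
      polarPoint (f ((ε + (ε + τ)) / 2)) (c + h / 2) := by
  have e2 : (c + (c + h)) / 2 = c + h / 2 := by ring
  have e2' : (c + h + c) / 2 = c + h / 2 := by ring
  have e3 : (c + c) / 2 = c := by ring
  have e4 : (ε + ε) / 2 = ε := by ring
  have hm : 0 < (ε + (ε + τ)) / 2 := by positivity
  have h1 : 0 < ε + τ := by positivity
  refine ⟨?_, ?_, ?_, ?_, ?_, ?_⟩ <;>
    simp [PolarTriangle.vertex, PolarTriangle.edgeNode, cornerElement', e2, e2', e3, e4,
      hv _ hε, hv _ h1, hv _ hm]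

end Nodes

/-! ### Partial derivatives of the interpolants in the frame of the element -/

section Parts

variable {f : ℝ → ℝ} {v : Plane → Plane} {φ₀ φ₁ c h ε τ κ S m a A L : ℝ} {x : Plane}

theorem cos_of_half (hS : Real.sin (h / 2) = S) :
    Real.cos h = 1 - 2 * S ^ 2 := by
  have := Real.cos_two_mul (h / 2)
  rw [show 2 * (h / 2) = h by ring] at this
  have h2 := Real.cos_sq_add_sin_sq (h / 2)
  rw [hS] at h2
  linarith

theorem sin_of_half (hκ : Real.cos (h / 2) = 1 - κ) (hS : Real.sin (h / 2) = S) :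
    Real.sin h = 2 * S * (1 - κ) := by
  have := Real.sin_two_mul (h / 2)
  rwa [show 2 * (h / 2) = h by ring, hκ, hS] at this

theorem sq_of_half (hκ : Real.cos (h / 2) = 1 - κ) (hS : Real.sin (h / 2) = S) :
    S ^ 2 = κ * (2 - κ) := by
  have h2 := Real.cos_sq_add_sin_sq (h / 2)
  rw [hS, hκ] at h2
  linarith

/-- `w` runs along the axis and `t` across it. The vectors `W` and `T` are the derivatives in `w`
and `t`, whence the combinations `W - T` and `W + T`. `A` is the slope of the quadratic interpolant
of the profile; `L` is the affine function through the values at the base and at the midpoint, as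
the apex lies on the axis and does not contribute to the transverse derivative. -/
theorem iso_hasParts (hv : IsPolarMap f v) (h₀ : 0 < φ₀) (h₁ : 0 < φ₁) (hne : φ₁ - φ₀ ≠ 0)
    (hκ : Real.cos (h / 2) = 1 - κ) (hS : Real.sin (h / 2) = S)
    {w t Δ W₁ W₂ T₁ T₂ : ℝ} (hw : w = x 0 + x 1) (ht : t = x 1 - x 0) (hΔ : Δ = φ₁ - φ₀)
    (ha : a = (f φ₁ - f ((φ₀ + φ₁) / 2)) / Δ)
    (hA : A = ((4 * f ((φ₀ + φ₁) / 2) - 3 * f φ₀ - f φ₁) * (1 - 2 * w) +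
      2 * w * (f φ₁ - f φ₀)) / Δ)
    (hL : L = (1 - w) * (2 * f ((φ₀ + φ₁) / 2) - f φ₁) + w * f φ₁)
    (hW₁ : W₁ = Δ * (A + (1 - 2 * w) * (4 * (κ * a) - 2 * (κ * (κ / Δ) * f φ₁))))
    (hW₂ : W₂ = 2 * S * Δ * (2 * a - 2 * (κ / Δ * f φ₁)) * t)
    (hT₁ : T₁ = - 2 * (4 * κ - 2 * κ ^ 2) * f φ₁ * t)
    (hT₂ : T₂ = 2 * S * (L + (1 - 2 * w) * (κ * f φ₁))) :
    (isoElement φ₀ φ₁ c h).HasParts v x c (W₁ - T₁) (W₂ - T₂) (W₁ + T₁) (W₂ + T₂) := by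
  obtain ⟨n0, n1, n2, n3, n4, n5⟩ := iso_nodes (c := c) (h := h) hv h₀ h₁
  have hΔ0 : Δ ≠ 0 := hΔ ▸ hne
  have hc := cos_of_half hS
  have hs := sin_of_half hκ hS
  have hq := sq_of_half hκ hS
  set u₀ := f φ₀
  set u₁ := f φ₁
  set um := f ((φ₀ + φ₁) / 2)
  have hW₁' : W₁ = (4 * um - 3 * u₀ - u₁) * (1 - 2 * w) + 2 * w * (u₁ - u₀) +
      (1 - 2 * w) * (4 * κ * (u₁ - um) - 2 * κ ^ 2 * u₁) := by
    rw [hW₁, hA, ha]; field_simp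
  have hW₂' : W₂ = 2 * S * (2 * (u₁ - um) - 2 * κ * u₁) * t := by
    rw [hW₂, ha]; field_simp
  constructor
  · rw [PolarTriangle.part₀_apply, n0, n1, n3, n4, n5, hW₁', hW₂', hT₁, hT₂, hL, hw, ht]
    simp only [polarPoint_zero, Real.cos_sub, Real.cos_add, hc, hs, hκ, hS, hq]
    ring
  · rw [PolarTriangle.part₀_apply, n0, n1, n3, n4, n5, hW₁', hW₂', hT₁, hT₂, hL, hw, ht]
    simp only [polarPoint_one, Real.sin_sub, Real.sin_add, hc, hs, hκ, hS, hq]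
    ring
  · rw [PolarTriangle.part₁_apply, n0, n2, n3, n4, n5, hW₁', hW₂', hT₁, hT₂, hL, hw, ht]
    simp only [polarPoint_zero, Real.cos_sub, Real.cos_add, hc, hs, hκ, hS, hq]
    ring
  · rw [PolarTriangle.part₁_apply, n0, n2, n3, n4, n5, hW₁', hW₂', hT₁, hT₂, hL, hw, ht]
    simp only [polarPoint_one, Real.sin_sub, Real.sin_add, hc, hs, hκ, hS, hq]
    ring

/-- Writing `κ = S m` exposes a common factor `S` in the second partial derivative, so that division
by the area scale `2 S τ` creates no quotient `κ / S`. -/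
theorem corner_hasParts (hv : IsPolarMap f v) (hε : 0 < ε) (hτ : 0 < τ)
    (hκ : Real.cos (h / 2) = 1 - κ) (hS : Real.sin (h / 2) = S) (hm : κ = S * m)
    {s t : ℝ} (hs : s = x 0) (ht : t = x 1)
    (ha : a = (f ((ε + (ε + τ)) / 2) - f ε) / τ)
    (hA : A = ((4 * f ((ε + (ε + τ)) / 2) - 3 * f ε - f (ε + τ)) * (1 - 2 * s) +
      2 * s * (f (ε + τ) - f ε)) / τ)
    (hL : L = f ε + 2 * (a * (τ * s))) :
    (cornerElement ε τ c h).HasParts v x c (τ * (A - 4 * (a * (κ * t)))) (τ * (4 * (a * S * t)))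
      (2 * S * (-m * (f ε * (κ + 4 * (1 - κ) * t) + 2 * (a * (τ * s)))))
      (2 * S * (L + f ε * (κ * (1 - 4 * t)))) := by
  obtain ⟨n0, n1, n2, n3, n4, n5⟩ := corner_nodes (c := c) (h := h) hv hε hτ
  have hc := cos_of_half hS
  have hs' := sin_of_half hκ hS
  have hq := sq_of_half hκ hS
  set u₀ := f ε
  set u₁ := f (ε + τ)
  set um := f ((ε + (ε + τ)) / 2)
  have g1 : τ * (A - 4 * (a * (κ * t))) = (4 * um - 3 * u₀ - u₁) * (1 - 2 * s) +
      2 * s * (u₁ - u₀) - 4 * (um - u₀) * κ * t := by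
    rw [hA, ha]; field_simp
  have g2 : τ * (4 * (a * S * t)) = 4 * (um - u₀) * S * t := by rw [ha]; field_simp
  have g3 : 2 * S * (-m * (u₀ * (κ + 4 * (1 - κ) * t) + 2 * (a * (τ * s)))) =
      -2 * κ * (u₀ * (κ + 4 * (1 - κ) * t) + 2 * ((um - u₀) * s)) := by
    have : a * (τ * s) = (um - u₀) * s := by rw [ha]; field_simp
    rw [this, hm]; ring
  have g4 : 2 * S * (L + u₀ * (κ * (1 - 4 * t))) =
      2 * S * (u₀ + 2 * ((um - u₀) * s) + u₀ * (κ * (1 - 4 * t))) := by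
    have : a * (τ * s) = (um - u₀) * s := by rw [ha]; field_simp
    rw [hL, this]
  rw [g1, g2, g3, g4]
  constructor
  · rw [PolarTriangle.part₀_apply, n0, n1, n3, n4, n5, hs, ht]
    simp only [polarPoint_zero, Real.cos_add, hκ, hS]
    ring
  · rw [PolarTriangle.part₀_apply, n0, n1, n3, n4, n5, hs, ht]
    simp only [polarPoint_one, Real.sin_add, hκ, hS]
    ring
  · rw [PolarTriangle.part₁_apply, n0, n2, n3, n4, n5, hs, ht]
    simp only [polarPoint_zero, Real.cos_add, hc, hs', hκ, hS, hq]
    ring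
  · rw [PolarTriangle.part₁_apply, n0, n2, n3, n4, n5, hs, ht]
    simp only [polarPoint_one, Real.sin_add, hc, hs', hκ, hS, hq]
    ring

/-- The elements `cornerElement` and `cornerElement'` differ by the order of their vertices. -/
theorem corner_hasParts' (hv : IsPolarMap f v) (hε : 0 < ε) (hτ : 0 < τ) {y : Plane}
    (hy0 : y 0 = x 1) (hy1 : y 1 = x 0) {a₀ b₀ a₁ b₁ : ℝ}
    (H : (cornerElement ε τ c h).HasParts v y c a₀ b₀ a₁ b₁) :
    (cornerElement' ε τ c h).HasParts v x c a₁ b₁ a₀ b₀ := by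
  obtain ⟨n0, n1, n2, n3, n4, n5⟩ := corner_nodes (c := c) (h := h) hv hε hτ
  obtain ⟨k0, k1, k2, k3, k4, k5⟩ := corner_nodes' (c := c) (h := h) hv hε hτ
  have e0 : (cornerElement' ε τ c h).part₀ v x = (cornerElement ε τ c h).part₁ v y := by
    ext i
    rw [PolarTriangle.part₀_apply, PolarTriangle.part₁_apply, n0, n2, n3, n4, n5, k0, k1, k3,
      k4, k5, hy0, hy1]
    ring
  have e1 : (cornerElement' ε τ c h).part₁ v x = (cornerElement ε τ c h).part₀ v y := by
    ext i
    rw [PolarTriangle.part₀_apply, PolarTriangle.part₁_apply, n0, n1, n3, n4, n5, k0, k2, k3,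
      k4, k5, hy0, hy1]
    ring
  exact ⟨e0 ▸ H.h₁₀, e0 ▸ H.h₁₁, e1 ▸ H.h₀₀, e1 ▸ H.h₀₁⟩

end Parts
end
noncomputable section

/-! ### Comparison of the interpolant with the exact deformation on one element -/

/-- The interpolant on `T` of the radial map with profile `r`, compared with the exact deformation
in polar coordinates. Here `ρ` is the radius of the point and `G` a scaling factor. -/
structure ElementApprox (r r' : ℝ → ℝ) (K e e₁ e₂ b G : ℝ) (T : PolarTriangle) (ρ : Plane → ℝ)
    (x : Plane) : Prop where
  jac_lower : ρ x / 2 ≤ T.jac id x / G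
  jac_rel : |T.jac id x / G - ρ x| ≤ K * e * (ρ x + b)
  jac_abs : |T.jac id x / G - ρ x| ≤ K * e₂
  frob : |T.frobNum (radialMap r) x / G ^ 2 - (r (ρ x) ^ 2 + (ρ x * r' (ρ x)) ^ 2)| ≤ K * e₁
  det : |T.jac (radialMap r) x / G - r (ρ x) * r' (ρ x)| ≤ K * e₂

section

variable {r r' r'' : ℝ → ℝ} {c₀ B : ℝ} {φ₀ φ₁ c h σ τ ε κ S : ℝ} {x : Plane}

theorem mem_Ioc_of_convex {a b w : ℝ} {l : ℝ} (ha : a ∈ Ioc 0 l) (hb : b ∈ Ioc 0 l) (hw : 0 ≤ w)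
    (hw1 : w ≤ 1) : a + (b - a) * w ∈ Ioc (0 : ℝ) l := by
  have := (convex_Ioc (0 : ℝ) l) ha hb (sub_nonneg.mpr hw1) hw (by ring)
  simp only [smul_eq_mul] at this
  convert this using 1
  ring

set_option maxHeartbeats 1000000 in
-- After division by `4 S (φ₁ - φ₀)` the Jacobians and the Frobenius numerator become the normalized
-- polynomials that `IsoData` estimates. The signs of `h` and of `φ₁ - φ₀` are free, which covers
-- types A and B together.
theorem iso_approx (H : ProfileBounds r r' r'' c₀ B) (h₀ : 0 < φ₀) (h₁ : 0 < φ₁) (h₀σ : φ₀ ≤ σ)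
    (h₁σ : φ₁ ≤ σ) (hσ : σ ≤ 1) (hτ : 0 < τ) (hτσ : τ ≤ σ) (hΔ : |φ₁ - φ₀| = τ)
    (hκ : Real.cos (h / 2) = 1 - κ) (hS : Real.sin (h / 2) = S) (hS0 : S ≠ 0) (hκ0 : 0 ≤ κ)
    (hsmall : κ + κ ^ 2 * σ / τ ≤ 1 / 40) (hx : x ∈ refTriangle) :
    ElementApprox r r' (1000000 * B ^ 2) (κ + κ ^ 2 * σ / τ) (τ ^ 2 + (κ + κ ^ 2 * σ / τ))
      (τ ^ 2 + κ * σ + κ ^ 2 / τ) φ₁ (4 * S * (φ₁ - φ₀)) (isoElement φ₀ φ₁ c h)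
      (fun x => φ₀ + (φ₁ - φ₀) * (x 0 + x 1)) x := by
  obtain ⟨hx0', hx1', hx2'⟩ := hx
  have hx0 : 0 ≤ x 0 + x 1 := add_nonneg hx0' hx1'
  set Δ := φ₁ - φ₀ with hΔdef
  have hΔ0 : Δ ≠ 0 := by
    intro h0; rw [h0, abs_zero] at hΔ; linarith
  set w := x 0 + x 1 with hw
  set t := x 1 - x 0 with ht
  set ρ := φ₀ + Δ * w with hρ
  have hσ0 : 0 < σ := h₀.trans_le h₀σ
  have m0 : φ₀ ∈ Ioc 0 σ := ⟨h₀, h₀σ⟩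
  have m1 : φ₁ ∈ Ioc 0 σ := ⟨h₁, h₁σ⟩
  have hsub : Ioc (0 : ℝ) σ ⊆ Ioc 0 1 := Ioc_subset_Ioc_right hσ
  have hρm : ρ ∈ Ioc 0 σ := mem_Ioc_of_convex m0 m1 hx0 hx2'
  have hmm : (φ₀ + φ₁) / 2 ∈ Ioc 0 σ := by
    have := mem_Ioc_of_convex m0 m1 (w := 1 / 2) (by norm_num) (by norm_num)
    convert this using 1
    ring
  have hB := H.B_nonneg
  have hB1 := H.one_le_B
  set um := r ((φ₀ + φ₁) / 2) with hum
  have hquad := H.abs_quadratic_deriv (hsub m0) (hsub m1) hx0 hx2'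
  have hlin := H.abs_linear_interp (hsub m0) (hsub m1) hx0 hx2'
  rw [← hΔdef, ← hρ, ← hum, hΔ] at hquad hlin
  set k := κ / Δ with hk
  set a := (r φ₁ - um) / Δ with ha
  set A := ((4 * um - 3 * r φ₀ - r φ₁) * (1 - 2 * w) + 2 * w * (r φ₁ - r φ₀)) / Δ with hA
  set Li := (1 - w) * (2 * um - r φ₁) + w * r φ₁ with hL
  have hsmall' : κ + κ * σ * (κ / τ) ≤ 1 / 40 := by
    refine le_trans (le_of_eq ?_) hsmall
    ring
  have habst : |t| ≤ w := by rw [abs_le]; constructor <;> linarith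
  have hφw : φ₁ * w ≤ ρ := by
    rw [hρ, hΔdef]
    linarith [mul_nonneg h₀.le (sub_nonneg.mpr hx2')]
  have hak : |k| ≤ κ / τ := by rw [hk, abs_div, hΔ, abs_of_nonneg hκ0]
  -- The factor `10` absorbs the constants of the two interpolation estimates; `k₀ = κ / τ` bounds
  -- `κ / |φ₁ - φ₀|`.
  have D : IsoData (10 * B) σ τ κ (κ / τ) S w t φ₁ ρ (r φ₁) a k A Li (r ρ) (r' ρ) :=
    { one_le_B := by linarith
      σ_le := hσ
      τ_nonneg := hτ.le
      τ_le := hτσ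
      κ_nonneg := hκ0
      k₀_nonneg := by positivity
      small := hsmall'
      S_sq := sq_of_half hκ hS
      w_nonneg := hx0
      w_le := hx2'
      abs_t := habst
      φ_nonneg := h₁.le
      φ_le := h₁σ
      φ_mul := hφw
      ρ_nonneg := hρm.1.le
      ρ_le := hρm.2
      abs_k := hak
      abs_u := (H.abs_r (hsub m1)).trans (by linarith)
      abs_a := by
        rw [ha, abs_div, hΔ, div_le_iff₀ hτ]
        have h1 := H.lipschitz σ hσ _ hmm _ m1
        rw [show φ₁ - (φ₀ + φ₁) / 2 = Δ * (1 / 2) by rw [hΔdef]; ring, abs_mul, hΔ] at h1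
        have : |(1 / 2 : ℝ)| = 1 / 2 := abs_of_nonneg (by norm_num)
        rw [this] at h1
        have : 0 ≤ B * σ * τ := by positivity
        linarith
      abs_A := by
        rw [show A - r' ρ = ((4 * um - 3 * r φ₀ - r φ₁) * (1 - 2 * w) + 2 * w * (r φ₁ - r φ₀) -
          Δ * r' ρ) / Δ by rw [hA]; field_simp, abs_div, hΔ, div_le_iff₀ hτ]
        refine hquad.trans (le_of_eq ?_)
        ring
      abs_L := hlin
      abs_R := (H.abs_r (hsub hρm)).trans (by linarith)
      abs_R' := by
        refine (H.abs_r' (hsub hρm)).trans ?_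
        have := mul_le_mul_of_nonneg_left hρm.2 hB
        have : 0 ≤ B * σ := by positivity
        linarith }
  have Pu := iso_hasParts (c := c) (x := x) (isPolarMap_radialMap r) h₀ h₁ hΔ0 hκ hS hw ht hΔdef
    ha hA hL rfl rfl rfl rfl
  -- The geometric map is the interpolant of the profile `f = id`, for which slope, half-edge
  -- quotient and affine part are exact.
  have Pid := iso_hasParts (c := c) (x := x) (A := 1) (a := 1 / 2) (L := ρ) isPolarMap_id h₀ h₁
    hΔ0 hκ hS hw ht hΔdef
    (by simp only [id]; rw [hΔdef]; field_simp [sub_ne_zero]; rw [eq_div_iff hΔ0]; ring)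
    (by simp only [id]; rw [eq_comm, div_eq_iff hΔ0, hΔdef]; ring)
    (by simp only [id]; rw [hρ, hΔdef]; ring) rfl rfl rfl rfl
  have hjid := Pid.jac_eq
  have hju := Pu.jac_eq
  have hfr := Pu.frobNum_eq Pid
  simp only [id] at hjid hfr
  have hG : 4 * S * Δ ≠ 0 := mul_ne_zero (mul_ne_zero (by norm_num) hS0) hΔ0
  have ejid : (isoElement φ₀ φ₁ c h).jac id x / (4 * S * Δ) =
      (1 + (1 - 2 * w) * (2 * κ - 2 * (κ * k * φ₁))) * (ρ + (1 - 2 * w) * (κ * φ₁)) +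
        2 * (4 * κ - 2 * κ ^ 2) * φ₁ * (1 - 2 * (k * φ₁)) * t ^ 2 := by
    rw [div_eq_iff hG, hjid]
    ring
  have eju : (isoElement φ₀ φ₁ c h).jac (radialMap r) x / (4 * S * Δ) =
      (A + (1 - 2 * w) * (4 * (κ * a) - 2 * (κ * k * r φ₁))) *
        (Li + (1 - 2 * w) * (κ * r φ₁)) +
        2 * (4 * κ - 2 * κ ^ 2) * r φ₁ * (2 * a - 2 * (k * r φ₁)) * t ^ 2 := by
    rw [div_eq_iff hG, hju]
    ring
  have hSq := D.S_sq
  have hkΔ : k * Δ = κ := by rw [hk]; field_simp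
  have hLi : Li = r φ₁ - 2 * (a * Δ) * (1 - w) := by
    rw [hL, show a * Δ = r φ₁ - um by rw [ha]; field_simp]; ring
  have hρ' : ρ = φ₁ - Δ * (1 - w) := by rw [hρ, hΔdef]; ring
  have efr : (isoElement φ₀ φ₁ c h).frobNum (radialMap r) x / (4 * S * Δ) ^ 2 =
      ((A + (1 - 2 * w) * (4 * (κ * a) - 2 * (κ * k * r φ₁))) * (ρ + (1 - 2 * w) * (κ * φ₁)) +
        2 * (4 * κ - 2 * κ ^ 2) * r φ₁ * (1 - 2 * (k * φ₁)) * t ^ 2) ^ 2 +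
      (2 * t * S * (φ₁ * (A + (1 - 2 * w) * (4 * (κ * a) - 2 * (κ * k * r φ₁))) -
        r φ₁ * (1 + (1 - 2 * w) * (2 * κ - 2 * (κ * k * φ₁))))) ^ 2 +
      (4 * t * S * (1 - κ) * (a * φ₁ - r φ₁ / 2)) ^ 2 +
      ((Li + (1 - 2 * w) * (κ * r φ₁)) * (1 + (1 - 2 * w) * (2 * κ - 2 * (κ * k * φ₁))) +
        2 * (4 * κ - 2 * κ ^ 2) * φ₁ * (2 * a - 2 * (k * r φ₁)) * t ^ 2) ^ 2 := by
    rw [div_eq_iff (pow_ne_zero 2 hG), hfr]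
    -- The terms with `k = κ / Δ` would be too large on their own. In this difference they combine
    -- to multiples of `k Δ = κ`, since `Li` and `ρ` are affine in `w` and take the values `r φ₁`
    -- and `φ₁` at the base.
    have hm21 : (2 * a - 2 * (k * r φ₁)) * (ρ + (1 - 2 * w) * (κ * φ₁)) -
        (Li + (1 - 2 * w) * (κ * r φ₁)) * (1 - 2 * (k * φ₁)) =
        2 * (1 - κ) * (a * φ₁ - r φ₁ / 2) := by
      rw [hLi, hρ', ← hkΔ]; ring
    set A₁ := A + (1 - 2 * w) * (4 * (κ * a) - 2 * (κ * k * r φ₁)) with hA₁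
    set x₁ := 1 + (1 - 2 * w) * (2 * κ - 2 * (κ * k * φ₁)) with hx₁
    set p := ρ + (1 - 2 * w) * (κ * φ₁) with hp
    set B₁ := Li + (1 - 2 * w) * (κ * r φ₁) with hB₁
    have hx₁' : 1 + (1 - 2 * w) * (4 * (κ * (1 / 2)) - 2 * (κ * k * φ₁)) = x₁ := by
      rw [hx₁]; ring
    have hq : 4 * κ - 2 * κ ^ 2 = 2 * S ^ 2 := by rw [hSq]; ring
    rw [hx₁', hq]
    have e21 : 4 * t * S * (1 - κ) * (a * φ₁ - r φ₁ / 2) = 2 * S * t *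
        ((2 * a - 2 * (k * r φ₁)) * p - B₁ * (1 - 2 * (k * φ₁))) := by
      rw [hm21]; ring
    rw [e21]
    set b := 2 * a - 2 * (k * r φ₁) with hb
    have hb' : 2 * (1 / 2) - 2 * (k * φ₁) = 1 - 2 * (k * φ₁) := by ring
    rw [hb']
    set y := 1 - 2 * (k * φ₁) with hy
    clear_value A₁ x₁ p B₁ b y
    have i1 : (Δ * A₁ - -2 * (2 * S ^ 2) * r φ₁ * t) * (2 * S * Δ * y * t + 2 * S * p) -
        (Δ * A₁ + -2 * (2 * S ^ 2) * r φ₁ * t) * (2 * S * Δ * y * t - 2 * S * p) =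
        (A₁ * p + 2 * (2 * S ^ 2) * r φ₁ * y * t ^ 2) * (4 * S * Δ) := by ring
    have i2 : (Δ * A₁ + -2 * (2 * S ^ 2) * r φ₁ * t) * (Δ * x₁ - -2 * (2 * S ^ 2) * φ₁ * t) -
        (Δ * A₁ - -2 * (2 * S ^ 2) * r φ₁ * t) * (Δ * x₁ + -2 * (2 * S ^ 2) * φ₁ * t) =
        (2 * t * S * (φ₁ * A₁ - r φ₁ * x₁)) * (4 * S * Δ) := by ring
    have i3 : (2 * S * Δ * b * t - 2 * S * B₁) * (2 * S * Δ * y * t + 2 * S * p) -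
        (2 * S * Δ * b * t + 2 * S * B₁) * (2 * S * Δ * y * t - 2 * S * p) =
        (2 * S * t * (b * p - B₁ * y)) * (4 * S * Δ) := by ring
    have i4 : (2 * S * Δ * b * t + 2 * S * B₁) * (Δ * x₁ - -2 * (2 * S ^ 2) * φ₁ * t) -
        (2 * S * Δ * b * t - 2 * S * B₁) * (Δ * x₁ + -2 * (2 * S ^ 2) * φ₁ * t) =
        (B₁ * x₁ + 2 * (2 * S ^ 2) * φ₁ * b * t ^ 2) * (4 * S * Δ) := by ring
    rw [i1, i2, i3, i4]
    ring
  have bj := D.abs_jac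
  have bl := D.jac_lower
  have bf := D.abs_frob rfl rfl rfl rfl
  have bd := D.abs_jac_interp
  rw [← ejid] at bj bl
  rw [← eju] at bd
  rw [← efr] at bf
  have ee : κ + κ * σ * (κ / τ) = κ + κ ^ 2 * σ / τ := by ring
  have ee2 : κ * (κ / τ) = κ ^ 2 / τ := by ring
  rw [ee] at bj bf
  rw [ee2] at bd
  set e := κ + κ ^ 2 * σ / τ with he
  have hB2 : 1 ≤ B ^ 2 := one_le_pow₀ hB1
  have hκτ : 0 ≤ κ ^ 2 / τ := by positivity
  have he' : e = κ + κ ^ 2 / τ * σ := by rw [he]; ring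
  have hκe : κ ≤ e := by
    rw [he']; linarith [mul_nonneg hκτ hσ0.le]
  have he0 : 0 ≤ e := hκ0.trans hκe
  refine
    { jac_lower := bl
      jac_rel := ?_
      jac_abs := ?_
      frob := bf.trans ?_
      det := bd.trans ?_ }
  -- The base radius stays as a separate summand here: near the apex it is not dominated by `ρ`, and
  -- it becomes harmless only after integration.
  · refine bj.trans ?_
    have h3 : κ * φ₁ ≤ e * φ₁ := mul_le_mul_of_nonneg_right hκe h₁.le
    have h5 : 0 ≤ e * (ρ + φ₁) := mul_nonneg he0 (add_nonneg hρm.1.le h₁.le)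
    have h6 := mul_le_mul_of_nonneg_right hB2 h5
    have h7 : 0 ≤ e * φ₁ := mul_nonneg he0 h₁.le
    linarith only [h3, h5, h6, h7]
  · refine bj.trans ?_
    have h1 : κ * φ₁ ≤ κ * σ := mul_le_mul_of_nonneg_left h₁σ hκ0
    have h2 : e * ρ ≤ e * σ := mul_le_mul_of_nonneg_left hρm.2 he0
    have h3 : e * σ ≤ κ * σ + κ ^ 2 / τ := by
      rw [he']
      have : κ ^ 2 / τ * (σ * σ) ≤ κ ^ 2 / τ * 1 :=
        mul_le_mul_of_nonneg_left (mul_le_one₀ hσ hσ0.le hσ) hκτ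
      linarith only [this]
    have h5 : 0 ≤ τ ^ 2 + κ * σ + κ ^ 2 / τ := by positivity
    have h6 := mul_le_mul_of_nonneg_right hB2 h5
    linarith only [h1, h2, h3, h5, h6, hκτ, sq_nonneg τ, mul_nonneg hκ0 hσ0.le]
  · have h5 : 0 ≤ B ^ 2 * (τ ^ 2 + e) := by positivity
    linarith only [h5]
  · have h5 : 0 ≤ B ^ 2 * (τ ^ 2 + κ * σ + κ ^ 2 / τ) := by positivity
    linarith only [h5]

set_option maxHeartbeats 1000000 in
-- One edge of a corner element is a straight radial segment, and no quotient `κ / τ` appears. The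
-- errors are therefore smaller than on isosceles elements: neither `κ² σ / τ` nor a base radius is
-- needed.
theorem corner_approx_aux (H : ProfileBounds r r' r'' c₀ B) (hε : 0 < ε) (hτ : 0 < τ)
    (hσ : ε + τ ≤ 1) (hκ : Real.cos (h / 2) = 1 - κ) (hS : Real.sin (h / 2) = S) (hS0 : S ≠ 0)
    (hκ0 : 0 ≤ κ) (hsmall : κ ≤ 1 / 40) (hx : x ∈ refTriangle) :
    ElementApprox r r' (1000000 * B ^ 2) κ (τ ^ 2 + κ)
      (τ ^ 2 + κ * (ε + τ)) 0 (2 * S * τ) (cornerElement ε τ c h)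
      (fun x => ε + τ * x 0) x := by
  obtain ⟨hx0', hx1', hx2'⟩ := hx
  have hx0l : x 0 ≤ 1 := by linarith
  have hx1l : x 1 ≤ 1 := by linarith
  set s := x 0 with hs
  set t := x 1 with ht
  set σ := ε + τ with hσd
  have hσ0 : 0 < σ := by positivity
  set ρ := ε + τ * s with hρ
  have m0 : ε ∈ Ioc 0 σ := ⟨hε, by linarith⟩
  have m1 : σ ∈ Ioc 0 σ := ⟨hσ0, le_rfl⟩
  have hsub : Ioc (0 : ℝ) σ ⊆ Ioc 0 1 := Ioc_subset_Ioc_right hσ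
  have hτd : σ - ε = τ := by rw [hσd]; ring
  have hρm : ρ ∈ Ioc 0 σ := by
    have := mem_Ioc_of_convex m0 m1 hx0' hx0l
    rwa [hτd] at this
  have hmm : (ε + σ) / 2 ∈ Ioc 0 σ := by
    have := mem_Ioc_of_convex m0 m1 (w := 1 / 2) (by norm_num) (by norm_num)
    convert this using 1
    ring
  have hB := H.B_nonneg
  have hB1 := H.one_le_B
  set um := r ((ε + σ) / 2) with hum
  have hquad := H.abs_quadratic_deriv (hsub m0) (hsub m1) hx0' hx0l
  -- The affine function passes through the values at the midpoint and at `ε`, the inner end; the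
  -- general estimate uses its second end point, hence the reversed order and `1 - s`.
  have hlin := H.abs_linear_interp (w := 1 - s) (hsub m1) (hsub m0) (by linarith) (by linarith)
  rw [add_comm σ ε, ← hum, show σ + (ε - σ) * (1 - s) = ρ by rw [hρ, hσd]; ring, abs_sub_comm ε σ,
    hτd, abs_of_pos hτ] at hlin
  rw [hτd, ← hρ, ← hum, abs_of_pos hτ] at hquad
  set a := (um - r ε) / τ with ha
  set A := ((4 * um - 3 * r ε - r σ) * (1 - 2 * s) + 2 * s * (r σ - r ε)) / τ with hA
  set Li := r ε + 2 * (a * (τ * s)) with hL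
  -- This is `tan (h/4)`, the half-angle form of `κ / S`.
  set m := S / (2 - κ) with hm
  have hSq := sq_of_half hκ hS
  have h2κ : 0 < 2 - κ := by linarith
  have hκm : κ = S * m := by
    rw [hm, ← mul_div_assoc, eq_div_iff h2κ.ne', ← sq, hSq]
  have D : CornerData (10 * B) σ τ κ S m s t ε (r ε) a A Li (r ρ) (r' ρ) :=
    { one_le_B := by linarith
      σ_eq := rfl
      σ_le := hσ
      τ_nonneg := hτ.le
      ε_nonneg := hε.le
      κ_nonneg := hκ0
      small := hsmall
      S_sq := hSq
      m_sq := by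
        rw [hm, div_pow, div_le_iff₀ (by positivity), hSq]
        refine mul_le_mul_of_nonneg_left ?_ hκ0
        nlinarith
      s_nonneg := hx0'
      s_le := hx0l
      t_nonneg := hx1'
      t_le := hx1l
      abs_u := (H.abs_r (hsub m0)).trans (by linarith)
      abs_a := by
        rw [ha, abs_div, abs_of_pos hτ, div_le_iff₀ hτ]
        have h1 := H.lipschitz σ hσ _ m0 _ hmm
        rw [show (ε + σ) / 2 - ε = τ * (1 / 2) by rw [hσd]; ring,
          abs_of_nonneg (by positivity : 0 ≤ τ * (1 / 2))] at h1
        have : 0 ≤ B * σ * τ := by positivity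
        linarith
      abs_A := by
        rw [show A - r' ρ = ((4 * um - 3 * r ε - r σ) * (1 - 2 * s) + 2 * s * (r σ - r ε) -
          τ * r' ρ) / τ by rw [hA]; field_simp, abs_div, abs_of_pos hτ, div_le_iff₀ hτ]
        refine hquad.trans (le_of_eq ?_)
        ring
      abs_L := by
        refine le_trans (le_of_eq ?_) hlin
        congr 1
        rw [hL, show a * (τ * s) = (um - r ε) * s by rw [ha]; field_simp]
        ring
      abs_R := (H.abs_r (hsub hρm)).trans (by linarith)
      abs_R' := by
        refine (H.abs_r' (hsub hρm)).trans ?_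
        have := mul_le_mul_of_nonneg_left hρm.2 hB
        have : 0 ≤ B * σ := by positivity
        linarith }
  have Pu := corner_hasParts (c := c) (x := x) (isPolarMap_radialMap r) hε hτ hκ hS hκm hs ht
    ha hA hL
  have Pid := corner_hasParts (c := c) (x := x) (A := 1) (a := 1 / 2) (L := ρ) isPolarMap_id hε hτ
    hκ hS hκm hs ht
    (by simp only [id]; rw [eq_div_iff hτ.ne']; ring)
    (by simp only [id]; rw [eq_comm, div_eq_iff hτ.ne']; ring)
    (by simp only [id]; rw [hρ]; ring)
  have hjid := Pid.jac_eq
  have hju := Pu.jac_eq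
  have hfr := Pu.frobNum_eq Pid
  simp only [id] at hjid hfr
  have hG : 2 * S * τ ≠ 0 := mul_ne_zero (mul_ne_zero (by norm_num) hS0) hτ.ne'
  have ejid : (cornerElement ε τ c h).jac id x / (2 * S * τ) =
      (1 - 2 * (κ * t)) * (ρ + ε * (κ * (1 - 4 * t))) +
        2 * (κ * t) * (ε * (κ + 4 * (1 - κ) * t) + τ * s) := by
    rw [div_eq_iff hG, hjid]
    linear_combination (- 2 * t * (ε * (κ + 4 * (1 - κ) * t) + τ * s) * (2 * S * τ)) * hκm
  have eju : (cornerElement ε τ c h).jac (radialMap r) x / (2 * S * τ) =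
      (A - 4 * (a * (κ * t))) * (Li + r ε * (κ * (1 - 4 * t))) +
        4 * (a * (κ * t)) * (r ε * (κ + 4 * (1 - κ) * t) + 2 * (a * (τ * s))) := by
    rw [div_eq_iff hG, hju]
    linear_combination (- 4 * a * t * (r ε * (κ + 4 * (1 - κ) * t) + 2 * (a * (τ * s))) *
      (2 * S * τ)) * hκm
  have efr : (cornerElement ε τ c h).frobNum (radialMap r) x / (2 * S * τ) ^ 2 =
      ((A - 4 * (a * (κ * t))) * (ρ + ε * (κ * (1 - 4 * t))) +
        2 * (κ * t) * (r ε * (κ + 4 * (1 - κ) * t) + 2 * (a * (τ * s)))) ^ 2 +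
      (m * ((A - 4 * (a * (κ * t))) * (ε * (κ + 4 * (1 - κ) * t) + τ * s) -
        (r ε * (κ + 4 * (1 - κ) * t) + 2 * (a * (τ * s))) * (1 - 2 * (κ * t)))) ^ 2 +
      (2 * S * t * (2 * a * (ρ + ε * (κ * (1 - 4 * t))) -
        (Li + r ε * (κ * (1 - 4 * t))))) ^ 2 +
      (4 * (a * (κ * t)) * (ε * (κ + 4 * (1 - κ) * t) + τ * s) +
        (Li + r ε * (κ * (1 - 4 * t))) * (1 - 2 * (κ * t))) ^ 2 := by
    rw [div_eq_iff (pow_ne_zero 2 hG), hfr]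
    set A₁ := A - 4 * (a * (κ * t)) with hA₁
    set B₁ := Li + r ε * (κ * (1 - 4 * t)) with hB₁
    set P := r ε * (κ + 4 * (1 - κ) * t) + 2 * (a * (τ * s)) with hP
    set N := ε * (κ + 4 * (1 - κ) * t) + τ * s with hN
    set Q := ρ + ε * (κ * (1 - 4 * t)) with hQ
    have hN' : ε * (κ + 4 * (1 - κ) * t) + 2 * (1 / 2 * (τ * s)) = N := by rw [hN]; ring
    rw [hN']
    clear_value A₁ B₁ P N Q
    have i1 : τ * A₁ * (2 * S * Q) - 2 * S * (-m * P) * (τ * (4 * (1 / 2 * S * t))) =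
        (A₁ * Q + 2 * (κ * t) * P) * (2 * S * τ) := by
      linear_combination (-2 * t * P * (2 * S * τ)) * hκm
    have i2 : 2 * S * (-m * P) * (τ * (1 - 4 * (1 / 2 * (κ * t)))) -
        τ * A₁ * (2 * S * (-m * N)) =
        (m * (A₁ * N - P * (1 - 2 * (κ * t)))) * (2 * S * τ) := by ring
    have i3 : τ * (4 * (a * S * t)) * (2 * S * Q) - 2 * S * B₁ * (τ * (4 * (1 / 2 * S * t))) =
        (2 * S * t * (2 * a * Q - B₁)) * (2 * S * τ) := by ring
    have i4 : 2 * S * B₁ * (τ * (1 - 4 * (1 / 2 * (κ * t)))) -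
        τ * (4 * (a * S * t)) * (2 * S * (-m * N)) =
        (4 * (a * (κ * t)) * N + B₁ * (1 - 2 * (κ * t))) * (2 * S * τ) := by
      linear_combination (-4 * a * t * N * (2 * S * τ)) * hκm
    rw [i1, i2, i3, i4]
    ring
  have bj := D.abs_jac
  have bl := D.jac_lower
  have bf := D.abs_frob rfl rfl rfl rfl
  have bd := D.abs_jac_interp
  rw [← hρ] at bj bl bf
  rw [← ejid] at bj bl
  rw [← eju] at bd
  rw [← efr] at bf
  have hB2 : 1 ≤ B ^ 2 := one_le_pow₀ hB1
  refine
    { jac_lower := bl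
      jac_rel := ?_
      jac_abs := ?_
      -- The factor `1000000` is `10000` times `10²`, with equality here; the other estimates have
      -- room to spare.
      frob := bf.trans (le_of_eq (by ring))
      det := bd.trans ?_ }
  · refine bj.trans ?_
    have h5 : 0 ≤ κ * ρ := mul_nonneg hκ0 hρm.1.le
    have h6 := mul_le_mul_of_nonneg_right hB2 h5
    rw [add_zero]
    linarith only [h5, h6]
  · refine bj.trans ?_
    have h1 : κ * ρ ≤ κ * σ := mul_le_mul_of_nonneg_left hρm.2 hκ0
    have h5 : 0 ≤ τ ^ 2 + κ * σ := by positivity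
    have h6 := mul_le_mul_of_nonneg_right hB2 h5
    linarith only [h1, h5, h6, sq_nonneg τ, mul_nonneg hκ0 hσ0.le]
  · have h5 : 0 ≤ B ^ 2 * (τ ^ 2 + κ * σ) := by positivity
    linarith

theorem ElementApprox.mono {K e e₁ e₂ b G e' e₁' e₂' b' : ℝ} {T : PolarTriangle}
    {ρ : Plane → ℝ} (h : ElementApprox r r' K e e₁ e₂ b G T ρ x) (hK : 0 ≤ K) (he' : 0 ≤ e')
    (hb : 0 ≤ ρ x + b) (h₀ : e ≤ e') (h₁ : e₁ ≤ e₁') (h₂ : e₂ ≤ e₂') (h₃ : b ≤ b') :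
    ElementApprox r r' K e' e₁' e₂' b' G T ρ x where
  jac_lower := h.jac_lower
  jac_rel := h.jac_rel.trans (mul_le_mul (mul_le_mul_of_nonneg_left h₀ hK) (by linarith) hb
    (mul_nonneg hK he'))
  jac_abs := h.jac_abs.trans (mul_le_mul_of_nonneg_left h₂ hK)
  frob := h.frob.trans (mul_le_mul_of_nonneg_left h₁ hK)
  det := h.det.trans (mul_le_mul_of_nonneg_left h₂ hK)

theorem corner_approx (H : ProfileBounds r r' r'' c₀ B) (hε : 0 < ε) (hτ : 0 < τ)
    (hσ : ε + τ ≤ 1) (hκ : Real.cos (h / 2) = 1 - κ) (hS : Real.sin (h / 2) = S) (hS0 : S ≠ 0)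
    (hκ0 : 0 ≤ κ) (hsmall : κ + κ ^ 2 * (ε + τ) / τ ≤ 1 / 40) (hx : x ∈ refTriangle) :
    ElementApprox r r' (1000000 * B ^ 2) (κ + κ ^ 2 * (ε + τ) / τ)
      (τ ^ 2 + (κ + κ ^ 2 * (ε + τ) / τ)) (τ ^ 2 + κ * (ε + τ) + κ ^ 2 / τ) 0 (2 * S * τ)
      (cornerElement ε τ c h) (fun x => ε + τ * x 0) x := by
  have h1 : 0 ≤ κ ^ 2 * (ε + τ) / τ := by positivity
  have h2 : 0 ≤ κ ^ 2 / τ := by positivity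
  refine (corner_approx_aux H hε hτ hσ hκ hS hS0 hκ0 (by linarith) hx).mono (by positivity)
    (by positivity) ?_ (by linarith) (by linarith) (by linarith) le_rfl
  have := mul_nonneg hτ.le hx.1
  linarith

/-- Exchanging the last two vertices composes with the reflection of the reference triangle. Both
Jacobians change sign, which the scale `2 (-S) τ` records, and the Frobenius numerator is unchanged.
-/
theorem corner_approx' (H : ProfileBounds r r' r'' c₀ B) (hε : 0 < ε) (hτ : 0 < τ)
    (hσ : ε + τ ≤ 1) (hκ : Real.cos (h / 2) = 1 - κ) (hS : Real.sin (h / 2) = S) (hS0 : S ≠ 0)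
    (hκ0 : 0 ≤ κ) (hsmall : κ + κ ^ 2 * (ε + τ) / τ ≤ 1 / 40) (hx : x ∈ refTriangle) :
    ElementApprox r r' (1000000 * B ^ 2) (κ + κ ^ 2 * (ε + τ) / τ)
      (τ ^ 2 + (κ + κ ^ 2 * (ε + τ) / τ)) (τ ^ 2 + κ * (ε + τ) + κ ^ 2 / τ) 0 (2 * (-S) * τ)
      (cornerElement' ε τ c h) (fun x => ε + τ * x 1) x := by
  set y : Plane := !₂[x 1, x 0] with hy
  have hy0 : y 0 = x 1 := rfl
  have hy1 : y 1 = x 0 := rfl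
  have hyT : y ∈ refTriangle := by
    obtain ⟨h0, h1, h2⟩ := hx
    exact ⟨h1, h0, by rw [hy0, hy1]; linarith⟩
  have A := corner_approx (c := c) H hε hτ hσ hκ hS hS0 hκ0 hsmall hyT
  have hκm : κ = S * (κ / S) := by field_simp
  have Pu := corner_hasParts (c := c) (x := y) (isPolarMap_radialMap r) hε hτ hκ hS hκm rfl rfl
    rfl rfl rfl
  have Pid := corner_hasParts (c := c) (x := y) isPolarMap_id hε hτ hκ hS hκm rfl rfl
    rfl rfl rfl
  have Pu' := corner_hasParts' (isPolarMap_radialMap r) hε hτ hy0 hy1 Pu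
  have Pid' := corner_hasParts' isPolarMap_id hε hτ hy0 hy1 Pid
  have e1 : (cornerElement' ε τ c h).jac id x = -(cornerElement ε τ c h).jac id y := by
    rw [Pid.jac_eq, Pid'.jac_eq]; ring
  have e2 : (cornerElement' ε τ c h).jac (radialMap r) x =
      -(cornerElement ε τ c h).jac (radialMap r) y := by
    rw [Pu.jac_eq, Pu'.jac_eq]; ring
  have e3 : (cornerElement' ε τ c h).frobNum (radialMap r) x =
      (cornerElement ε τ c h).frobNum (radialMap r) y := by
    rw [Pu.frobNum_eq Pid, Pu'.frobNum_eq Pid']; ring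
  have eG : 2 * (-S) * τ = -(2 * S * τ) := by ring
  rw [eG]
  constructor
  · rw [e1, neg_div_neg_eq]; exact A.jac_lower
  · rw [e1, neg_div_neg_eq]; exact A.jac_rel
  · rw [e1, neg_div_neg_eq]; exact A.jac_abs
  · rw [e3, neg_sq]; exact A.frob
  · rw [e2, neg_div_neg_eq]; exact A.det

end

/-! ### The elements of a layer -/

/-- The radius at the point of an element with a given pre-image in the reference triangle. -/
def refRadius (ε τ : ℝ) : ElementType → Plane → ℝ
  | .A => fun x => ε + τ * (x 0 + x 1)
  | .B => fun x => ε + τ * (1 - (x 0 + x 1))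
  | .C => fun x => ε + τ * x 0
  | .D => fun x => ε + τ * x 1

/-- The area factor of the affine map from the reference triangle to the polar triangle. -/
def areaFactor : ElementType → ℝ
  | .A => 2
  | .B => 2
  | .C => 1
  | .D => 1

/-- The radius of the base of an element. -/
def baseRadius (ε τ : ℝ) : ElementType → ℝ
  | .A => ε + τ
  | .B => ε
  | .C => 0
  | .D => 0

theorem layerElement_eq (ε τ : ℝ) (N : ℕ) (k : Fin N) :
    layerElement ε τ N (.A, k) =
      isoElement ε (ε + τ) (elementAngle N k .A) (Real.pi / N) ∧
    layerElement ε τ N (.B, k) =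
      isoElement (ε + τ) ε (elementAngle N k .B) (-(Real.pi / N)) ∧
    layerElement ε τ N (.C, k) = cornerElement ε τ (elementAngle N k .C) (Real.pi / N) ∧
    layerElement ε τ N (.D, k) = cornerElement' ε τ (elementAngle N k .D) (-(Real.pi / N)) := by
  refine ⟨?_, ?_, ?_, ?_⟩ <;>
    simp [layerElement, repElement, isoElement, cornerElement, cornerElement', sub_eq_add_neg]

/-- Types B and D are described with the angle `-π/N`, so their sine is `-S`. A second sign, from
the radius decreasing towards the base for B and from the vertex order for D, makes the scale
positive for all four types. -/
theorem layer_approx {r r' r'' : ℝ → ℝ} {c₀ B ε τ κ S : ℝ} {N : ℕ}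
    (H : ProfileBounds r r' r'' c₀ B) (P : LayerParams ε τ N)
    (hκ : κ = 1 - Real.cos (Real.pi / N / 2)) (hS : S = Real.sin (Real.pi / N / 2)) (hS0 : S ≠ 0)
    (hsmall : κ + κ ^ 2 * (ε + τ) / τ ≤ 1 / 40) (e : ElementType × Fin N) {x : Plane}
    (hx : x ∈ refTriangle) :
    ElementApprox r r' (1000000 * B ^ 2) (κ + κ ^ 2 * (ε + τ) / τ)
      (τ ^ 2 + (κ + κ ^ 2 * (ε + τ) / τ)) (τ ^ 2 + κ * (ε + τ) + κ ^ 2 / τ)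
      (baseRadius ε τ e.1) (areaFactor e.1 * (2 * S * τ)) (layerElement ε τ N e)
      (refRadius ε τ e.1) x := by
  obtain ⟨hε, hτ, hσ, hN⟩ := P
  have hκ0 : 0 ≤ κ := by rw [hκ]; linarith [Real.cos_le_one (Real.pi / N / 2)]
  have hc : Real.cos (Real.pi / N / 2) = 1 - κ := by rw [hκ]; ring
  have hc' : Real.cos (-(Real.pi / N) / 2) = 1 - κ := by rw [neg_div, Real.cos_neg, hc]
  have hs' : Real.sin (-(Real.pi / N) / 2) = -S := by rw [neg_div, Real.sin_neg, hS]
  have hσ0 : 0 < ε + τ := by positivity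
  obtain ⟨t, k⟩ := e
  obtain ⟨eA, eB, eC, eD⟩ := layerElement_eq ε τ N k
  cases t with
  | A =>
    have h := iso_approx (c := elementAngle N k .A) H hε hσ0 (by linarith) le_rfl hσ hτ
      (by linarith) (by rw [add_sub_cancel_left, abs_of_pos hτ]) hc hS.symm hS0 hκ0 hsmall hx
    have e1 : 4 * S * (ε + τ - ε) = areaFactor .A * (2 * S * τ) := by
      simp only [areaFactor]; ring
    have e2 : (fun z : Plane => ε + (ε + τ - ε) * (z 0 + z 1)) = refRadius ε τ .A := by
      funext z; simp only [refRadius]; ring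
    rw [← eA, e1, e2] at h
    exact h
  | B =>
    have h := iso_approx (c := elementAngle N k .B) H hσ0 hε le_rfl (by linarith) hσ hτ
      (by linarith) (by rw [show ε - (ε + τ) = -τ by ring, abs_neg, abs_of_pos hτ]) hc' hs'
      (neg_ne_zero.mpr hS0) hκ0 hsmall hx
    have e1 : 4 * -S * (ε - (ε + τ)) = areaFactor .B * (2 * S * τ) := by
      simp only [areaFactor]; ring
    have e2 : (fun z : Plane => ε + τ + (ε - (ε + τ)) * (z 0 + z 1)) = refRadius ε τ .B := by
      funext z; simp only [refRadius]; ring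
    rw [← eB, e1, e2] at h
    exact h
  | C =>
    have h := corner_approx (c := elementAngle N k .C) H hε hτ hσ hc hS.symm hS0 hκ0 hsmall hx
    have e1 : 2 * S * τ = areaFactor .C * (2 * S * τ) := by simp only [areaFactor]; ring
    rw [← eC, e1] at h
    exact h
  | D =>
    have h := corner_approx' (c := elementAngle N k .D) H hε hτ hσ hc' hs' (neg_ne_zero.mpr hS0)
      hκ0 hsmall hx
    have e1 : 2 * - -S * τ = areaFactor .D * (2 * S * τ) := by simp only [areaFactor]; ring
    rw [← eD, e1] at h
    exact h
end
noncomputable section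

/-! ### Integrals over the reference triangle -/

/-- Fubini: the fibre of the triangle over `s` has length `1 - s`. -/
theorem setIntegral_refTriangle_fst {k : ℝ → ℝ} (hk : ContinuousOn k (Icc 0 1)) :
    ∫ x in refTriangle, k (x 0) = ∫ s in (0 : ℝ)..1, (1 - s) * k s := by
  set e : Plane ≃ᵐ ℝ × ℝ := (MeasurableEquiv.toLp 2 (Fin 2 → ℝ)).symm.trans
    MeasurableEquiv.finTwoArrow with he
  have hmp : MeasurePreserving e :=
    (PiLp.volume_preserving_ofLp (Fin 2)).trans (volume_preserving_finTwoArrow ℝ)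
  set D : Set (ℝ × ℝ) := {z | 0 ≤ z.1 ∧ 0 ≤ z.2 ∧ z.1 + z.2 ≤ 1} with hD
  have hpre : refTriangle = e ⁻¹' D := rfl
  have h1 : ∫ x in refTriangle, k (x 0) = ∫ z in D, k z.1 := by
    rw [hpre]
    exact hmp.setIntegral_preimage_emb e.measurableEmbedding (fun z => k z.1) D
  have hDc : IsClosed D := (isClosed_le continuous_const continuous_fst).inter
    ((isClosed_le continuous_const continuous_snd).inter
      (isClosed_le (continuous_fst.add continuous_snd) continuous_const))
  have hDK : IsCompact D := by
    refine IsCompact.of_isClosed_subset (isCompact_Icc.prod isCompact_Icc :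
      IsCompact (Icc (0 : ℝ) 1 ×ˢ Icc (0 : ℝ) 1)) hDc ?_
    rintro ⟨a, b⟩ ⟨h0, h1, h2⟩
    simp only at h0 h1 h2
    exact ⟨⟨h0, by simp only; linarith⟩, ⟨h1, by simp only; linarith⟩⟩
  have hint : IntegrableOn (fun z : ℝ × ℝ => k z.1) D := by
    refine ContinuousOn.integrableOn_compact hDK (hk.comp continuousOn_fst ?_)
    rintro ⟨a, b⟩ ⟨h0, h1, h2⟩
    simp only at h0 h1 h2
    exact ⟨h0, by simp only; linarith⟩
  rw [h1, ← integral_indicator hDc.measurableSet, Measure.volume_eq_prod, integral_prod _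
    ((integrable_indicator_iff hDc.measurableSet).mpr hint)]
  have h2 : ∀ a : ℝ, ∫ b, D.indicator (fun z : ℝ × ℝ => k z.1) (a, b) =
      (Icc (0 : ℝ) 1).indicator (fun a => (1 - a) * k a) a := by
    intro a
    by_cases ha : a ∈ Icc (0 : ℝ) 1
    · have : (fun b => D.indicator (fun z : ℝ × ℝ => k z.1) (a, b)) =
          (Icc (0 : ℝ) (1 - a)).indicator (fun _ => k a) := by
        ext b
        by_cases hb : b ∈ Icc 0 (1 - a)
        · rw [indicator_of_mem hb, indicator_of_mem]
          exact ⟨ha.1, hb.1, by simp only; linarith [hb.2]⟩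
        · rw [indicator_of_notMem hb, indicator_of_notMem]
          rintro ⟨_, h1, h2⟩
          simp only at h1 h2
          exact hb ⟨h1, by linarith⟩
      rw [this, integral_indicator measurableSet_Icc, setIntegral_const, indicator_of_mem ha]
      simp [ha.2]
    · have : (fun b => D.indicator (fun z : ℝ × ℝ => k z.1) (a, b)) = fun _ => 0 := by
        ext b
        rw [indicator_of_notMem]
        rintro ⟨h0, h1, h2⟩
        simp only at h0 h1 h2
        exact ha ⟨h0, by linarith⟩
      rw [this, indicator_of_notMem ha]
      simp
  simp_rw [h2]
  rw [integral_indicator measurableSet_Icc, integral_Icc_eq_integral_Ioc,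
    intervalIntegral.integral_of_le zero_le_one]

/-- Measure preserving affine symmetries of the reference triangle. -/
theorem setIntegral_refTriangle_comp {a : Plane → Plane} {L : Plane →L[ℝ] Plane}
    (ha : ∀ x, HasFDerivAt a L x) (hdet : |L.det| = 1) (hinj : Function.Injective a)
    (himg : a '' refTriangle = refTriangle) (f : Plane → ℝ) :
    ∫ x in refTriangle, f x = ∫ x in refTriangle, f (a x) := by
  have h := integral_image_eq_integral_abs_det_fderiv_smul volume
    refTriangle_isClosed.measurableSet (fun x _ => (ha x).hasFDerivWithinAt) hinj.injOn f
  rw [himg, hdet] at h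
  simpa using h

theorem setIntegral_refTriangle_snd {k : ℝ → ℝ} (hk : ContinuousOn k (Icc 0 1)) :
    ∫ x in refTriangle, k (x 1) = ∫ s in (0 : ℝ)..1, (1 - s) * k s := by
  rw [← setIntegral_refTriangle_fst hk]
  set L : Plane →L[ℝ] Plane :=
    (EuclideanSpace.proj 1 : Plane →L[ℝ] ℝ).smulRight (EuclideanSpace.single 0 1) +
    (EuclideanSpace.proj 0 : Plane →L[ℝ] ℝ).smulRight (EuclideanSpace.single 1 1) with hL
  have h0 : ∀ x, L x 0 = x 1 := fun x => by simp [hL]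
  have h1 : ∀ x, L x 1 = x 0 := fun x => by simp [hL]
  have hinv : ∀ x, L (L x) = x := fun x => by
    ext i
    fin_cases i
    · exact (h0 _).trans (h1 x)
    · exact (h1 _).trans (h0 x)
  have hmem : ∀ x ∈ refTriangle, L x ∈ refTriangle := fun x hx =>
    ⟨by rw [h0]; exact hx.2.1, by rw [h1]; exact hx.1, by rw [h0, h1]; linarith [hx.2.2]⟩
  rw [setIntegral_refTriangle_comp (fun x => L.hasFDerivAt) ?_
    (Function.LeftInverse.injective hinv) ?_]
  · simp_rw [h1]
  · rw [plane_det_eq]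
    simp [h0, h1]
  · refine Subset.antisymm (image_subset_iff.mpr hmem) fun x hx => ⟨L x, hmem x hx, hinv x⟩

/-- The affine involution that exchanges the first two barycentric coordinates preserves the
triangle and its measure. -/
theorem setIntegral_refTriangle_sub {k : ℝ → ℝ} (hk : ContinuousOn k (Icc 0 1)) :
    ∫ x in refTriangle, k (1 - (x 0 + x 1)) = ∫ s in (0 : ℝ)..1, (1 - s) * k s := by
  rw [← setIntegral_refTriangle_fst hk]
  set L : Plane →L[ℝ] Plane :=
    -((EuclideanSpace.proj 0 : Plane →L[ℝ] ℝ).smulRight (EuclideanSpace.single 0 1)) +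
    (EuclideanSpace.proj 1 : Plane →L[ℝ] ℝ).smulRight
      (EuclideanSpace.single 1 1 - EuclideanSpace.single 0 1) with hL
  set a : Plane → Plane := fun x => EuclideanSpace.single 0 1 + L x with ha
  have h0 : ∀ x, a x 0 = 1 - (x 0 + x 1) := fun x => by simp [ha, hL]; ring
  have h1 : ∀ x, a x 1 = x 1 := fun x => by simp [ha, hL]
  have hinv : ∀ x, a (a x) = x := fun x => by
    ext i
    fin_cases i
    · refine (h0 _).trans ?_
      rw [h0, h1]; ring_nf; rfl
    · exact (h1 _).trans (h1 x)
  have hmem : ∀ x ∈ refTriangle, a x ∈ refTriangle := fun x hx =>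
    ⟨by rw [h0]; linarith [hx.2.2], by rw [h1]; exact hx.2.1,
      by rw [h0, h1]; linarith [hx.1]⟩
  rw [setIntegral_refTriangle_comp (a := a) (L := L) (fun x => L.hasFDerivAt.const_add _) ?_
    (Function.LeftInverse.injective hinv) ?_]
  · refine integral_congr_ae (Eventually.of_forall fun x => ?_)
    simp only [h0, h1]
    congr 1
    ring
  · rw [plane_det_eq]
    simp [hL]
  · refine Subset.antisymm (image_subset_iff.mpr hmem) fun x hx => ⟨a x, hmem x hx, hinv x⟩

theorem setIntegral_refTriangle_add {k : ℝ → ℝ} (hk : ContinuousOn k (Icc 0 1)) :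
    ∫ x in refTriangle, k (x 0 + x 1) = ∫ s in (0 : ℝ)..1, s * k s := by
  have hk' : ContinuousOn (fun s => k (1 - s)) (Icc 0 1) :=
    hk.comp (by fun_prop) fun s hs => ⟨by linarith [hs.2], by linarith [hs.1]⟩
  have h := setIntegral_refTriangle_sub hk'
  simp only [sub_sub_cancel] at h
  rw [h]
  have := intervalIntegral.integral_comp_sub_left (a := 0) (b := 1) (fun s => s * k s) (1 : ℝ)
  simpa using this

/-! ### Integrals over annuli -/

theorem setIntegral_annulus {ε τ : ℝ} (hε : 0 < ε) (hτ : 0 < τ) (f : ℝ → ℝ) :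
    ∫ x in annulus ε τ, f ‖x‖ = 2 * Real.pi * ∫ R in ε..(ε + τ), R * f R := by
  have hmeas : MeasurableSet (annulus ε τ) := by
    have : annulus ε τ = (fun x : Plane => ‖x‖) ⁻¹' Icc ε (ε + τ) := rfl
    rw [this]
    exact measurable_norm measurableSet_Icc
  rw [← integral_indicator hmeas]
  have h1 : (annulus ε τ).indicator (fun x : Plane => f ‖x‖) =
      fun x : Plane => (Icc ε (ε + τ)).indicator f ‖x‖ := by
    ext x
    by_cases hx : x ∈ annulus ε τ
    · rw [indicator_of_mem hx, indicator_of_mem]; exact hx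
    · rw [indicator_of_notMem hx, indicator_of_notMem]; exact hx
  rw [h1, integral_fun_norm_addHaar volume (fun R => (Icc ε (ε + τ)).indicator f R)]
  have hvol : (volume : Measure Plane).real (Metric.ball 0 1) = Real.pi := by
    rw [Measure.real, EuclideanSpace.volume_ball_fin_two]
    simp [Real.pi_pos.le]
  rw [hvol]
  have h2 : ∫ y in Ioi (0 : ℝ), y ^ (Module.finrank ℝ Plane - 1) •
      (Icc ε (ε + τ)).indicator f y = ∫ R in ε..(ε + τ), R * f R := by
    rw [intervalIntegral.integral_of_le (by linarith), ← integral_Icc_eq_integral_Ioc]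
    have h3 : (fun y : ℝ => y ^ (Module.finrank ℝ Plane - 1) • (Icc ε (ε + τ)).indicator f y) =
        (Icc ε (ε + τ)).indicator fun y => y * f y := by
      ext y
      by_cases hy : y ∈ Icc ε (ε + τ)
      · rw [indicator_of_mem hy, indicator_of_mem hy]; simp
      · rw [indicator_of_notMem hy, indicator_of_notMem hy]; simp
    rw [h3, setIntegral_indicator measurableSet_Icc]
    congr 2
    exact inter_eq_right.mpr fun y hy => hε.trans_le hy.1
  rw [h2]
  simp
  ring
end
noncomputable section

/-! ### The geometric maps in the frame of the element -/

/-- First coordinate of the geometric map of an isosceles element, along its axis. -/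
def isoX (φ₀ φ₁ κ w t : ℝ) : ℝ :=
  φ₀ + (φ₁ - φ₀) * w + w * (1 - w) * (2 * κ * ((φ₁ - φ₀) - κ * φ₁)) -
    (4 * κ - 2 * κ ^ 2) * φ₁ * t ^ 2

/-- Second coordinate of the geometric map of an isosceles element, across its axis. -/
def isoY (φ₀ φ₁ κ S w t : ℝ) : ℝ :=
  2 * S * (φ₀ + (φ₁ - φ₀) * w + (1 - 2 * w) * (κ * φ₁)) * t

/-- First coordinate of the geometric map of a corner element, along its radial edge. -/
def cornerX (ε τ κ s t : ℝ) : ℝ :=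
  ε * (1 - 2 * κ ^ 2 * t - 4 * κ * (1 - κ) * t ^ 2) + τ * s * (1 - 2 * κ * t)

/-- Second coordinate of the geometric map of a corner element, across its radial edge. -/
def cornerY (ε τ κ S s t : ℝ) : ℝ :=
  ε * (2 * S * (1 + κ) * t - 4 * S * κ * t ^ 2) + 2 * S * τ * s * t

/-- The point with coordinates `(X, Y)` in the frame rotated by the angle `c`. -/
def rotPoint (c X Y : ℝ) : Plane :=
  !₂[Real.cos c * X - Real.sin c * Y, Real.sin c * X + Real.cos c * Y]

@[simp] theorem rotPoint_zero (c X Y : ℝ) :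
    rotPoint c X Y 0 = Real.cos c * X - Real.sin c * Y := rfl

@[simp] theorem rotPoint_one (c X Y : ℝ) :
    rotPoint c X Y 1 = Real.sin c * X + Real.cos c * Y := rfl

theorem norm_rotPoint_sq (c X Y : ℝ) : ‖rotPoint c X Y‖ ^ 2 = X ^ 2 + Y ^ 2 := by
  rw [EuclideanSpace.norm_sq_eq, Fin.sum_univ_two]
  simp only [rotPoint, PiLp.toLp_apply, Matrix.cons_val_zero, Matrix.cons_val_one,
    Real.norm_eq_abs, sq_abs]
  linear_combination (X ^ 2 + Y ^ 2) * Real.cos_sq_add_sin_sq c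

theorem rotPoint_add (c h X Y : ℝ) : rotPoint (c + h) X Y =
    rotPoint c (Real.cos h * X - Real.sin h * Y) (Real.sin h * X + Real.cos h * Y) := by
  ext i
  fin_cases i <;> simp [rotPoint, Real.cos_add, Real.sin_add] <;> ring

theorem rotPoint_polar (c R θ : ℝ) :
    rotPoint c (R * Real.cos θ) (R * Real.sin θ) = polarPoint R (c + θ) := by
  ext i
  fin_cases i <;> simp [rotPoint, polarPoint, Real.cos_add, Real.sin_add] <;> ring

section Geom

variable {φ₀ φ₁ c h ε τ κ S : ℝ}

theorem iso_geomMap (h₀ : 0 < φ₀) (h₁ : 0 < φ₁)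
    (hκ : Real.cos (h / 2) = 1 - κ) (hS : Real.sin (h / 2) = S) (x : Plane) :
    (isoElement φ₀ φ₁ c h).geomMap x = rotPoint c (isoX φ₀ φ₁ κ (x 0 + x 1) (x 1 - x 0))
      (isoY φ₀ φ₁ κ S (x 0 + x 1) (x 1 - x 0)) := by
  obtain ⟨n0, n1, n2, n3, n4, n5⟩ := iso_nodes (c := c) (h := h) isPolarMap_id h₀ h₁
  have hc := cos_of_half hS
  have hs := sin_of_half hκ hS
  have hq := sq_of_half hκ hS
  ext i
  fin_cases i
  · change (isoElement φ₀ φ₁ c h).lagrange id x 0 = rotPoint c _ _ 0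
    rw [rotPoint_zero]
    rw [PolarTriangle.lagrange_apply, n0, n1, n2, n3, n4, n5]
    simp only [polarPoint_zero, Real.cos_sub, Real.cos_add, hc, hs, hκ, hS, hq, id,
      isoX, isoY]
    ring
  · change (isoElement φ₀ φ₁ c h).lagrange id x 1 = rotPoint c _ _ 1
    rw [rotPoint_one]
    rw [PolarTriangle.lagrange_apply, n0, n1, n2, n3, n4, n5]
    simp only [polarPoint_one, Real.sin_sub, Real.sin_add, hc, hs, hκ, hS, hq, id,
      isoX, isoY]
    ring

theorem corner_geomMap (hε : 0 < ε) (hτ : 0 < τ)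
    (hκ : Real.cos (h / 2) = 1 - κ) (hS : Real.sin (h / 2) = S) (x : Plane) :
    (cornerElement ε τ c h).geomMap x =
      rotPoint c (cornerX ε τ κ (x 0) (x 1)) (cornerY ε τ κ S (x 0) (x 1)) := by
  obtain ⟨n0, n1, n2, n3, n4, n5⟩ := corner_nodes (c := c) (h := h) isPolarMap_id hε hτ
  have hc := cos_of_half hS
  have hs := sin_of_half hκ hS
  have hq := sq_of_half hκ hS
  ext i
  fin_cases i
  · change (cornerElement ε τ c h).lagrange id x 0 = rotPoint c _ _ 0
    rw [rotPoint_zero]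
    rw [PolarTriangle.lagrange_apply, n0, n1, n2, n3, n4, n5]
    simp only [polarPoint_zero, Real.cos_add, hc, hs, hκ, hS, hq, id,
      cornerX, cornerY]
    ring
  · change (cornerElement ε τ c h).lagrange id x 1 = rotPoint c _ _ 1
    rw [rotPoint_one]
    rw [PolarTriangle.lagrange_apply, n0, n1, n2, n3, n4, n5]
    simp only [polarPoint_one, Real.sin_add, hc, hs, hκ, hS, hq, id,
      cornerX, cornerY]
    ring

theorem corner_geomMap' (hε : 0 < ε) (hτ : 0 < τ)
    (hκ : Real.cos (h / 2) = 1 - κ) (hS : Real.sin (h / 2) = S) (x : Plane) :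
    (cornerElement' ε τ c h).geomMap x =
      rotPoint c (cornerX ε τ κ (x 1) (x 0)) (cornerY ε τ κ S (x 1) (x 0)) := by
  rw [show rotPoint c (cornerX ε τ κ (x 1) (x 0)) (cornerY ε τ κ S (x 1) (x 0)) =
    (cornerElement ε τ c h).geomMap !₂[x 1, x 0] from (corner_geomMap hε hτ hκ hS !₂[x 1, x 0]).symm]
  obtain ⟨n0, n1, n2, n3, n4, n5⟩ := corner_nodes (c := c) (h := h) isPolarMap_id hε hτ
  obtain ⟨k0, k1, k2, k3, k4, k5⟩ := corner_nodes' (c := c) (h := h) isPolarMap_id hε hτ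
  ext i
  change (cornerElement' ε τ c h).lagrange id x i = (cornerElement ε τ c h).lagrange id _ i
  rw [PolarTriangle.lagrange_apply, PolarTriangle.lagrange_apply, n0, n1, n2, n3, n4, n5,
    k0, k1, k2, k3, k4, k5]
  simp
  ring

end Geom

/-! ### One half-sector of a layer -/

/-- The mesh parameters: `κ = 1 - cos (h/2)`, `S = sin (h/2)`. -/
structure SectorParams (ε τ h κ S : ℝ) : Prop where
  ε_pos : 0 < ε
  τ_pos : 0 < τ
  h_pos : 0 < h
  h_le : h ≤ 1
  cos_eq : Real.cos (h / 2) = 1 - κ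
  sin_eq : Real.sin (h / 2) = S
  κ_nonneg : 0 ≤ κ
  S_pos : 0 < S
  small : κ + κ ^ 2 * (ε + τ) / τ ≤ 1 / 400

namespace SectorParams

variable {ε τ h κ S : ℝ}

theorem S_sq (P : SectorParams ε τ h κ S) : S ^ 2 = κ * (2 - κ) := sq_of_half P.cos_eq P.sin_eq

theorem κ_small (P : SectorParams ε τ h κ S) : κ ≤ 1 / 400 := by
  have := P.ε_pos
  have := P.τ_pos
  have : 0 ≤ κ ^ 2 * (ε + τ) / τ := by positivity
  linarith [P.small]

theorem κ_sq_small (P : SectorParams ε τ h κ S) : κ ^ 2 * (ε + τ) ≤ τ / 400 := by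
  have h1 : κ ^ 2 * (ε + τ) / τ ≤ 1 / 400 := by linarith [P.small, P.κ_nonneg]
  rw [div_le_iff₀ P.τ_pos] at h1
  linarith

end SectorParams

/-- The second element of a half-sector, given by its geometric map in its own frame. The
coordinates `(s, t)` satisfy `s ≤ t`, and `t = 1` is the axis of the element. -/
structure SectorPiece (ε τ h κ S : ℝ) (X Y : ℝ → ℝ → ℝ) : Prop where
  continuous_X : Continuous fun z : ℝ × ℝ => X z.1 z.2
  continuous_Y : Continuous fun z : ℝ × ℝ => Y z.1 z.2
  diag_X : ∀ t, Real.cos h * X t t + Real.sin h * Y t t = isoX ε (ε + τ) κ t t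
  diag_Y : ∀ t, Real.sin h * X t t - Real.cos h * Y t t = isoY ε (ε + τ) κ S t t
  X_pos : ∀ s t, 0 ≤ s → s ≤ t → t ≤ 1 → 0 < X s t
  Y_nonneg : ∀ s t, 0 ≤ s → s ≤ t → t ≤ 1 → 0 ≤ Y s t
  strictMono : ∀ t, 0 ≤ t → t ≤ 1 → StrictMonoOn (fun s => X s t ^ 2 + Y s t ^ 2) (Icc 0 t)
  axis : ∀ s, Y s 1 = 0
  inner_le : ∀ t, 0 ≤ t → t ≤ 1 → X 0 t ^ 2 + Y 0 t ^ 2 ≤ ε ^ 2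
  le_inner : ∀ t, 0 ≤ t → t ≤ 1 →
    ε ^ 2 * (1 - (4 * κ - 2 * κ ^ 2) ^ 2) ≤ X 0 t ^ 2 + Y 0 t ^ 2

/-- Monotonicity of the radius on an isosceles element. -/
theorem iso_radial_pos {φ₀ φ₁ κ S w t : ℝ} (h₀ : 0 < φ₀) (h₁ : 0 < φ₁) (hne : φ₁ ≠ φ₀)
    (hκ0 : 0 ≤ κ) (hκ : κ ≤ 1 / 400) (hκ2 : κ ^ 2 * φ₁ ≤ |φ₁ - φ₀| / 400)
    (hSq : S ^ 2 = κ * (2 - κ)) (hw : w ≤ 1) (ht0 : 0 ≤ t) (htw : t ≤ w) :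
    0 < isoX φ₀ φ₁ κ w t ∧ 0 ≤ φ₀ + (φ₁ - φ₀) * w + (1 - 2 * w) * (κ * φ₁) ∧
    0 < (isoX φ₀ φ₁ κ w t * ((φ₁ - φ₀) + (1 - 2 * w) * (2 * κ * ((φ₁ - φ₀) - κ * φ₁))) +
      isoY φ₀ φ₁ κ S w t * (2 * S * ((φ₁ - φ₀) - 2 * (κ * φ₁)) * t)) * (φ₁ - φ₀) := by
  set Δ := φ₁ - φ₀ with hΔ
  have hΔ0 : 0 < |Δ| := abs_pos.mpr (sub_ne_zero.mpr hne)
  have hw0 : 0 ≤ w := ht0.trans htw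
  set ρ := φ₀ + Δ * w with hρ
  have hφw : φ₁ * w ≤ ρ := by
    rw [hρ, hΔ]; linarith [mul_nonneg h₀.le (sub_nonneg.mpr hw)]
  have hρ0 : 0 < ρ := by
    have e : ρ = φ₀ * (1 - w) + φ₁ * w := by rw [hρ, hΔ]; ring
    rcases hw.lt_or_eq with h | h
    · rw [e]; have : 0 < 1 - w := by linarith
      positivity
    · rw [e, h]; linarith
  have ht1 : t ≤ 1 := htw.trans hw
  have htt : t ^ 2 ≤ w := by nlinarith
  have hφt : φ₁ * t ^ 2 ≤ ρ := (mul_le_mul_of_nonneg_left htt h₁.le).trans hφw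
  have hφt0 : 0 ≤ φ₁ * t ^ 2 := by positivity
  have hww : 0 ≤ w * (1 - w) := mul_nonneg hw0 (by linarith)
  have hww1 : w * (1 - w) ≤ 1 - w := mul_le_of_le_one_left (by linarith) hw
  have hww2 : w * (1 - w) ≤ w := mul_le_of_le_one_right hw0 (by linarith)
  have hΔw : |w * (1 - w) * Δ| ≤ ρ := by
    have e : w * (1 - w) * Δ = φ₁ * (w * (1 - w)) - φ₀ * (w * (1 - w)) := by rw [hΔ]; ring
    have e2 : ρ = φ₀ * (1 - w) + φ₁ * w := by rw [hρ, hΔ]; ring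
    have i1 := mul_le_mul_of_nonneg_left hww1 h₀.le
    have i2 := mul_le_mul_of_nonneg_left hww2 h₁.le
    have i3 := mul_nonneg h₀.le hww
    have i4 := mul_nonneg h₁.le hww
    have i5 : 0 ≤ φ₀ * (1 - w) := mul_nonneg h₀.le (by linarith)
    have i6 := mul_nonneg h₁.le hw0
    rw [e, e2, abs_le]
    constructor <;> linarith
  have hφww : φ₁ * (w * (1 - w)) ≤ ρ := (mul_le_mul_of_nonneg_left hww2 h₁.le).trans hφw
  have hφww0 : 0 ≤ φ₁ * (w * (1 - w)) := mul_nonneg h₁.le hww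
  -- Every correction is a small multiple of a quantity bounded by `ρ`, because `t² ≤ w` and `φ₁ w ≤
  -- ρ`.
  have hX : 9 / 10 * ρ ≤ isoX φ₀ φ₁ κ w t := by
    have e : isoX φ₀ φ₁ κ w t = ρ + 2 * (κ * (w * (1 - w) * Δ)) -
        2 * (κ * (κ * (φ₁ * (w * (1 - w))))) - (4 * κ - 2 * κ ^ 2) * (φ₁ * t ^ 2) := by
      rw [isoX, hρ]; ring
    have a1 : -(1 / 400 * ρ) ≤ κ * (w * (1 - w) * Δ) := by
      have := abs_mul_le_mul ((abs_of_nonneg hκ0).le.trans hκ) hΔw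
      exact (abs_le.mp this).1
    have a2 : κ * (κ * (φ₁ * (w * (1 - w)))) ≤ 1 / 400 * ρ := by
      refine mul_le_mul hκ ?_ (mul_nonneg hκ0 hφww0) (by norm_num)
      exact (mul_le_of_le_one_left hφww0 (by linarith)).trans hφww
    have a3 : (4 * κ - 2 * κ ^ 2) * (φ₁ * t ^ 2) ≤ 1 / 100 * ρ := by
      refine mul_le_mul ?_ hφt hφt0 (by norm_num)
      nlinarith [sq_nonneg κ]
    rw [e]; linarith
  have hp : 0 ≤ ρ + (1 - 2 * w) * (κ * φ₁) := by
    have h1 : -ρ ≤ (1 - 2 * w) * φ₁ := by nlinarith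
    have h2 := mul_le_mul_of_nonneg_left h1 hκ0
    have h3 : κ * ρ ≤ ρ := mul_le_of_le_one_left hρ0.le (by linarith)
    linarith
  refine ⟨by linarith, hp, ?_⟩
  have hΔΔ : Δ * Δ = |Δ| * |Δ| := (abs_mul_abs_self Δ).symm
  -- the radial derivative
  have hx : 9 / 10 * (|Δ| * |Δ|) ≤ (Δ + (1 - 2 * w) * (2 * κ * (Δ - κ * φ₁))) * Δ := by
    have b1 : |1 - 2 * w| ≤ 1 := abs_le.mpr ⟨by linarith, by linarith⟩
    have b2 : |κ * (Δ - κ * φ₁)| ≤ 1 / 200 * |Δ| := by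
      have e : κ * (Δ - κ * φ₁) = κ * Δ - κ ^ 2 * φ₁ := by ring
      rw [e]
      have := abs_sub_le_add (abs_mul_le_mul ((abs_of_nonneg hκ0).le.trans hκ) (le_refl |Δ|))
        ((abs_of_nonneg (by positivity : 0 ≤ κ ^ 2 * φ₁)).le.trans hκ2)
      linarith
    have b3 := (abs_le.mp (abs_mul_le_mul (abs_mul_le_mul b1 b2) (le_refl |Δ|))).1
    have e : (Δ + (1 - 2 * w) * (2 * κ * (Δ - κ * φ₁))) * Δ =
        Δ * Δ + 2 * ((1 - 2 * w) * (κ * (Δ - κ * φ₁)) * Δ) := by ring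
    rw [e, hΔΔ]
    nlinarith [mul_pos hΔ0 hΔ0]
  -- The two factors `S` give `S² = κ (2 - κ)`. Distributing `κ` leaves `κ Δ - 2 κ² φ₁`, a small
  -- multiple of `|Δ|` by the hypothesis on `κ² φ₁`.
  have hy : |isoY φ₀ φ₁ κ S w t * (2 * S * (Δ - 2 * (κ * φ₁)) * t) * Δ| ≤
      1 / 5 * (ρ * (|Δ| * |Δ|)) := by
    have e : isoY φ₀ φ₁ κ S w t * (2 * S * (Δ - 2 * (κ * φ₁)) * t) * Δ =
        (4 * (2 - κ)) * (t ^ 2 * (ρ + (1 - 2 * w) * (κ * φ₁))) *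
          (κ * Δ - 2 * (κ ^ 2 * φ₁)) * Δ := by
      have : isoY φ₀ φ₁ κ S w t * (2 * S * (Δ - 2 * (κ * φ₁)) * t) * Δ =
        4 * S ^ 2 * (t ^ 2 * (ρ + (1 - 2 * w) * (κ * φ₁))) * (Δ - 2 * (κ * φ₁)) * Δ := by
        rw [isoY, hρ]; ring
      rw [this, hSq]; ring
    have b1 : |4 * (2 - κ)| ≤ 8 := abs_le.mpr ⟨by linarith, by linarith⟩
    have b2 : |t ^ 2 * (ρ + (1 - 2 * w) * (κ * φ₁))| ≤ 2 * ρ := by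
      rw [abs_of_nonneg (mul_nonneg (sq_nonneg t) hp)]
      have ht21 : t ^ 2 ≤ 1 := htt.trans hw
      have g1 : t ^ 2 * ρ ≤ ρ := mul_le_of_le_one_left hρ0.le ht21
      have g2 : t ^ 2 * ((1 - 2 * w) * (κ * φ₁)) ≤ κ * (φ₁ * t ^ 2) := by
        have : (1 - 2 * w) * (κ * (φ₁ * t ^ 2)) ≤ 1 * (κ * (φ₁ * t ^ 2)) :=
          mul_le_mul_of_nonneg_right (by linarith) (mul_nonneg hκ0 hφt0)
        linarith
      have g3 : κ * (φ₁ * t ^ 2) ≤ 1 * ρ := mul_le_mul (by linarith) hφt hφt0 (by norm_num)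
      linarith
    have b3 : |κ * Δ - 2 * (κ ^ 2 * φ₁)| ≤ 3 / 400 * |Δ| := by
      have := abs_sub_le_add (abs_mul_le_mul ((abs_of_nonneg hκ0).le.trans hκ) (le_refl |Δ|))
        ((abs_of_nonneg (by positivity : 0 ≤ 2 * (κ ^ 2 * φ₁))).le.trans
          (mul_le_mul_of_nonneg_left hκ2 zero_le_two))
      linarith
    rw [e]
    have := abs_mul_le_mul (abs_mul_le_mul (abs_mul_le_mul b1 b2) b3) (le_refl |Δ|)
    have h0 : 0 ≤ ρ * (|Δ| * |Δ|) := by positivity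
    linarith
  -- The axial part contributes at least `0.81 ρ Δ²`, against at most `0.2 ρ Δ²` from the transverse
  -- part.
  have h1 : 9 / 10 * ρ * (9 / 10 * (|Δ| * |Δ|)) ≤
      isoX φ₀ φ₁ κ w t * ((Δ + (1 - 2 * w) * (2 * κ * (Δ - κ * φ₁))) * Δ) :=
    mul_le_mul hX hx (by positivity) (by linarith)
  have h2 := (abs_le.mp hy).1
  have h3 : 0 < ρ * (|Δ| * |Δ|) := by positivity
  have e : (isoX φ₀ φ₁ κ w t * (Δ + (1 - 2 * w) * (2 * κ * (Δ - κ * φ₁))) +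
      isoY φ₀ φ₁ κ S w t * (2 * S * (Δ - 2 * (κ * φ₁)) * t)) * Δ =
      isoX φ₀ φ₁ κ w t * ((Δ + (1 - 2 * w) * (2 * κ * (Δ - κ * φ₁))) * Δ) +
      isoY φ₀ φ₁ κ S w t * (2 * S * (Δ - 2 * (κ * φ₁)) * t) * Δ := by ring
  rw [e]
  linarith

theorem iso_hasDerivAt (φ₀ φ₁ κ S w t : ℝ) :
    HasDerivAt (fun w => isoX φ₀ φ₁ κ w t ^ 2 + isoY φ₀ φ₁ κ S w t ^ 2)
      (2 * (isoX φ₀ φ₁ κ w t * ((φ₁ - φ₀) + (1 - 2 * w) * (2 * κ * ((φ₁ - φ₀) - κ * φ₁))) +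
        isoY φ₀ φ₁ κ S w t * (2 * S * ((φ₁ - φ₀) - 2 * (κ * φ₁)) * t))) w := by
  have hid := hasDerivAt_id' w
  have hX : HasDerivAt (fun w => isoX φ₀ φ₁ κ w t)
      ((φ₁ - φ₀) + (1 - 2 * w) * (2 * κ * ((φ₁ - φ₀) - κ * φ₁))) w := by
    have h := ((((hid.const_mul (φ₁ - φ₀)).const_add φ₀).add
      ((hid.mul (hid.const_sub 1)).mul_const (2 * κ * ((φ₁ - φ₀) - κ * φ₁)))).sub_const
        ((4 * κ - 2 * κ ^ 2) * φ₁ * t ^ 2))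
    exact h.congr_deriv (by ring)
  have hY : HasDerivAt (fun w => isoY φ₀ φ₁ κ S w t)
      (2 * S * ((φ₁ - φ₀) - 2 * (κ * φ₁)) * t) w := by
    have h := ((((hid.const_mul (φ₁ - φ₀)).const_add φ₀).add
      (((hid.const_mul 2).const_sub 1).mul_const (κ * φ₁))).const_mul (2 * S)).mul_const t
    exact h.congr_deriv (by ring)
  exact ((hX.pow 2).add (hY.pow 2)).congr_deriv (by push_cast; ring)

/-- The radius along the base of an isosceles element. -/
theorem iso_base (φ₀ φ₁ t : ℝ) {κ S : ℝ} (hSq : S ^ 2 = κ * (2 - κ)) :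
    isoX φ₀ φ₁ κ 1 t ^ 2 + isoY φ₀ φ₁ κ S 1 t ^ 2 =
      φ₁ ^ 2 * (1 - (4 * κ - 2 * κ ^ 2) ^ 2 * (t ^ 2 * (1 - t ^ 2))) := by
  have : isoY φ₀ φ₁ κ S 1 t ^ 2 = 4 * S ^ 2 * (φ₁ - κ * φ₁) ^ 2 * t ^ 2 := by
    rw [isoY]; ring
  rw [this, hSq, isoX]
  ring

theorem unit_sq_bounds {t : ℝ} (h0 : 0 ≤ t) (h1 : t ≤ 1) :
    0 ≤ t ^ 2 * (1 - t ^ 2) ∧ t ^ 2 * (1 - t ^ 2) ≤ 1 := by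
  have h2 : t ^ 2 ≤ 1 := pow_le_one₀ h0 h1
  exact ⟨mul_nonneg (sq_nonneg t) (by linarith), mul_le_one₀ h2 (by linarith)
    (by linarith [sq_nonneg t])⟩

section Pieces

variable {ε τ h κ S : ℝ}

/-- Elements of type B as the second element of a half-sector. -/
theorem sectorPiece_iso (P : SectorParams ε τ h κ S) :
    SectorPiece ε τ h κ S (fun s t => isoX (ε + τ) ε κ (1 - s) (1 - t))
      (fun s t => isoY (ε + τ) ε κ S (1 - s) (1 - t)) := by
  have hc := cos_of_half P.sin_eq
  have hs := sin_of_half P.cos_eq P.sin_eq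
  have hq := P.S_sq
  have hστ : 0 < ε + τ := add_pos P.ε_pos P.τ_pos
  have key := fun (w t : ℝ) (hw : w ≤ 1) (ht : 0 ≤ t) (htw : t ≤ w) =>
    iso_radial_pos (κ := κ) (S := S) hστ P.ε_pos (by linarith [P.τ_pos]) P.κ_nonneg P.κ_small
    (by
      rw [show ε - (ε + τ) = -τ by ring, abs_neg, abs_of_pos P.τ_pos]
      have := mul_nonneg (sq_nonneg κ) P.τ_pos.le
      linarith [P.κ_sq_small]) hq hw ht htw
  refine
    { continuous_X := by unfold isoX; fun_prop
      continuous_Y := by unfold isoY; fun_prop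
      diag_X := fun t => ?_
      diag_Y := fun t => ?_
      X_pos := fun s t h0 h1 h2 => (key (1 - s) (1 - t) (by linarith) (by linarith)
        (by linarith)).1
      Y_nonneg := fun s t h0 h1 h2 => ?_
      strictMono := fun t ht0 ht1 => ?_
      axis := fun s => by simp [isoY]
      inner_le := fun t h0 h1 => ?_
      le_inner := fun t h0 h1 => ?_ }
  · rw [hc, hs]
    simp only [isoX, isoY]
    linear_combination (-2 * (ε + τ + (ε - (ε + τ)) * (1 - t) + (1 - t) * (1 - (1 - t)) *
      (2 * κ * ((ε - (ε + τ)) - κ * ε)) - (4 * κ - 2 * κ ^ 2) * ε * (1 - t) ^ 2) +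
      4 * (1 - κ) * (ε + τ + (ε - (ε + τ)) * (1 - t) + (1 - 2 * (1 - t)) * (κ * ε)) *
      (1 - t)) * hq
  · rw [hc, hs]
    simp only [isoX, isoY]
    linear_combination (4 * S * (ε + τ + (ε - (ε + τ)) * (1 - t) +
      (1 - 2 * (1 - t)) * (κ * ε)) * (1 - t)) * hq
  · have := (key (1 - s) (1 - t) (by linarith) (by linarith) (by linarith)).2.1
    have hS := P.S_pos
    have : 0 ≤ 1 - t := by linarith
    simp only [isoY]
    positivity
  · refine strictMonoOn_of_deriv_pos (convex_Icc 0 t) ?_ ?_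
    · unfold isoX isoY; fun_prop
    · intro s hs'
      rw [interior_Icc] at hs'
      have hd := (iso_hasDerivAt (ε + τ) ε κ S (1 - s) (1 - t)).comp s
        ((hasDerivAt_id' s).const_sub 1)
      have hd' : deriv (fun s => isoX (ε + τ) ε κ (1 - s) (1 - t) ^ 2 +
        isoY (ε + τ) ε κ S (1 - s) (1 - t) ^ 2) s = _ := hd.deriv
      rw [hd']
      have := (key (1 - s) (1 - t) (by linarith [hs'.1]) (by linarith)
        (by linarith [hs'.2])).2.2
      -- For type B the radius decreases in `w`; with `w = 1 - s` the two signs cancel and it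
      -- increases in `s`.
      have hneg : ε - (ε + τ) < 0 := by linarith [P.τ_pos]
      have := neg_of_mul_pos_left this hneg.le
      linarith
  · simp only [sub_zero]
    rw [iso_base _ _ _ hq]
    have := unit_sq_bounds (t := 1 - t) (by linarith) (by linarith)
    have h3 : 0 ≤ (4 * κ - 2 * κ ^ 2) ^ 2 * ((1 - t) ^ 2 * (1 - (1 - t) ^ 2)) :=
      mul_nonneg (sq_nonneg _) this.1
    exact mul_le_of_le_one_right (sq_nonneg ε) (by linarith)
  · simp only [sub_zero]
    rw [iso_base _ _ _ hq]
    have := unit_sq_bounds (t := 1 - t) (by linarith) (by linarith)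
    have h3 : (4 * κ - 2 * κ ^ 2) ^ 2 * ((1 - t) ^ 2 * (1 - (1 - t) ^ 2)) ≤
      (4 * κ - 2 * κ ^ 2) ^ 2 := mul_le_of_le_one_right (sq_nonneg _) this.2
    exact mul_le_mul_of_nonneg_left (by linarith) (sq_nonneg ε)

/-- Elements of types C and D as the second element of a half-sector. -/
theorem sectorPiece_corner (P : SectorParams ε τ h κ S) :
    SectorPiece ε τ h κ S (fun s t => cornerX ε τ κ s (1 - t))
      (fun s t => cornerY ε τ κ S s (1 - t)) := by
  have hc := cos_of_half P.sin_eq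
  have hs := sin_of_half P.cos_eq P.sin_eq
  have hq := P.S_sq
  have hε := P.ε_pos
  have hτ := P.τ_pos
  have hS := P.S_pos
  have hκ0 := P.κ_nonneg
  have hκ := P.κ_small
  have hX1 : ∀ t, 0 ≤ t → t ≤ 1 → 0 < 1 - 2 * κ ^ 2 * t - 4 * κ * (1 - κ) * t ^ 2 := by
    intro t h0 h1
    have a1 : κ ^ 2 * t ≤ 1 / 400 * 1 :=
      mul_le_mul (by nlinarith) h1 h0 (by norm_num)
    have a2 : κ * (1 - κ) * t ^ 2 ≤ 1 / 400 * 1 :=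
      mul_le_mul (by nlinarith) (pow_le_one₀ h0 h1) (sq_nonneg t) (by norm_num)
    linarith
  have hX2 : ∀ t, 0 ≤ t → t ≤ 1 → 0 < 1 - 2 * κ * t := by
    intro t h0 h1
    have : κ * t ≤ 1 / 400 * 1 := mul_le_mul hκ h1 h0 (by norm_num)
    linarith
  have hY1 : ∀ t, 0 ≤ t → t ≤ 1 → 0 ≤ 2 * S * (1 + κ) * t - 4 * S * κ * t ^ 2 := by
    intro t h0 h1
    have e : 2 * S * (1 + κ) * t - 4 * S * κ * t ^ 2 = 2 * S * t * (1 + κ - 2 * (κ * t)) := by ring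
    have : κ * t ≤ 1 / 400 * 1 := mul_le_mul hκ h1 h0 (by norm_num)
    rw [e]
    exact mul_nonneg (by positivity) (by linarith)
  have hXpos : ∀ s t, 0 ≤ s → 0 ≤ t → t ≤ 1 → 0 < cornerX ε τ κ s t := by
    intro s t h0 h1 h2
    have a := mul_pos hε (hX1 t h1 h2)
    have b := mul_nonneg (mul_nonneg hτ.le h0) (hX2 t h1 h2).le
    rw [cornerX]; linarith
  have hYnn : ∀ s t, 0 ≤ s → 0 ≤ t → t ≤ 1 → 0 ≤ cornerY ε τ κ S s t := by
    intro s t h0 h1 h2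
    have a := mul_nonneg hε.le (hY1 t h1 h2)
    have b : 0 ≤ 2 * S * τ * s * t := by positivity
    rw [cornerY]; linarith
  -- The inner edge spans the angle `h` rather than `2h`. This is the base formula of isosceles
  -- elements with the centred parameter `2t - 1`, and with `κ` in place of `4κ - 2κ²`.
  have hbase : ∀ t, cornerX ε τ κ 0 t ^ 2 + cornerY ε τ κ S 0 t ^ 2 =
      ε ^ 2 * (1 - κ ^ 2 * ((2 * t - 1) ^ 2 * (1 - (2 * t - 1) ^ 2))) := by
    intro t
    have : cornerY ε τ κ S 0 t ^ 2 = S ^ 2 * (ε * (2 * (1 + κ) * t - 4 * κ * t ^ 2)) ^ 2 := by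
      rw [cornerY]; ring
    rw [this, hq, cornerX]
    ring
  have hunit : ∀ t : ℝ, 0 ≤ t → t ≤ 1 → 0 ≤ (2 * t - 1) ^ 2 * (1 - (2 * t - 1) ^ 2) ∧
      (2 * t - 1) ^ 2 * (1 - (2 * t - 1) ^ 2) ≤ 1 := by
    intro t h0 h1
    rw [← sq_abs]
    exact unit_sq_bounds (abs_nonneg _) (abs_le.mpr ⟨by linarith, by linarith⟩)
  refine
    { continuous_X := by unfold cornerX; fun_prop
      continuous_Y := by unfold cornerY; fun_prop
      diag_X := fun t => ?_
      diag_Y := fun t => ?_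
      X_pos := fun s t h0 h1 h2 => hXpos s (1 - t) h0 (by linarith) (by linarith)
      Y_nonneg := fun s t h0 h1 h2 => hYnn s (1 - t) h0 (by linarith) (by linarith)
      strictMono := fun t ht0 ht1 => ?_
      axis := fun s => by simp [cornerY]
      inner_le := fun t h0 h1 => ?_
      le_inner := fun t h0 h1 => ?_ }
  · rw [hc, hs]
    simp only [isoX, cornerX, cornerY]
    linear_combination (-2 * (ε * (1 - 2 * κ ^ 2 * (1 - t) - 4 * κ * (1 - κ) * (1 - t) ^ 2) +
      τ * t * (1 - 2 * κ * (1 - t))) + 2 * (1 - κ) * (ε * (2 * (1 + κ) * (1 - t) -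
      4 * κ * (1 - t) ^ 2) + 2 * τ * t * (1 - t))) * hq
  · rw [hc, hs]
    simp only [isoY, cornerX, cornerY]
    linear_combination (2 * S * (ε * (2 * (1 + κ) * (1 - t) -
      4 * κ * (1 - t) ^ 2) + 2 * τ * t * (1 - t))) * hq
  -- For fixed `t` both coordinates are affine in `s`, positive or nonnegative, and nondecreasing,
  -- the first one strictly.
  · intro s₁ hs₁ s₂ hs₂ hlt
    have h1t : 0 ≤ 1 - t := by linarith
    have h1t1 : 1 - t ≤ 1 := by linarith
    have hXlt : cornerX ε τ κ s₁ (1 - t) < cornerX ε τ κ s₂ (1 - t) := by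
      have := mul_lt_mul_of_pos_right (mul_lt_mul_of_pos_left hlt hτ) (hX2 (1 - t) h1t h1t1)
      rw [cornerX, cornerX]; linarith
    have hYle : cornerY ε τ κ S s₁ (1 - t) ≤ cornerY ε τ κ S s₂ (1 - t) := by
      have : 2 * S * τ * (1 - t) * s₁ ≤ 2 * S * τ * (1 - t) * s₂ :=
        mul_le_mul_of_nonneg_left hlt.le (by positivity)
      rw [cornerY, cornerY]; linarith
    have a := pow_lt_pow_left₀ hXlt (hXpos s₁ (1 - t) hs₁.1 h1t h1t1).le two_ne_zero
    have b := pow_le_pow_left₀ (hYnn s₁ (1 - t) hs₁.1 h1t h1t1) hYle 2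
    simp only
    linarith
  · rw [hbase]
    have := hunit (1 - t) (by linarith) (by linarith)
    have h3 := mul_nonneg (sq_nonneg κ) this.1
    exact mul_le_of_le_one_right (sq_nonneg ε) (by linarith)
  · rw [hbase]
    have := hunit (1 - t) (by linarith) (by linarith)
    have h3 := mul_le_of_le_one_right (sq_nonneg κ) this.2
    have h4 : κ ^ 2 ≤ (4 * κ - 2 * κ ^ 2) ^ 2 := by
      refine pow_le_pow_left₀ hκ0 ?_ 2
      nlinarith
    exact mul_le_mul_of_nonneg_left (by linarith) (sq_nonneg ε)

end Pieces
end
noncomputable section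

/-! ### Half-sectors cover the annulus -/

/-- First coordinate on a half-sector: an element of type A, followed by a second element. -/
def sectorX (ε τ h κ : ℝ) (X Y : ℝ → ℝ → ℝ) (z : ℝ × ℝ) : ℝ :=
  if z.2 ≤ z.1 then isoX ε (ε + τ) κ z.1 z.2 else
    Real.cos h * X z.1 z.2 + Real.sin h * Y z.1 z.2

/-- Second coordinate on a half-sector. -/
def sectorY (ε τ h κ S : ℝ) (X Y : ℝ → ℝ → ℝ) (z : ℝ × ℝ) : ℝ :=
  if z.2 ≤ z.1 then isoY ε (ε + τ) κ S z.1 z.2 else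
    Real.sin h * X z.1 z.2 - Real.cos h * Y z.1 z.2

/-- The squared radius on a half-sector. -/
def sectorN (ε τ h κ S : ℝ) (X Y : ℝ → ℝ → ℝ) (z : ℝ × ℝ) : ℝ :=
  sectorX ε τ h κ X Y z ^ 2 + sectorY ε τ h κ S X Y z ^ 2

theorem SectorParams.iso_pos {ε τ h κ S : ℝ} (P : SectorParams ε τ h κ S) {w t : ℝ}
    (hw : w ≤ 1) (ht0 : 0 ≤ t) (htw : t ≤ w) :
    0 < isoX ε (ε + τ) κ w t ∧ 0 ≤ isoY ε (ε + τ) κ S w t ∧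
      0 < isoX ε (ε + τ) κ w t * ((ε + τ - ε) +
        (1 - 2 * w) * (2 * κ * ((ε + τ - ε) - κ * (ε + τ)))) +
      isoY ε (ε + τ) κ S w t * (2 * S * ((ε + τ - ε) - 2 * (κ * (ε + τ))) * t) := by
  have hστ : 0 < ε + τ := add_pos P.ε_pos P.τ_pos
  have e : ε + τ - ε = τ := by ring
  obtain ⟨h1, h2, h3⟩ := iso_radial_pos (κ := κ) (S := S) P.ε_pos hστ (by linarith [P.τ_pos])
    P.κ_nonneg P.κ_small (by
      rw [e, abs_of_pos P.τ_pos]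
      exact P.κ_sq_small) P.S_sq hw ht0 htw
  refine ⟨h1, ?_, pos_of_mul_pos_left h3 (by linarith [P.τ_pos])⟩
  have := P.S_pos
  rw [isoY]
  exact mul_nonneg (mul_nonneg (by linarith) h2) ht0

section Sector

variable {ε τ h κ S : ℝ} {X Y : ℝ → ℝ → ℝ}

theorem sectorX_of_le (H : SectorPiece ε τ h κ S X Y) {s t : ℝ} (hst : s ≤ t) :
    sectorX ε τ h κ X Y (s, t) = Real.cos h * X s t + Real.sin h * Y s t := by
  rcases hst.lt_or_eq with hlt | rfl
  · exact if_neg (not_le.mpr hlt)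
  · rw [H.diag_X]; exact if_pos le_rfl

theorem sectorY_of_le (H : SectorPiece ε τ h κ S X Y) {s t : ℝ} (hst : s ≤ t) :
    sectorY ε τ h κ S X Y (s, t) = Real.sin h * X s t - Real.cos h * Y s t := by
  rcases hst.lt_or_eq with hlt | rfl
  · exact if_neg (not_le.mpr hlt)
  · rw [H.diag_Y]; exact if_pos le_rfl

theorem sectorX_of_ge {s t : ℝ} (hst : t ≤ s) :
    sectorX ε τ h κ X Y (s, t) = isoX ε (ε + τ) κ s t := if_pos hst

theorem sectorY_of_ge {s t : ℝ} (hst : t ≤ s) :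
    sectorY ε τ h κ S X Y (s, t) = isoY ε (ε + τ) κ S s t := if_pos hst

theorem sectorN_of_ge {s t : ℝ} (hst : t ≤ s) :
    sectorN ε τ h κ S X Y (s, t) = isoX ε (ε + τ) κ s t ^ 2 + isoY ε (ε + τ) κ S s t ^ 2 := by
  rw [sectorN, sectorX_of_ge hst, sectorY_of_ge hst]

theorem sectorN_of_le (H : SectorPiece ε τ h κ S X Y) {s t : ℝ} (hst : s ≤ t) :
    sectorN ε τ h κ S X Y (s, t) = X s t ^ 2 + Y s t ^ 2 := by
  rw [sectorN, sectorX_of_le H hst, sectorY_of_le H hst]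
  linear_combination (X s t ^ 2 + Y s t ^ 2) * Real.cos_sq_add_sin_sq h

theorem continuous_sectorX (H : SectorPiece ε τ h κ S X Y) :
    Continuous (sectorX ε τ h κ X Y) := by
  have hX := H.continuous_X
  have hY := H.continuous_Y
  refine Continuous.if_le (by unfold isoX; fun_prop) (by fun_prop) continuous_snd continuous_fst ?_
  rintro ⟨s, t⟩ (rfl : t = s)
  exact (H.diag_X t).symm

theorem continuous_sectorY (H : SectorPiece ε τ h κ S X Y) :
    Continuous (sectorY ε τ h κ S X Y) := by
  have hX := H.continuous_X
  have hY := H.continuous_Y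
  refine Continuous.if_le (by unfold isoY; fun_prop) (by fun_prop) continuous_snd continuous_fst ?_
  rintro ⟨s, t⟩ (rfl : t = s)
  exact (H.diag_Y t).symm

theorem continuous_sectorN (H : SectorPiece ε τ h κ S X Y) :
    Continuous (sectorN ε τ h κ S X Y) :=
  ((continuous_sectorX H).pow 2).add ((continuous_sectorY H).pow 2)

/-- The line of constant `t` crosses the second element for `s ≤ t` and the element of type A for `s
≥ t`. Monotonicity holds on both parts, and they meet on the common edge `s = t`. -/
theorem sectorN_strictMono (P : SectorParams ε τ h κ S) (H : SectorPiece ε τ h κ S X Y) {t : ℝ}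
    (h0 : 0 ≤ t) (h1 : t ≤ 1) :
    StrictMonoOn (fun s => sectorN ε τ h κ S X Y (s, t)) (Icc 0 1) := by
  rw [← Icc_union_Icc_eq_Icc h0 h1]
  refine StrictMonoOn.union (c := t) ?_ ?_ ⟨right_mem_Icc.mpr h0, fun x hx => hx.2⟩
    ⟨left_mem_Icc.mpr h1, fun x hx => hx.1⟩
  · exact (H.strictMono t h0 h1).congr fun s hs => (sectorN_of_le H hs.2).symm
  · refine StrictMonoOn.congr (f₁ := fun s => isoX ε (ε + τ) κ s t ^ 2 +
      isoY ε (ε + τ) κ S s t ^ 2) ?_ fun s hs => (sectorN_of_ge hs.1).symm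
    refine strictMonoOn_of_deriv_pos (convex_Icc t 1) ?_ ?_
    · unfold isoX isoY; fun_prop
    · intro s hs
      rw [interior_Icc] at hs
      rw [(iso_hasDerivAt ε (ε + τ) κ S s t).deriv]
      exact mul_pos two_pos (P.iso_pos hs.2.le h0 hs.1.le).2.2

/-- The radius on a half-sector is between those of the circles, up to a higher-order term. -/
theorem sectorN_bounds (P : SectorParams ε τ h κ S) (H : SectorPiece ε τ h κ S X Y) {s t : ℝ}
    (h0 : 0 ≤ t) (h1 : t ≤ 1) (hs0 : 0 ≤ s) (hs1 : s ≤ 1) :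
    ε ^ 2 * (1 - (4 * κ - 2 * κ ^ 2) ^ 2) ≤ sectorN ε τ h κ S X Y (s, t) ∧
      sectorN ε τ h κ S X Y (s, t) ≤ (ε + τ) ^ 2 := by
  have hm := (sectorN_strictMono P H h0 h1).monotoneOn
  constructor
  · refine le_trans ?_ (hm (left_mem_Icc.mpr zero_le_one) ⟨hs0, hs1⟩ hs0)
    simp only
    rw [sectorN_of_le H h0]
    exact H.le_inner t h0 h1
  · refine (hm ⟨hs0, hs1⟩ (right_mem_Icc.mpr zero_le_one) hs1).trans ?_
    simp only
    rw [sectorN_of_ge h1, iso_base _ _ _ P.S_sq]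
    have := mul_nonneg (sq_nonneg (4 * κ - 2 * κ ^ 2)) (unit_sq_bounds h0 h1).1
    exact mul_le_of_le_one_right (sq_nonneg _) (by linarith)

/-- Every circle between the two boundaries of a half-sector is covered. -/
theorem sector_cover (P : SectorParams ε τ h κ S) (H : SectorPiece ε τ h κ S X Y) {R θ : ℝ}
    (hR : ε ≤ R) (hR' : R ^ 2 ≤ (ε + τ) ^ 2 * (1 - (4 * κ - 2 * κ ^ 2) ^ 2))
    (hθ0 : 0 ≤ θ) (hθh : θ ≤ h) :
    ∃ s t, 0 ≤ s ∧ s ≤ 1 ∧ 0 ≤ t ∧ t ≤ 1 ∧ sectorX ε τ h κ X Y (s, t) = R * Real.cos θ ∧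
      sectorY ε τ h κ S X Y (s, t) = R * Real.sin θ := by
  have hε := P.ε_pos
  have hpi := Real.pi_gt_three
  have hh1 := P.h_le
  have hsinθ : 0 ≤ Real.sin θ := Real.sin_nonneg_of_nonneg_of_le_pi hθ0 (by linarith)
  have hcosθ : 0 < Real.cos θ := Real.cos_pos_of_mem_Ioo ⟨by linarith, by linarith⟩
  have hsinhθ : 0 ≤ Real.sin (h - θ) :=
    Real.sin_nonneg_of_nonneg_of_le_pi (by linarith) (by linarith)
  have hcoshθ : 0 < Real.cos (h - θ) := Real.cos_pos_of_mem_Ioo ⟨by linarith, by linarith⟩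
  set N := sectorN ε τ h κ S X Y with hN
  -- `G` is the radius times the sine of the polar angle minus `θ`; a zero of `G` on the level set
  -- of radius `R` is sought.
  set G : ℝ × ℝ → ℝ := fun z => sectorY ε τ h κ S X Y z * Real.cos θ -
    sectorX ε τ h κ X Y z * Real.sin θ with hG
  have hGc : Continuous G := by
    have := continuous_sectorX H
    have := continuous_sectorY H
    fun_prop
  have hNc : Continuous N := continuous_sectorN H
  -- The radius is at most `ε` on the inner boundary and at least `R` on the outer one, so every
  -- line of constant `t` meets the circle.
  have hex : ∀ t ∈ Icc (0 : ℝ) 1, ∃ s ∈ Icc (0 : ℝ) 1, N (s, t) = R ^ 2 := by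
    intro t ht
    have hc : ContinuousOn (fun s => N (s, t)) (Icc 0 1) := by fun_prop
    refine intermediate_value_Icc zero_le_one hc ⟨?_, ?_⟩
    · simp only [hN]
      rw [sectorN_of_le H ht.1]
      exact (H.inner_le t ht.1 ht.2).trans (pow_le_pow_left₀ hε.le hR 2)
    · simp only [hN]
      rw [sectorN_of_ge ht.2, iso_base _ _ _ P.S_sq]
      refine hR'.trans (mul_le_mul_of_nonneg_left ?_ (sq_nonneg _))
      have := mul_le_of_le_one_right (sq_nonneg (4 * κ - 2 * κ ^ 2)) (unit_sq_bounds ht.1 ht.2).2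
      linarith
  set Z : Set (ℝ × ℝ) := (Icc 0 1 ×ˢ Icc 0 1) ∩ {z | N z = R ^ 2} with hZ
  have hZc : IsCompact Z :=
    (isCompact_Icc.prod isCompact_Icc).inter_right (isClosed_eq hNc continuous_const)
  have hU : IsClosed (Prod.snd '' (Z ∩ {z | G z ≤ 0})) :=
    ((hZc.inter_right (isClosed_le hGc continuous_const)).image continuous_snd).isClosed
  have hV : IsClosed (Prod.snd '' (Z ∩ {z | 0 ≤ G z})) :=
    ((hZc.inter_right (isClosed_le continuous_const hGc)).image continuous_snd).isClosed
  -- The values of `t` are split by the sign of `G` on the circle. Both sets are closed as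
  -- projections of compact sets, so connectedness of `[0,1]` produces a common `t`.
  have hcover : Icc (0 : ℝ) 1 ⊆ Prod.snd '' (Z ∩ {z | G z ≤ 0}) ∪
      Prod.snd '' (Z ∩ {z | 0 ≤ G z}) := by
    intro t ht
    obtain ⟨s, hs, hNs⟩ := hex t ht
    rcases le_total (G (s, t)) 0 with hg | hg
    · exact Or.inl ⟨(s, t), ⟨⟨⟨hs, ht⟩, hNs⟩, hg⟩, rfl⟩
    · exact Or.inr ⟨(s, t), ⟨⟨⟨hs, ht⟩, hNs⟩, hg⟩, rfl⟩
  -- At `t = 0` the point lies on the axis of the element of type A, at angle `0`; at `t = 1` it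
  -- lies on the other axis, at angle `h`.
  have hU0 : (Icc (0 : ℝ) 1 ∩ Prod.snd '' (Z ∩ {z | G z ≤ 0})).Nonempty := by
    have ht : (0 : ℝ) ∈ Icc (0 : ℝ) 1 := left_mem_Icc.mpr zero_le_one
    obtain ⟨s, hs, hNs⟩ := hex 0 ht
    refine ⟨0, ht, (s, 0), ⟨⟨⟨hs, ht⟩, hNs⟩, ?_⟩, rfl⟩
    simp only [hG, mem_ofPred_eq]
    rw [sectorX_of_ge hs.1, sectorY_of_ge hs.1]
    have h1 : isoY ε (ε + τ) κ S s 0 = 0 := by simp [isoY]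
    have h2 := mul_nonneg (P.iso_pos hs.2 le_rfl hs.1).1.le hsinθ
    rw [h1]
    linarith
  have hV0 : (Icc (0 : ℝ) 1 ∩ Prod.snd '' (Z ∩ {z | 0 ≤ G z})).Nonempty := by
    have ht : (1 : ℝ) ∈ Icc (0 : ℝ) 1 := right_mem_Icc.mpr zero_le_one
    obtain ⟨s, hs, hNs⟩ := hex 1 ht
    refine ⟨1, ht, (s, 1), ⟨⟨⟨hs, ht⟩, hNs⟩, ?_⟩, rfl⟩
    simp only [hG, mem_ofPred_eq]
    rw [sectorX_of_le H hs.2, sectorY_of_le H hs.2, H.axis]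
    have h2 := mul_nonneg (H.X_pos s 1 hs.1 hs.2 le_rfl).le hsinhθ
    rw [Real.sin_sub] at h2
    linarith
  obtain ⟨t, ht, ⟨⟨s, t'⟩, ⟨⟨⟨hs, -⟩, hNs⟩, hgs⟩, rfl⟩, ⟨⟨s', t''⟩, ⟨⟨⟨hs', -⟩, hNs'⟩, hgs'⟩, rfl⟩⟩ :=
    isPreconnected_closed_iff.mp isPreconnected_Icc _ _ hU hV hcover hU0 hV0
  -- The common `t` comes with two points of the circle. Strict monotonicity of the radius
  -- identifies them, so `G` has both signs at one point.
  have hss : s = s' := by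
    refine (sectorN_strictMono P H ht.1 ht.2).injOn hs hs' ?_
    exact hNs.trans hNs'.symm
  subst hss
  simp only at ht
  have hG0 : G (s, t'') = 0 := le_antisymm hgs hgs'
  -- `G = 0` leaves the direction `θ` or its opposite; positivity of this component excludes the
  -- latter.
  have hpos : 0 < sectorX ε τ h κ X Y (s, t'') * Real.cos θ +
      sectorY ε τ h κ S X Y (s, t'') * Real.sin θ := by
    rcases le_total t'' s with hts | hst
    · rw [sectorX_of_ge hts, sectorY_of_ge hts]
      obtain ⟨a, b, -⟩ := P.iso_pos hs.2 ht.1 hts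
      exact add_pos_of_pos_of_nonneg (mul_pos a hcosθ) (mul_nonneg b hsinθ)
    · rw [sectorX_of_le H hst, sectorY_of_le H hst]
      have a := mul_pos (H.X_pos s t'' hs.1 hst ht.2) hcoshθ
      have b := mul_nonneg (H.Y_nonneg s t'' hs.1 hst ht.2) hsinhθ
      rw [Real.cos_sub] at a
      rw [Real.sin_sub] at b
      linarith
  have hRpos : 0 < R := hε.trans_le hR
  have hsq := Real.cos_sq_add_sin_sq θ
  have hNs2 : sectorX ε τ h κ X Y (s, t'') ^ 2 + sectorY ε τ h κ S X Y (s, t'') ^ 2 = R ^ 2 := hNs'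
  simp only [hG] at hG0
  have hHR : sectorX ε τ h κ X Y (s, t'') * Real.cos θ +
      sectorY ε τ h κ S X Y (s, t'') * Real.sin θ = R := by
    refine (pow_left_inj₀ hpos.le hRpos.le two_ne_zero).mp ?_
    rw [← hNs2]
    linear_combination (sectorX ε τ h κ X Y (s, t'') ^ 2 +
      sectorY ε τ h κ S X Y (s, t'') ^ 2) * hsq - (sectorY ε τ h κ S X Y (s, t'') * Real.cos θ -
      sectorX ε τ h κ X Y (s, t'') * Real.sin θ) * hG0
  refine ⟨s, t'', hs.1, hs.2, ht.1, ht.2, ?_, ?_⟩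
  · linear_combination Real.cos θ * hHR - Real.sin θ * hG0 - sectorX ε τ h κ X Y (s, t'') * hsq
  · linear_combination Real.sin θ * hHR + Real.cos θ * hG0 - sectorY ε τ h κ S X Y (s, t'') * hsq

/-- A set that contains the two elements of a half-sector, or of its mirror image, contains the
circular arcs of the half-sector. -/
theorem polarPoint_mem_of_sector (P : SectorParams ε τ h κ S) (H : SectorPiece ε τ h κ S X Y)
    {c σ : ℝ} (hσ : σ = 1 ∨ σ = -1) {U : Set Plane}
    (hA : ∀ s t, 0 ≤ t → t ≤ s → s ≤ 1 →
      rotPoint c (isoX ε (ε + τ) κ s t) (σ * isoY ε (ε + τ) κ S s t) ∈ U)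
    (hB : ∀ s t, 0 ≤ s → s ≤ t → t ≤ 1 → rotPoint (c + σ * h) (X s t) (-(σ * Y s t)) ∈ U)
    {R θ : ℝ} (hR : ε ≤ R) (hR' : R ^ 2 ≤ (ε + τ) ^ 2 * (1 - (4 * κ - 2 * κ ^ 2) ^ 2))
    (hθ0 : 0 ≤ θ) (hθh : θ ≤ h) : polarPoint R (c + σ * θ) ∈ U := by
  obtain ⟨s, t, hs0, hs1, ht0, ht1, hX, hY⟩ := sector_cover P H hR hR' hθ0 hθh
  have hcos : ∀ x, Real.cos (σ * x) = Real.cos x := by rcases hσ with rfl | rfl <;> simp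
  have hsin : ∀ x, Real.sin (σ * x) = σ * Real.sin x := by rcases hσ with rfl | rfl <;> simp
  have hσ2 : σ * σ = 1 := by rcases hσ with rfl | rfl <;> norm_num
  have e : polarPoint R (c + σ * θ) = rotPoint c (sectorX ε τ h κ X Y (s, t))
      (σ * sectorY ε τ h κ S X Y (s, t)) := by
    rw [hX, hY, ← rotPoint_polar, hcos, hsin]
    congr 1; ring
  rw [e]
  rcases le_total t s with hts | hst
  · rw [sectorX_of_ge hts, sectorY_of_ge hts]
    exact hA s t ht0 hts hs1
  · have := hB s t hs0 hst ht1
    rw [rotPoint_add, hcos, hsin] at this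
    rw [sectorX_of_le H hst, sectorY_of_le H hst]
    convert this using 2
    · linear_combination -(Real.sin h * Y s t) * hσ2
    · ring

end Sector
end
noncomputable section

/-! ### The region covered by a layer -/

/-- The number `κ = 1 - cos (π / (2N))`. -/
def meshCos (N : ℕ) : ℝ := 1 - Real.cos (Real.pi / N / 2)

/-- The number `S = sin (π / (2N))`. -/
def meshSin (N : ℕ) : ℝ := Real.sin (Real.pi / N / 2)

theorem meshCos_nonneg (N : ℕ) : 0 ≤ meshCos N := by
  rw [meshCos]; linarith [Real.cos_le_one (Real.pi / N / 2)]

theorem meshCos_le (N : ℕ) : meshCos N ≤ 2 * (1 / (N : ℝ) ^ 2) := by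
  have h := Real.one_sub_sq_div_two_le_cos (x := Real.pi / N / 2)
  have hpi : Real.pi ^ 2 ≤ 16 := by
    have := Real.pi_le_four
    nlinarith [Real.pi_pos]
  have h2 : (Real.pi / N / 2) ^ 2 / 2 = Real.pi ^ 2 * (1 / (N : ℝ) ^ 2) / 8 := by
    rw [div_pow, div_pow]; ring
  have h3 : 0 ≤ 1 / (N : ℝ) ^ 2 := by positivity
  rw [meshCos]
  nlinarith

theorem one_le_cast {N : ℕ} (hN : 0 < N) : (1 : ℝ) ≤ N := by exact_mod_cast hN

/-- The total mesh error `κ + κ² (ε + τ) / τ`. -/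
theorem mesh_error_le {ε τ : ℝ} {N : ℕ} (P : LayerParams ε τ N) :
    meshCos N + meshCos N ^ 2 * (ε + τ) / τ ≤
      6 * (1 / (N : ℝ) ^ 2) + 4 * (ε / τ * (1 / (N : ℝ) ^ 4)) := by
  have hε := P.eps_pos
  have hτ := P.tau_pos
  have hN := one_le_cast P.N_pos
  have h1 := meshCos_le N
  have h0 := meshCos_nonneg N
  have hn : 1 / (N : ℝ) ^ 2 ≤ 1 := by
    rw [div_le_one (by positivity)]; exact one_le_pow₀ hN
  have hn0 : 0 ≤ 1 / (N : ℝ) ^ 2 := by positivity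
  have h2 : meshCos N ^ 2 ≤ 4 * (1 / (N : ℝ) ^ 4) := by
    have := pow_le_pow_left₀ h0 h1 2
    have e : (2 * (1 / (N : ℝ) ^ 2)) ^ 2 = 4 * (1 / (N : ℝ) ^ 4) := by
      field_simp; norm_num
    rwa [e] at this
  have h4 : 1 / (N : ℝ) ^ 4 ≤ 1 / (N : ℝ) ^ 2 := by
    have : 1 / (N : ℝ) ^ 4 = (1 / (N : ℝ) ^ 2) * (1 / (N : ℝ) ^ 2) := by field_simp
    rw [this]; exact mul_le_of_le_one_left hn0 hn
  have e : meshCos N ^ 2 * (ε + τ) / τ = ε / τ * meshCos N ^ 2 + meshCos N ^ 2 := by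
    field_simp
  have h5 := mul_le_mul_of_nonneg_left h2 (by positivity : 0 ≤ ε / τ)
  rw [e]
  linarith

/-- With `δ ≤ 1/2000` the angle is at most `4/2000`, and the mesh error is at most `6/2000² +
4/2000`, below `1/400`. -/
theorem FineLayer.sectorParams {δ ε τ : ℝ} {N : ℕ} (hδ : δ ≤ 1 / 2000)
    (F : FineLayer δ ε τ N) : SectorParams ε τ (Real.pi / N) (meshCos N) (meshSin N) := by
  have hN := one_le_cast F.N_pos
  have hN0 : (0 : ℝ) < N := by linarith
  have hinv := F.inv_N_le.trans hδ
  have hh0 : 0 < Real.pi / N := div_pos Real.pi_pos hN0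
  have hh : Real.pi / N ≤ 1 := by
    have e : Real.pi / N = Real.pi * (1 / N) := by ring
    have := mul_le_mul Real.pi_le_four hinv (by positivity) (by norm_num)
    rw [e]; linarith
  refine ⟨F.eps_pos, F.tau_pos, hh0, hh, by rw [meshCos]; ring, rfl, meshCos_nonneg N,
    Real.sin_pos_of_pos_of_lt_pi (by positivity) (by linarith [Real.pi_gt_three]), ?_⟩
  have h1 := mesh_error_le F.toLayerParams
  have h2 : 1 / (N : ℝ) ^ 2 ≤ 1 / 2000 * (1 / 2000) := by
    have e : 1 / (N : ℝ) ^ 2 = 1 / N * (1 / N) := by field_simp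
    rw [e]
    exact mul_le_mul hinv hinv (by positivity) (by norm_num)
  have h3 := F.ratio_le.trans hδ
  linarith

section Membership

variable {φ₀ φ₁ c h ε τ κ S σ : ℝ}

theorem rotPoint_mem_iso (h₀ : 0 < φ₀) (h₁ : 0 < φ₁) (hκ : Real.cos (h / 2) = 1 - κ)
    (hS : Real.sin (h / 2) = S) (hσ : σ = 1 ∨ σ = -1) {w t : ℝ} (ht : 0 ≤ t) (htw : t ≤ w)
    (hw : w ≤ 1) :
    rotPoint c (isoX φ₀ φ₁ κ w t) (σ * isoY φ₀ φ₁ κ S w t) ∈ (isoElement φ₀ φ₁ c h).carrier := by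
  refine ⟨!₂[(w - σ * t) / 2, (w + σ * t) / 2], ?_, ?_⟩
  · simp only [refTriangle, mem_ofPred_eq, Matrix.cons_val_zero,
      Matrix.cons_val_one]
    rcases hσ with rfl | rfl <;> refine ⟨?_, ?_, ?_⟩ <;> linarith
  · rw [iso_geomMap h₀ h₁ hκ hS]
    simp only [Matrix.cons_val_zero, Matrix.cons_val_one]
    have e1 : (w - σ * t) / 2 + (w + σ * t) / 2 = w := by ring
    have e2 : (w + σ * t) / 2 - (w - σ * t) / 2 = σ * t := by ring
    have hσ2 : σ ^ 2 = 1 := by rcases hσ with rfl | rfl <;> norm_num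
    rw [e1, e2]
    congr 1
    · rw [isoX, isoX, mul_pow, hσ2, one_mul]
    · rw [isoY, isoY]; ring

theorem rotPoint_mem_corner (hε : 0 < ε) (hτ : 0 < τ) (hκ : Real.cos (h / 2) = 1 - κ)
    (hS : Real.sin (h / 2) = S) {s t : ℝ} (hs : 0 ≤ s) (ht : 0 ≤ t) (hst : s + t ≤ 1) :
    rotPoint c (cornerX ε τ κ s t) (cornerY ε τ κ S s t) ∈ (cornerElement ε τ c h).carrier :=
  ⟨!₂[s, t], ⟨hs, ht, hst⟩, by rw [corner_geomMap hε hτ hκ hS]; rfl⟩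

theorem rotPoint_mem_corner' (hε : 0 < ε) (hτ : 0 < τ) (hκ : Real.cos (h / 2) = 1 - κ)
    (hS : Real.sin (h / 2) = S) {s t : ℝ} (hs : 0 ≤ s) (ht : 0 ≤ t) (hst : s + t ≤ 1) :
    rotPoint c (cornerX ε τ κ s t) (cornerY ε τ κ S s t) ∈ (cornerElement' ε τ c h).carrier :=
  ⟨!₂[t, s], ⟨ht, hs, by simpa [add_comm] using hst⟩, by
    rw [corner_geomMap' hε hτ hκ hS]; rfl⟩

theorem isoY_neg_sin (φ₀ φ₁ κ S w t : ℝ) :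
    isoY φ₀ φ₁ κ (-S) w t = -isoY φ₀ φ₁ κ S w t := by rw [isoY, isoY]; ring

theorem cornerY_neg_sin (ε τ κ S s t : ℝ) :
    cornerY ε τ κ (-S) s t = -cornerY ε τ κ S s t := by rw [cornerY, cornerY]; ring

end Membership

section Layer

variable {ε τ : ℝ} {N : ℕ} {K : LayerKind}

theorem carrier_subset_layerRegion {e : ElementType × Fin N} (he : e.1 ∈ K.types) :
    (layerElement ε τ N e).carrier ⊆ layerRegion K ε τ N :=
  subset_iUnion₂_of_subset e (Finset.mem_product.mpr ⟨he, Finset.mem_univ _⟩) subset_rfl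

theorem typeA_mem_types (K : LayerKind) : ElementType.A ∈ K.types := by
  cases K <;> simp [LayerKind.types]

theorem isCompact_carrier (T : PolarTriangle) : IsCompact T.carrier :=
  refTriangle_isCompact.image (T.continuous_lagrange id)

theorem isCompact_layerRegion (K : LayerKind) (ε τ : ℝ) (N : ℕ) :
    IsCompact (layerRegion K ε τ N) :=
  (layerIndex K N).isCompact_biUnion fun _ _ => isCompact_carrier _

theorem rotPoint_periodic (c X Y : ℝ) : rotPoint (c + 2 * Real.pi) X Y = rotPoint c X Y := by
  rw [rotPoint, rotPoint, Real.cos_add_two_pi, Real.sin_add_two_pi]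

/-- Elements of type A in the layer. -/
theorem rotPoint_mem_layer_A (P : SectorParams ε τ (Real.pi / N) (meshCos N) (meshSin N))
    (hN : 0 < N) {σ : ℝ} (hσ : σ = 1 ∨ σ = -1) {k : ℕ} (hk : k ≤ N) {s t : ℝ} (h0 : 0 ≤ t)
    (hts : t ≤ s) (h1 : s ≤ 1) :
    rotPoint (2 * k * Real.pi / N) (isoX ε (ε + τ) (meshCos N) s t)
      (σ * isoY ε (ε + τ) (meshCos N) (meshSin N) s t) ∈ layerRegion K ε τ N := by
  have key : ∀ j : Fin N, rotPoint (2 * (j : ℕ) * Real.pi / N) (isoX ε (ε + τ) (meshCos N) s t)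
      (σ * isoY ε (ε + τ) (meshCos N) (meshSin N) s t) ∈ layerRegion K ε τ N := by
    intro j
    refine carrier_subset_layerRegion (e := (.A, j)) (typeA_mem_types K) ?_
    rw [(layerElement_eq ε τ N j).1]
    exact rotPoint_mem_iso P.ε_pos (add_pos P.ε_pos P.τ_pos) P.cos_eq P.sin_eq hσ h0 hts h1
  -- The value `k = N` is allowed because the last mirrored half-sector ends on the axis at the
  -- angle `2π`, that of the element number `0`.
  rcases hk.lt_or_eq with hlt | rfl
  · exact key ⟨k, hlt⟩
  · have := key ⟨0, hN⟩
    rw [← rotPoint_periodic] at this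
    have hk0 : (k : ℝ) ≠ 0 := by exact_mod_cast hN.ne'
    have e : 2 * (k : ℝ) * Real.pi / k = 2 * ((0 : ℕ) : ℝ) * Real.pi / k + 2 * Real.pi := by
      field_simp; simp
    rw [e]
    exact this

/-- The other elements of the layer are second elements of half-sectors. -/
theorem exists_sectorPiece (P : SectorParams ε τ (Real.pi / N) (meshCos N) (meshSin N))
    (K : LayerKind) : ∃ X Y, SectorPiece ε τ (Real.pi / N) (meshCos N) (meshSin N) X Y ∧
      ∀ (k : Fin N) (σ : ℝ), σ = 1 ∨ σ = -1 → ∀ s t, 0 ≤ s → s ≤ t → t ≤ 1 →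
        rotPoint ((2 * (k : ℕ) + 1) * Real.pi / N) (X s t) (σ * Y s t) ∈ layerRegion K ε τ N := by
  have hcos' : Real.cos (-(Real.pi / N) / 2) = 1 - meshCos N := by
    rw [neg_div, Real.cos_neg, P.cos_eq]
  have hsin' : Real.sin (-(Real.pi / N) / 2) = -meshSin N := by
    rw [neg_div, Real.sin_neg, P.sin_eq]
  cases K with
  | AB =>
    refine ⟨_, _, sectorPiece_iso P, fun k σ hσ s t h0 hst h1 => ?_⟩
    refine carrier_subset_layerRegion (e := (.B, k)) (by simp [LayerKind.types]) ?_
    rw [(layerElement_eq ε τ N k).2.1]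
    -- The element of type B is taken with the angle `-π/N`, which flips its transverse coordinate;
    -- the sign `-σ` undoes this.
    have := rotPoint_mem_iso (c := elementAngle N k .B) (σ := -σ) (add_pos P.ε_pos P.τ_pos)
      P.ε_pos hcos' hsin' (by rcases hσ with rfl | rfl <;> simp) (by linarith : 0 ≤ 1 - t)
      (by linarith : 1 - t ≤ 1 - s) (by linarith)
    rwa [isoY_neg_sin, neg_mul_neg] at this
  | ACD =>
    refine ⟨_, _, sectorPiece_corner P, fun k σ hσ s t h0 hst h1 => ?_⟩
    rcases hσ with rfl | rfl
    · refine carrier_subset_layerRegion (e := (.C, k)) (by simp [LayerKind.types]) ?_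
      rw [(layerElement_eq ε τ N k).2.2.1, one_mul]
      exact rotPoint_mem_corner P.ε_pos P.τ_pos P.cos_eq P.sin_eq h0 (by linarith) (by linarith)
    · refine carrier_subset_layerRegion (e := (.D, k)) (by simp [LayerKind.types]) ?_
      rw [(layerElement_eq ε τ N k).2.2.2, neg_one_mul, ← cornerY_neg_sin]
      exact rotPoint_mem_corner' P.ε_pos P.τ_pos hcos' hsin' h0 (by linarith) (by linarith)

/-- The layer contains the annulus, except for a thin part near the outer circle. -/
theorem polarPoint_mem_layerRegion
    (P : SectorParams ε τ (Real.pi / N) (meshCos N) (meshSin N)) (hN : 0 < N) (K : LayerKind)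
    {R θ : ℝ} (hR : ε ≤ R)
    (hR' : R ^ 2 ≤ (ε + τ) ^ 2 * (1 - (4 * meshCos N - 2 * meshCos N ^ 2) ^ 2))
    (hθ0 : 0 ≤ θ) (hθ : θ < 2 * Real.pi) : polarPoint R θ ∈ layerRegion K ε τ N := by
  obtain ⟨X, Y, H, hXY⟩ := exists_sectorPiece P K
  have hN0 : (0 : ℝ) < N := by exact_mod_cast hN
  set h := Real.pi / N with hh
  have hh0 : 0 < h := P.h_pos
  have hfl := Nat.floor_le (div_nonneg hθ0 hh0.le)
  have hfl2 := Nat.lt_floor_add_one (θ / h)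
  set j := ⌊θ / h⌋₊ with hj
  rw [le_div_iff₀ hh0] at hfl
  rw [div_lt_iff₀ hh0] at hfl2
  have hNh : Real.pi = N * h := by rw [hh]; field_simp
  have hj2 : j < 2 * N := by
    have : (j : ℝ) < 2 * N := by
      refine lt_of_mul_lt_mul_right (a := h) ?_ hh0.le
      rw [mul_assoc, ← hNh]; linarith
    exact_mod_cast this
  -- In an even half-sector the angle increases away from the axis of an element of type A. In an
  -- odd one it increases towards the next such axis, so the mirror image about that axis is used.
  rcases Nat.even_or_odd' j with ⟨k, hk | hk⟩
  · have hkN : k < N := by omega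
    have hjk : (j : ℝ) = 2 * k := by rw [hk]; push_cast; ring
    have hc : 2 * (k : ℝ) * Real.pi / N = j * h := by rw [hjk, hh]; ring
    have := polarPoint_mem_of_sector (c := j * h) (σ := 1) (U := layerRegion K ε τ N) P H
      (Or.inl rfl) (fun s t h1 h2 h3 => by
        have := rotPoint_mem_layer_A (K := K) P hN (σ := 1) (Or.inl rfl) hkN.le h1 h2 h3
        rwa [hc] at this)
      (fun s t h1 h2 h3 => by
        have := hXY ⟨k, hkN⟩ (-1) (Or.inr rfl) s t h1 h2 h3
        convert this using 1
        congr 1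
        · rw [hjk, hh]; ring
        · ring)
      hR hR' (θ := θ - j * h) (by linarith) (by linarith)
    rwa [one_mul, add_sub_cancel] at this
  · have hkN : k < N := by omega
    have hjk : (j : ℝ) = 2 * k + 1 := by rw [hk]; push_cast; ring
    have hc : 2 * ((k + 1 : ℕ) : ℝ) * Real.pi / N = (j + 1) * h := by
      rw [hjk, hh]; push_cast; ring
    have := polarPoint_mem_of_sector (c := (j + 1) * h) (σ := -1) (U := layerRegion K ε τ N) P H
      (Or.inr rfl) (fun s t h1 h2 h3 => by
        have := rotPoint_mem_layer_A (K := K) P hN (σ := -1) (Or.inr rfl) (k := k + 1) hkN h1 h2 h3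
        rwa [hc] at this)
      (fun s t h1 h2 h3 => by
        have := hXY ⟨k, hkN⟩ 1 (Or.inl rfl) s t h1 h2 h3
        convert this using 1
        congr 1
        · rw [hjk, hh]; ring
        · ring)
      hR hR' (θ := (j + 1) * h - θ) (by linarith) (by linarith)
    convert this using 2
    ring

theorem exists_polarPoint (x : Plane) :
    ∃ θ, 0 ≤ θ ∧ θ < 2 * Real.pi ∧ x = polarPoint ‖x‖ θ := by
  set z : ℂ := ⟨x 0, x 1⟩ with hz
  have hn : ‖z‖ = ‖x‖ := by
    rw [EuclideanSpace.norm_eq, Fin.sum_univ_two, Complex.norm_eq_sqrt_sq_add_sq]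
    simp [hz]
  refine ⟨toIcoMod Real.two_pi_pos 0 z.arg, ?_, ?_, ?_⟩
  · exact left_le_toIcoMod _ _ _
  · simpa using toIcoMod_lt_right Real.two_pi_pos 0 z.arg
  · have hm : toIcoMod Real.two_pi_pos 0 z.arg =
        z.arg - (toIcoDiv Real.two_pi_pos 0 z.arg : ℤ) * (2 * Real.pi) := by
      rw [toIcoMod, zsmul_eq_mul]
    ext i
    fin_cases i
    · change x 0 = polarPoint _ _ 0
      rw [polarPoint_zero, hm, Real.cos_sub_int_mul_two_pi, ← hn, Complex.norm_mul_cos_arg]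
    · change x 1 = polarPoint _ _ 1
      rw [polarPoint_one, hm, Real.sin_sub_int_mul_two_pi, ← hn, Complex.norm_mul_sin_arg]

theorem mem_layerRegion_of_norm
    (P : SectorParams ε τ (Real.pi / N) (meshCos N) (meshSin N)) (hN : 0 < N) (K : LayerKind)
    {x : Plane} (hx : ε ≤ ‖x‖)
    (hx' : ‖x‖ ^ 2 ≤ (ε + τ) ^ 2 * (1 - (4 * meshCos N - 2 * meshCos N ^ 2) ^ 2)) :
    x ∈ layerRegion K ε τ N := by
  obtain ⟨θ, h0, h1, h2⟩ := exists_polarPoint x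
  rw [h2]
  exact polarPoint_mem_layerRegion P hN K hx hx' h0 h1

/-- The layer lies in the annulus, except for a thin part near the inner circle. -/
theorem norm_geomMap_bounds
    (P : SectorParams ε τ (Real.pi / N) (meshCos N) (meshSin N)) (e : ElementType × Fin N)
    {x : Plane} (hx : x ∈ refTriangle) :
    ε ^ 2 * (1 - (4 * meshCos N - 2 * meshCos N ^ 2) ^ 2) ≤
        ‖(layerElement ε τ N e).geomMap x‖ ^ 2 ∧
      ‖(layerElement ε τ N e).geomMap x‖ ^ 2 ≤ (ε + τ) ^ 2 := by
  obtain ⟨hx0, hx1, hx2⟩ := hx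
  have hcos' : Real.cos (-(Real.pi / N) / 2) = 1 - meshCos N := by
    rw [neg_div, Real.cos_neg, P.cos_eq]
  have hsin' : Real.sin (-(Real.pi / N) / 2) = -meshSin N := by
    rw [neg_div, Real.sin_neg, P.sin_eq]
  have hε := P.ε_pos
  have hτ := P.τ_pos
  have habs : |x 1 - x 0| ≤ x 0 + x 1 := abs_le.mpr ⟨by linarith, by linarith⟩
  have habs0 := abs_nonneg (x 1 - x 0)
  -- Isosceles elements are symmetric about their axis, so the half-sector estimates apply with
  -- `|t|`.
  have hiso : ∀ φ₀ φ₁ S, isoX φ₀ φ₁ (meshCos N) (x 0 + x 1) (x 1 - x 0) ^ 2 +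
      isoY φ₀ φ₁ (meshCos N) S (x 0 + x 1) (x 1 - x 0) ^ 2 =
      isoX φ₀ φ₁ (meshCos N) (x 0 + x 1) |x 1 - x 0| ^ 2 +
      isoY φ₀ φ₁ (meshCos N) S (x 0 + x 1) |x 1 - x 0| ^ 2 := by
    intro φ₀ φ₁ S
    simp only [isoX, isoY, mul_pow, sq_abs]
  obtain ⟨ty, k⟩ := e
  obtain ⟨eA, eB, eC, eD⟩ := layerElement_eq ε τ N k
  cases ty with
  | A =>
    rw [eA, iso_geomMap hε (add_pos hε hτ) P.cos_eq P.sin_eq, norm_rotPoint_sq, hiso,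
      ← sectorN_of_ge (h := Real.pi / N) (X := fun s t => isoX (ε + τ) ε (meshCos N) (1 - s) (1 - t))
        (Y := fun s t => isoY (ε + τ) ε (meshCos N) (meshSin N) (1 - s) (1 - t)) habs]
    exact sectorN_bounds P (sectorPiece_iso P) habs0 (by linarith) (by linarith) hx2
  | B =>
    have e := sectorN_of_le (sectorPiece_iso P) (s := 1 - (x 0 + x 1)) (t := 1 - |x 1 - x 0|)
      (by linarith)
    simp only [sub_sub_cancel] at e
    rw [eB, iso_geomMap (add_pos hε hτ) hε hcos' hsin', norm_rotPoint_sq, hiso, isoY_neg_sin,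
      neg_sq, ← e]
    exact sectorN_bounds P (sectorPiece_iso P) (by linarith) (by linarith) (by linarith)
      (by linarith)
  | C =>
    have e := sectorN_of_le (sectorPiece_corner P) (s := x 0) (t := 1 - x 1) (by linarith)
    simp only [sub_sub_cancel] at e
    rw [eC, corner_geomMap hε hτ P.cos_eq P.sin_eq, norm_rotPoint_sq, ← e]
    exact sectorN_bounds P (sectorPiece_corner P) (by linarith) (by linarith) hx0 (by linarith)
  | D =>
    have e := sectorN_of_le (sectorPiece_corner P) (s := x 1) (t := 1 - x 0) (by linarith)
    simp only [sub_sub_cancel] at e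
    rw [eD, corner_geomMap' hε hτ hcos' hsin', norm_rotPoint_sq,
      cornerY_neg_sin, neg_sq, ← e]
    exact sectorN_bounds P (sectorPiece_corner P) (by linarith) (by linarith) hx1 (by linarith)

theorem norm_bounds_of_mem_layerRegion
    (P : SectorParams ε τ (Real.pi / N) (meshCos N) (meshSin N)) {x : Plane}
    (hx : x ∈ layerRegion K ε τ N) :
    ε ^ 2 * (1 - (4 * meshCos N - 2 * meshCos N ^ 2) ^ 2) ≤ ‖x‖ ^ 2 ∧
      ‖x‖ ≤ ε + τ := by
  simp only [layerRegion, mem_iUnion] at hx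
  obtain ⟨e, -, y, hy, rfl⟩ := hx
  have := norm_geomMap_bounds P e hy
  exact ⟨this.1, (pow_le_pow_iff_left₀ (norm_nonneg _) (add_pos P.ε_pos P.τ_pos).le
    two_ne_zero).mp this.2⟩

end Layer
end
noncomputable section

/-! ### Energy densities of the radial deformation -/

/-- The squared Frobenius norm of the gradient in polar coordinates, times `R²`. -/
def radialNum (r r' : ℝ → ℝ) (R : ℝ) : ℝ := r R ^ 2 + (R * r' R) ^ 2

/-- The density of `E₁` at radius `R`. -/
def radialDensity₁ (p ω : ℝ) (r r' : ℝ → ℝ) (R : ℝ) : ℝ :=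
  ω * Real.sqrt (radialNum r r' R / R ^ 2) ^ p

/-- The density of `E₂` at radius `R`. -/
def radialDensity₂ (g r r' : ℝ → ℝ) (R : ℝ) : ℝ := g (r R * r' R / R)

/-- The gradient of a radial map. -/
theorem radialMap_hasFDerivAt {r : ℝ → ℝ} {x : Plane} {d : ℝ} (hx : x ≠ 0)
    (hr : HasDerivAt r d ‖x‖) : ∃ L : Plane →L[ℝ] Plane, HasFDerivAt (radialMap r) L x ∧
      ∀ i j, L (EuclideanSpace.single j 1) i =
        r ‖x‖ / ‖x‖ * (if i = j then 1 else 0) +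
          (d * ‖x‖ - r ‖x‖) / ‖x‖ ^ 2 / ‖x‖ * x j * x i := by
  have hR : 0 < ‖x‖ := norm_pos_iff.mpr hx
  have h1 : HasFDerivAt (fun y : Plane => ‖y‖ ^ 2) (2 • innerSL ℝ x) x :=
    (hasStrictFDerivAt_norm_sq x).hasFDerivAt
  have h2 := h1.sqrt (by positivity)
  have h2' : HasFDerivAt (fun y : Plane => ‖y‖)
      ((1 / (2 * ‖x‖)) • (2 : ℕ) • (innerSL ℝ x : Plane →L[ℝ] ℝ)) x := by
    simpa only [Real.sqrt_sq (norm_nonneg _)] using h2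
  have h3 := (hr.div (hasDerivAt_id' ‖x‖) hR.ne').comp_hasFDerivAt x h2'
  have h4 : HasFDerivAt (radialMap r) _ x := h3.smul (hasFDerivAt_id x)
  refine ⟨_, h4, fun i j => ?_⟩
  have hin : inner ℝ x (EuclideanSpace.single j (1 : ℝ)) = x j := by
    rw [EuclideanSpace.inner_single_right]; simp
  simp only [_root_.add_apply, _root_.smul_apply,
    ContinuousLinearMap.smulRight_apply, ContinuousLinearMap.id_apply, innerSL_apply_apply, hin,
    PiLp.add_apply, PiLp.smul_apply, smul_eq_mul, nsmul_eq_mul, PiLp.single_apply,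
    Function.comp_apply, Pi.div_apply, Nat.cast_ofNat, mul_one]
  congr 1
  field_simp

section Radial

variable {p ω c B : ℝ} {g r r' r'' : ℝ → ℝ}

/-- The gradient has singular values `r'` in the radial and `r/R` in the tangential direction. The
unit circle is excluded, since the profile is given only up to radius one. -/
theorem density_radialMap (H : ProfileBounds r r' r'' c B) {x : Plane} (hx : x ≠ 0)
    (hx1 : ‖x‖ < 1) :
    density₁ p ω (radialMap r) x = radialDensity₁ p ω r r' ‖x‖ ∧
      density₂ g (radialMap r) x = radialDensity₂ g r r' ‖x‖ := by
  have hR : 0 < ‖x‖ := norm_pos_iff.mpr hx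
  obtain ⟨L, hL, hLe⟩ := radialMap_hasFDerivAt hx (H.hasDerivAt ‖x‖ ⟨hR, hx1⟩)
  have hn : ‖x‖ ^ 2 = x 0 ^ 2 + x 1 ^ 2 := by
    rw [EuclideanSpace.norm_sq_eq, Fin.sum_univ_two]; simp
  set R := ‖x‖ with hRdef
  have h1 : x 1 ^ 2 = R ^ 2 - x 0 ^ 2 := by linarith
  constructor
  · rw [density₁, radialDensity₁, radialNum, hL.fderiv, frobNorm_eq, hLe, hLe, hLe, hLe]
    congr 3
    simp only [if_true, if_false, Fin.isValue, zero_ne_one, one_ne_zero]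
    field_simp
    have h2 : x 1 ^ 4 = (R ^ 2 - x 0 ^ 2) ^ 2 := by rw [← h1]; ring
    ring_nf
    rw [h2, h1]
    ring
  · rw [density₂, radialDensity₂, hL.fderiv, plane_det_eq, hLe, hLe, hLe, hLe]
    congr 1
    simp only [if_true, if_false, Fin.isValue, zero_ne_one, one_ne_zero]
    field_simp
    ring_nf
    rw [h1]
    ring

theorem ProfileBounds.radialNum_bounds (H : ProfileBounds r r' r'' c B) {R : ℝ}
    (hR : R ∈ Ioc (0 : ℝ) 1) : c ^ 2 ≤ radialNum r r' R ∧ radialNum r r' R ≤ 2 * B ^ 2 := by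
  have hc := H.c_pos
  have h1 := H.le_r R hR
  have h2 := H.r_le R hR
  have h3 := H.le_r' R hR
  have h4 := H.r'_le R hR
  have h0 : 0 ≤ R * r' R := mul_nonneg hR.1.le ((mul_pos hc hR.1).le.trans h3)
  have hB := H.B_nonneg
  have h5 : R * r' R ≤ B := by
    have a1 := mul_le_mul_of_nonneg_left h4 hR.1.le
    have a2 : R * (B * R) ≤ B := by
      have : R * R ≤ 1 := mul_le_one₀ hR.2 hR.1.le hR.2
      nlinarith
    linarith
  have a1 := pow_le_pow_left₀ hc.le h1 2
  have a2 := pow_le_pow_left₀ (hc.le.trans h1) h2 2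
  have a3 := pow_le_pow_left₀ h0 h5 2
  rw [radialNum]
  constructor <;> nlinarith [sq_nonneg (R * r' R)]

/-- The slope `r'` is comparable to `R`, which cancels the singular factor `1/R`. The exact
determinants therefore stay in a compact part of `(0, ∞)`, uniformly up to the cavity. -/
theorem ProfileBounds.det_bounds (H : ProfileBounds r r' r'' c B) {R : ℝ}
    (hR : R ∈ Ioc (0 : ℝ) 1) : r R * r' R / R ∈ Icc (c ^ 2) (B ^ 2) := by
  have hc := H.c_pos
  have h1 := H.le_r R hR
  have h2 := H.r_le R hR
  have h3 := H.le_r' R hR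
  have h4 := H.r'_le R hR
  constructor
  · rw [le_div_iff₀ hR.1]
    calc c ^ 2 * R = c * (c * R) := by ring
      _ ≤ r R * r' R := mul_le_mul h1 h3 (mul_pos hc hR.1).le (hc.le.trans h1)
  · rw [div_le_iff₀ hR.1]
    calc r R * r' R ≤ B * (B * R) :=
          mul_le_mul h2 h4 ((mul_pos hc hR.1).le.trans h3) H.B_nonneg
      _ = B ^ 2 * R := by ring

theorem radialDensity₁_eq (hR : 0 < R) (hM : 0 ≤ radialNum r r' R) :
    radialDensity₁ p ω r r' R = ω * radialNum r r' R ^ (p / 2) * R ^ (-p) := by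
  rw [radialDensity₁, Real.sqrt_eq_rpow, ← Real.rpow_mul (by positivity),
    Real.div_rpow hM (by positivity), ← Real.rpow_natCast, ← Real.rpow_mul hR.le,
    Real.rpow_neg hR.le, div_eq_mul_inv, mul_assoc, show 1 / 2 * p = p / 2 by ring,
    show ((2 : ℕ) : ℝ) * (p / 2) = p by push_cast; ring]

theorem radialDensity₁_bounds (H : ProfileBounds r r' r'' c B) (hp : 0 ≤ p) (hp2 : p ≤ 2)
    (hω : 0 ≤ ω) {R : ℝ} (hR : R ∈ Ioc (0 : ℝ) 1) :
    ω * c ^ p * R ^ (-p) ≤ radialDensity₁ p ω r r' R ∧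
      radialDensity₁ p ω r r' R ≤ ω * (2 * B ^ 2) * R ^ (-p) := by
  obtain ⟨h1, h2⟩ := H.radialNum_bounds hR
  have hc := H.c_pos
  have hM : 0 ≤ radialNum r r' R := (by positivity : (0 : ℝ) ≤ c ^ 2).trans h1
  have hRp : 0 ≤ R ^ (-p) := Real.rpow_nonneg hR.1.le _
  rw [radialDensity₁_eq hR.1 hM]
  constructor
  · have e : c ^ p = (c ^ 2) ^ (p / 2) := by
      rw [← Real.rpow_natCast, ← Real.rpow_mul hc.le]; congr 1; push_cast; ring
    rw [e]
    have := Real.rpow_le_rpow (by positivity) h1 (by linarith : 0 ≤ p / 2)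
    gcongr
  · have a1 := Real.rpow_le_rpow hM h2 (by linarith : 0 ≤ p / 2)
    have hB : 1 ≤ 2 * B ^ 2 := by nlinarith [H.one_le_B]
    have a2 : (2 * B ^ 2) ^ (p / 2) ≤ 2 * B ^ 2 := by
      conv_rhs => rw [← Real.rpow_one (2 * B ^ 2)]
      exact Real.rpow_le_rpow_of_exponent_le hB (by linarith)
    have := a1.trans a2
    gcongr

theorem continuousOn_radialDensity₁ (H : ProfileBounds r r' r'' c B) (hp : 0 ≤ p) :
    ContinuousOn (radialDensity₁ p ω r r') (Ioc 0 1) := by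
  have h1 := H.cont_r
  have h2 := H.cont_r'
  have h3 : ContinuousOn (fun R => radialNum r r' R / R ^ 2) (Ioc 0 1) := by
    unfold radialNum
    exact ContinuousOn.div (by fun_prop) (by fun_prop) fun R hR => pow_ne_zero 2 hR.1.ne'
  exact continuousOn_const.mul (h3.sqrt.rpow_const fun _ _ => Or.inr hp)

theorem continuousOn_radialDensity₂ (H : ProfileBounds r r' r'' c B)
    (hg : ContinuousOn g (Ioi 0)) : ContinuousOn (radialDensity₂ g r r') (Ioc 0 1) := by
  refine hg.comp ((H.cont_r.mul H.cont_r').div continuousOn_id fun R hR => hR.1.ne') ?_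
  intro R hR
  exact lt_of_lt_of_le (pow_pos H.c_pos 2) (H.det_bounds hR).1

theorem exists_radialDensity₂_bound (H : ProfileBounds r r' r'' c B)
    (hg : IsCompressibility g) : ∃ C > 0, ∀ R ∈ Ioc (0 : ℝ) 1,
      0 ≤ radialDensity₂ g r r' R ∧ radialDensity₂ g r r' R ≤ C := by
  have hc : 0 < c ^ 2 := pow_pos H.c_pos 2
  obtain ⟨C, hC⟩ := (isCompact_Icc (a := c ^ 2) (b := B ^ 2)).exists_bound_of_continuousOn
    (hg.contDiff.continuousOn.mono fun d hd => lt_of_lt_of_le hc hd.1)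
  refine ⟨max C 1, by positivity, fun R hR => ?_⟩
  have hd := H.det_bounds hR
  exact ⟨(hg.pos _ (hc.trans_le hd.1)).le, ((le_abs_self _).trans (hC _ hd)).trans (le_max_left _ _)⟩

theorem ae_norm_ne_one : ∀ᵐ x : Plane, ‖x‖ ≠ 1 := by
  have h := Measure.addHaar_sphere (volume : Measure Plane) 0 1
  rw [ae_iff]
  convert h using 2
  ext x
  simp

/-- On regions away from the origin the densities are radial almost everywhere. -/
theorem density_radialMap_ae (H : ProfileBounds r r' r'' c B) {a : ℝ} (ha : 0 < a) {U : Set Plane}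
    (hU : MeasurableSet U) (hUa : ∀ x ∈ U, a ≤ ‖x‖ ∧ ‖x‖ ≤ 1) :
    (∀ᵐ x ∂(volume.restrict U), density₁ p ω (radialMap r) x = radialDensity₁ p ω r r' ‖x‖) ∧
    ∀ᵐ x ∂(volume.restrict U), density₂ g (radialMap r) x = radialDensity₂ g r r' ‖x‖ := by
  have h : ∀ᵐ x ∂(volume.restrict U), density₁ p ω (radialMap r) x = radialDensity₁ p ω r r' ‖x‖ ∧
      density₂ g (radialMap r) x = radialDensity₂ g r r' ‖x‖ := by
    rw [ae_restrict_iff' hU]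
    filter_upwards [ae_norm_ne_one] with x hx hxU
    exact density_radialMap H (norm_pos_iff.mp (ha.trans_le (hUa x hxU).1))
      (lt_of_le_of_ne (hUa x hxU).2 hx)
  exact ⟨h.mono fun _ h => h.1, h.mono fun _ h => h.2⟩

theorem integrableOn_radial {f : ℝ → ℝ} (hf : ContinuousOn f (Ioc 0 1)) {a : ℝ} (ha : 0 < a)
    {U : Set Plane} (hU : IsCompact U) (hUa : ∀ x ∈ U, a ≤ ‖x‖ ∧ ‖x‖ ≤ 1) :
    IntegrableOn (fun x => f ‖x‖) U :=
  (hf.comp continuous_norm.continuousOn fun x hx =>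
    ⟨ha.trans_le (hUa x hx).1, (hUa x hx).2⟩).integrableOn_compact hU

end Radial
end
noncomputable section

/-! ### The layer and the annulus -/

/-! ### The layer size as a singular integral -/

section Size

variable {p ε τ : ℝ}

theorem integral_rpow_layer (hp : p < 2) :
    ∫ R in ε..(ε + τ), R ^ (1 - p) = layerSize p ε τ / (2 - p) := by
  rw [integral_rpow (Or.inl (by linarith)), layerSize]
  rw [show 1 - p + 1 = 2 - p by ring]

theorem intervalIntegrable_of_continuousOn_Ioc {f : ℝ → ℝ} (hf : ContinuousOn f (Ioc 0 1))
    {a b : ℝ} (ha : 0 < a) (hab : a ≤ b) (hb : b ≤ 1) : IntervalIntegrable f volume a b := by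
  refine ContinuousOn.intervalIntegrable (hf.mono ?_)
  rw [uIcc_of_le hab]
  exact fun R hR => ⟨ha.trans_le hR.1, hR.2.trans hb⟩

theorem continuousOn_rpow_Ioc (q : ℝ) : ContinuousOn (fun R : ℝ => R ^ q) (Ioc 0 1) :=
  continuousOn_id.rpow_const fun _ hR => Or.inl hR.1.ne'

/-- The layer size over `2 - p` is the integral of `R^(1-p)`, a nonincreasing function, which is at
least its value at the outer radius. -/
theorem layerSize_lower (hε : 0 < ε) (hτ : 0 < τ) (hσ : ε + τ ≤ 1) (hp : 1 ≤ p) (hp2 : p < 2) :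
    (2 - p) * (τ * (ε + τ) ^ (1 - p)) ≤ layerSize p ε τ := by
  have h1 := integral_rpow_layer (ε := ε) (τ := τ) hp2
  have h2 : ∫ _ in ε..(ε + τ), (ε + τ) ^ (1 - p) ≤ ∫ R in ε..(ε + τ), R ^ (1 - p) := by
    refine intervalIntegral.integral_mono_on (by linarith) intervalIntegrable_const
      (intervalIntegrable_of_continuousOn_Ioc (continuousOn_rpow_Ioc _) hε (by linarith) hσ) ?_
    intro R hR
    exact Real.rpow_le_rpow_of_nonpos (hε.trans_le hR.1) hR.2 (by linarith)
  rw [intervalIntegral.integral_const, h1, smul_eq_mul, add_sub_cancel_left,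
    le_div_iff₀ (by linarith)] at h2
  linarith

theorem layerSize_ge (hε : 0 < ε) (hτ : 0 < τ) (hσ : ε + τ ≤ 1) (hp : 1 ≤ p) (hp2 : p < 2) :
    (2 - p) * τ ≤ layerSize p ε τ := by
  refine le_trans ?_ (layerSize_lower hε hτ hσ hp hp2)
  have h1 : 1 ≤ (ε + τ) ^ (1 - p) :=
    Real.one_le_rpow_of_pos_of_le_one_of_nonpos (by linarith) hσ (by linarith)
  have h2 : 0 ≤ (2 - p) * τ := mul_nonneg (by linarith) hτ.le
  nlinarith

/-- Shell energies are proportional to `(ε+τ)^(2-p)`. Expressing them through the layer size costs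
the factor `(ε+τ)/τ`, which is how `ε/τ` enters the region comparison. -/
theorem rpow_outer_le (hε : 0 < ε) (hτ : 0 < τ) (hσ : ε + τ ≤ 1) (hp : 1 ≤ p) (hp2 : p < 2) :
    (ε + τ) ^ (2 - p) ≤ (ε / τ + 1) * (layerSize p ε τ / (2 - p)) := by
  have h := layerSize_lower hε hτ hσ hp hp2
  have e : (ε + τ) ^ (2 - p) = (ε + τ) * (ε + τ) ^ (1 - p) := by
    rw [← Real.rpow_one_add' (by linarith) (by linarith)]; congr 1; ring
  have h2 : τ * (ε + τ) ^ (1 - p) ≤ layerSize p ε τ / (2 - p) := by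
    rw [le_div_iff₀ (by linarith)]; linarith
  have h3 := mul_le_mul_of_nonneg_left h2 (by positivity : 0 ≤ ε / τ + 1)
  rw [e]
  refine le_of_eq_of_le ?_ h3
  field_simp

end Size

/-! ### Thin shells between the layer and the annulus -/

section Shell

variable {ε τ q C : ℝ} {N : ℕ} {f : ℝ → ℝ}

/-- The relative width of the shells by which the layer and the annulus differ. -/
def meshQ (N : ℕ) : ℝ := 4 * meshCos N - 2 * meshCos N ^ 2

/-- Writing `R^(1-q)` as `R^(2-q) / R` gives one bound for every `q ≤ 2`, irrespective of the sign
of `1 - q`: on the shell the first factor is at most its value at `b`, and `1/R ≤ 2/b`. -/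
theorem integral_thin_le (hf0 : ∀ R ∈ Ioc (0 : ℝ) 1, 0 ≤ f R ∧ f R ≤ C * R ^ (-q)) (hC : 0 ≤ C)
    (hq : q ≤ 2) {a b Q : ℝ} (hb : 0 < b) (hb1 : b ≤ 1) (ha : 1 / 2 ≤ a) (ha1 : a ≤ 1)
    (haQ : 1 - a ≤ Q) : ∫ R in (b * a)..b, R * f R ≤ 2 * C * b ^ (2 - q) * Q := by
  have hba : b * a ≤ b := mul_le_of_le_one_right hb.le ha1
  have hbq : 0 ≤ b ^ (2 - q) := Real.rpow_nonneg hb.le _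
  have h := intervalIntegral.norm_integral_le_of_norm_le_const (a := b * a) (b := b)
    (f := fun R => R * f R) (C := C * b ^ (2 - q) * (2 / b)) (by
      intro R hR
      rw [uIoc_of_le hba] at hR
      have hR0 : b / 2 ≤ R := by nlinarith [hR.1]
      have hRpos : 0 < R := by linarith
      obtain ⟨f0, f1⟩ := hf0 R ⟨hRpos, hR.2.trans hb1⟩
      rw [Real.norm_eq_abs, abs_of_nonneg (mul_nonneg hRpos.le f0)]
      have e : R ^ (-q) = R ^ (2 - q) * (1 / R) * (1 / R) := by
        rw [show (2 : ℝ) - q = -q + 2 by ring, Real.rpow_add hRpos, Real.rpow_two]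
        field_simp
      calc R * f R ≤ R * (C * R ^ (-q)) := mul_le_mul_of_nonneg_left f1 hRpos.le
        _ = C * R ^ (2 - q) * (1 / R) := by rw [e]; field_simp
        _ ≤ C * b ^ (2 - q) * (2 / b) := by
          have i1 := Real.rpow_le_rpow hRpos.le hR.2 (by linarith : 0 ≤ 2 - q)
          have i2 : 1 / R ≤ 2 / b := by
            rw [div_le_div_iff₀ hRpos hb]; linarith
          have := Real.rpow_nonneg hRpos.le (2 - q)
          gcongr)
  rw [abs_of_nonneg (by linarith)] at h
  have h1 := (le_abs_self _).trans h
  refine h1.trans ?_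
  have e : C * b ^ (2 - q) * (2 / b) * (b - b * a) = 2 * C * b ^ (2 - q) * (1 - a) := by
    field_simp
  rw [e]
  gcongr

theorem isCompact_annulus (ε τ : ℝ) : IsCompact (annulus ε τ) := by
  refine Metric.isCompact_of_isClosed_isBounded (isClosed_Icc.preimage continuous_norm) ?_
  exact (Metric.isBounded_closedBall (x := (0 : Plane)) (r := ε + τ)).subset fun x hx => by
    simpa using hx.2

/-- The second bound keeps the defect of the outer circle below half the thickness, so that the
inner comparison annulus is not empty. -/
theorem meshQ_bounds (P : SectorParams ε τ (Real.pi / N) (meshCos N) (meshSin N)) :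
    meshQ N ^ 2 ≤ 1 / 1000 ∧ meshQ N ^ 2 * (ε + τ) ≤ τ / 2 := by
  have h0 := meshCos_nonneg N
  have h1 := P.κ_small
  have h2 := P.κ_sq_small
  have hσ : 0 < ε + τ := add_pos P.ε_pos P.τ_pos
  have hQ0 : 0 ≤ meshQ N := by rw [meshQ]; nlinarith
  have hQ : meshQ N ≤ 4 * meshCos N := by rw [meshQ]; nlinarith [sq_nonneg (meshCos N)]
  have hQ2 := pow_le_pow_left₀ hQ0 hQ 2
  constructor
  · nlinarith
  · have := mul_le_mul_of_nonneg_right hQ2 hσ.le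
    linarith [P.τ_pos]

/-- The integral of a radial function over the layer, compared with that over the annulus. -/
theorem integral_layer_sub_annulus (L : LayerParams ε τ N)
    (P : SectorParams ε τ (Real.pi / N) (meshCos N) (meshSin N)) (K : LayerKind)
    (hf : ContinuousOn f (Ioc 0 1))
    (hf0 : ∀ R ∈ Ioc (0 : ℝ) 1, 0 ≤ f R ∧ f R ≤ C * R ^ (-q)) (hC : 0 ≤ C) (hq : q ≤ 2) :
    |(∫ x in layerRegion K ε τ N, f ‖x‖) - ∫ x in annulus ε τ, f ‖x‖| ≤
      8 * Real.pi * C * meshQ N ^ 2 * (ε + τ) ^ (2 - q) := by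
  obtain ⟨hε, hτ, hσ, hN⟩ := L
  obtain ⟨hQ1, hQ2⟩ := meshQ_bounds P
  have hQ0 := sq_nonneg (meshQ N)
  set Q2 := meshQ N ^ 2 with hQ2def
  set a := Real.sqrt (1 - Q2) with ha
  have ha2 : a ^ 2 = 1 - Q2 := Real.sq_sqrt (by linarith)
  have ha0 : 0 ≤ a := Real.sqrt_nonneg _
  have ha1 : a ≤ 1 := by nlinarith
  have haQ : 1 - a ≤ Q2 := by nlinarith
  have hah : 1 / 2 ≤ a := by linarith
  have hεa : 0 < ε * a := by positivity
  have hεaε : ε * a ≤ ε := mul_le_of_le_one_right hε.le ha1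
  have hσa : ε < (ε + τ) * a := by nlinarith
  have hσaσ : (ε + τ) * a ≤ ε + τ := mul_le_of_le_one_right (by linarith) ha1
  -- Both the layer and the annulus lie between `core` and `big`. For a nonnegative density their
  -- integrals therefore differ by at most the integral over the two shells of relative width `1 - a
  -- ≤ Q²`.
  set big := annulus (ε * a) (ε + τ - ε * a) with hbig
  set core := annulus ε ((ε + τ) * a - ε) with hcore
  have hbig_mem : ∀ x, x ∈ big ↔ ε * a ≤ ‖x‖ ∧ ‖x‖ ≤ ε + τ := by
    intro x; rw [hbig, annulus]; simp
  have hcore_mem : ∀ x, x ∈ core ↔ ε ≤ ‖x‖ ∧ ‖x‖ ≤ (ε + τ) * a := by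
    intro x; rw [hcore, annulus]; simp
  have hLb : layerRegion K ε τ N ⊆ big := by
    intro x hx
    obtain ⟨h1, h2⟩ := norm_bounds_of_mem_layerRegion P hx
    refine (hbig_mem x).mpr ⟨?_, h2⟩
    refine (pow_le_pow_iff_left₀ hεa.le (norm_nonneg x) two_ne_zero).mp ?_
    rw [mul_pow, ha2]
    exact h1
  have hcL : core ⊆ layerRegion K ε τ N := by
    intro x hx
    obtain ⟨h1, h2⟩ := (hcore_mem x).mp hx
    refine mem_layerRegion_of_norm P hN K h1 ?_
    have := pow_le_pow_left₀ (norm_nonneg x) h2 2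
    rwa [mul_pow, ha2] at this
  have hAb : annulus ε τ ⊆ big := fun x hx => (hbig_mem x).mpr ⟨hεaε.trans hx.1, hx.2⟩
  have hcA : core ⊆ annulus ε τ := by
    intro x hx
    obtain ⟨h1, h2⟩ := (hcore_mem x).mp hx
    exact ⟨h1, h2.trans hσaσ⟩
  have hbig1 : ∀ x ∈ big, ε * a ≤ ‖x‖ ∧ ‖x‖ ≤ 1 := fun x hx =>
    ⟨((hbig_mem x).mp hx).1, ((hbig_mem x).mp hx).2.trans hσ⟩
  have hint : IntegrableOn (fun x => f ‖x‖) big :=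
    integrableOn_radial hf hεa (isCompact_annulus _ _) hbig1
  have hnn : 0 ≤ᵐ[volume.restrict big] fun x => f ‖x‖ := by
    rw [EventuallyLE, ae_restrict_iff' (isCompact_annulus _ _).measurableSet]
    exact ae_of_all _ fun x hx => (hf0 ‖x‖ ⟨hεa.trans_le (hbig1 x hx).1, (hbig1 x hx).2⟩).1
  have hmono : ∀ {U V : Set Plane}, MeasurableSet V → U ⊆ V → V ⊆ big →
      ∫ x in U, f ‖x‖ ≤ ∫ x in V, f ‖x‖ := fun hV hUV hVb =>
    setIntegral_mono_set (hint.mono_set hVb) (ae_restrict_of_ae_restrict_of_subset hVb hnn)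
      hUV.eventuallyLE
  have mL := (isCompact_layerRegion K ε τ N).measurableSet
  have mA := (isCompact_annulus ε τ).measurableSet
  have mb : MeasurableSet big := (isCompact_annulus _ _).measurableSet
  have i1 := hmono mb hLb subset_rfl
  have i2 := hmono mL hcL hLb
  have i3 := hmono mb hAb subset_rfl
  have i4 := hmono mA hcA hAb
  have hRf : ContinuousOn (fun R => R * f R) (Ioc 0 1) := continuousOn_id.mul hf
  have eb : ∫ x in big, f ‖x‖ = 2 * Real.pi * ∫ R in (ε * a)..(ε + τ), R * f R := by
    rw [hbig, setIntegral_annulus hεa (by linarith)]; congr 2; ring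
  have ec : ∫ x in core, f ‖x‖ = 2 * Real.pi * ∫ R in ε..((ε + τ) * a), R * f R := by
    rw [hcore, setIntegral_annulus hε (by linarith)]; congr 2; ring
  have s1 := intervalIntegral.integral_add_adjacent_intervals
    (intervalIntegrable_of_continuousOn_Ioc hRf hεa hεaε (by linarith))
    (intervalIntegrable_of_continuousOn_Ioc hRf hε (by linarith : ε ≤ ε + τ) hσ)
  have s2 := intervalIntegral.integral_add_adjacent_intervals
    (intervalIntegrable_of_continuousOn_Ioc hRf hε hσa.le (by linarith))
    (intervalIntegrable_of_continuousOn_Ioc hRf (by linarith) hσaσ hσ)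
  have t1 := integral_thin_le hf0 hC hq hε (by linarith) hah ha1 haQ
  have t2 := integral_thin_le hf0 hC hq (by linarith : 0 < ε + τ) hσ hah ha1 haQ
  have t3 : ε ^ (2 - q) ≤ (ε + τ) ^ (2 - q) :=
    Real.rpow_le_rpow hε.le (by linarith) (by linarith)
  have t4 : 2 * C * ε ^ (2 - q) * Q2 ≤ 2 * C * (ε + τ) ^ (2 - q) * Q2 := by gcongr
  have hdiff : (∫ x in big, f ‖x‖) - ∫ x in core, f ‖x‖ ≤
      8 * Real.pi * C * Q2 * (ε + τ) ^ (2 - q) := by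
    rw [eb, ec, ← s1, ← s2]
    have hpi := Real.pi_pos
    have : (∫ R in (ε * a)..ε, R * f R) + (∫ R in ((ε + τ) * a)..(ε + τ), R * f R) ≤
      4 * C * Q2 * (ε + τ) ^ (2 - q) := by linarith
    have := mul_le_mul_of_nonneg_left this (by positivity : 0 ≤ 2 * Real.pi)
    linarith
  rw [abs_le]
  constructor <;> linarith

theorem meshQ_sq_le (hN : 0 < N) : meshQ N ^ 2 ≤ 64 * (1 / (N : ℝ) ^ 4) := by
  have h0 := meshCos_nonneg N
  have h1 := meshCos_le N
  have hk : meshCos N ≤ 2 := by rw [meshCos]; linarith [Real.neg_one_le_cos (Real.pi / N / 2)]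
  have hQ0 : 0 ≤ meshQ N := by rw [meshQ]; nlinarith
  have hQ : meshQ N ≤ 8 * (1 / (N : ℝ) ^ 2) := by
    rw [meshQ]; nlinarith [sq_nonneg (meshCos N)]
  refine (pow_le_pow_left₀ hQ0 hQ 2).trans (le_of_eq ?_)
  field_simp; norm_num

theorem integral_layer_sub_annulus_bounded (L : LayerParams ε τ N)
    (P : SectorParams ε τ (Real.pi / N) (meshCos N) (meshSin N)) (K : LayerKind)
    (hf : ContinuousOn f (Ioc 0 1)) (hf0 : ∀ R ∈ Ioc (0 : ℝ) 1, 0 ≤ f R ∧ f R ≤ C)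
    (hC : 0 ≤ C) :
    |(∫ x in layerRegion K ε τ N, f ‖x‖) - ∫ x in annulus ε τ, f ‖x‖| ≤
      2048 * C * (1 / (N : ℝ) ^ 4) := by
  have h := integral_layer_sub_annulus (q := 0) (C := C) L P K hf
    (fun R hR => by simpa using hf0 R hR) hC zero_le_two
  refine h.trans ?_
  have h1 := meshQ_sq_le L.N_pos
  have h2 : (ε + τ) ^ ((2 : ℝ) - 0) ≤ 1 :=
    Real.rpow_le_one (by linarith [L.eps_pos, L.tau_pos]) L.le_one (by norm_num)
  have h3 : 0 ≤ (ε + τ) ^ ((2 : ℝ) - 0) := Real.rpow_nonneg (by linarith [L.eps_pos, L.tau_pos]) _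
  calc 8 * Real.pi * C * meshQ N ^ 2 * (ε + τ) ^ ((2 : ℝ) - 0)
      ≤ 8 * 4 * C * (64 * (1 / (N : ℝ) ^ 4)) * 1 := by
        have := Real.pi_le_four
        have := Real.pi_pos
        gcongr
    _ = _ := by ring

theorem integral_layer_sub_annulus_singular {p : ℝ} (hp : 1 ≤ p) (hp2 : p < 2)
    (L : LayerParams ε τ N)
    (P : SectorParams ε τ (Real.pi / N) (meshCos N) (meshSin N)) (K : LayerKind)
    (hf : ContinuousOn f (Ioc 0 1))
    (hf0 : ∀ R ∈ Ioc (0 : ℝ) 1, 0 ≤ f R ∧ f R ≤ C * R ^ (-p)) (hC : 0 ≤ C) :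
    |(∫ x in layerRegion K ε τ N, f ‖x‖) - ∫ x in annulus ε τ, f ‖x‖| ≤
      2048 * C / (2 - p) * layerSize p ε τ *
        (1 / (N : ℝ) ^ 2 + ε / τ * (1 / (N : ℝ) ^ 4)) := by
  have hε := L.eps_pos
  have hτ := L.tau_pos
  have hN := one_le_cast L.N_pos
  refine (integral_layer_sub_annulus L P K hf hf0 hC hp2.le).trans ?_
  have h1 := meshQ_sq_le L.N_pos
  have h2 := rpow_outer_le hε hτ L.le_one hp hp2
  have hA : 0 ≤ layerSize p ε τ :=
    le_trans (mul_nonneg (by linarith) hτ.le) (layerSize_ge hε hτ L.le_one hp hp2)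
  have hp2' : 0 < 2 - p := by linarith
  have h4 : 1 / (N : ℝ) ^ 4 ≤ 1 / (N : ℝ) ^ 2 :=
    one_div_le_one_div_of_le (by positivity) (pow_le_pow_right₀ hN (by norm_num))
  calc 8 * Real.pi * C * meshQ N ^ 2 * (ε + τ) ^ (2 - p)
      ≤ 8 * 4 * C * (64 * (1 / (N : ℝ) ^ 4)) * ((ε / τ + 1) * (layerSize p ε τ / (2 - p))) := by
        have := Real.pi_le_four
        have := Real.pi_pos
        gcongr
    _ = 2048 * C / (2 - p) * layerSize p ε τ *
        (1 / (N : ℝ) ^ 4 + ε / τ * (1 / (N : ℝ) ^ 4)) := by ring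
    _ ≤ _ := by gcongr

end Shell
end
noncomputable section

/-! ### Energies of the interpolant on one element -/

theorem refTriangle_measurableSet : MeasurableSet refTriangle := refTriangle_isClosed.measurableSet

namespace PolarTriangle

variable {T : PolarTriangle} {v : Plane → Plane} {p ω : ℝ} {g : ℝ → ℝ}

/-- The density of `E₁` of the interpolant, pulled back to the reference triangle. -/
def refDensity₁ (p ω : ℝ) (T : PolarTriangle) (v : Plane → Plane) (x : Plane) : ℝ :=
  |T.jac id x| * (ω * Real.sqrt (T.frobNum v x / T.jac id x ^ 2) ^ p)

/-- The density of `E₂` of the interpolant, pulled back to the reference triangle. -/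
def refDensity₂ (g : ℝ → ℝ) (T : PolarTriangle) (v : Plane → Plane) (x : Plane) : ℝ :=
  |T.jac id x| * g (T.jac v x / T.jac id x)

theorem refDensity₁_ae (hJ : ∀ x ∈ refTriangle, T.jac id x ≠ 0) :
    (fun x => |T.jac id x| * density₁ p ω (T.interp v) (T.geomMap x)) =ᵐ[volume.restrict refTriangle]
      refDensity₁ p ω T v := by
  filter_upwards [ae_interior] with x hx
  rw [density₁, frobNorm_fderiv_interp v hJ hx, refDensity₁]

theorem refDensity₂_ae (hJ : ∀ x ∈ refTriangle, T.jac id x ≠ 0) :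
    (fun x => |T.jac id x| * density₂ g (T.interp v) (T.geomMap x)) =ᵐ[volume.restrict refTriangle]
      refDensity₂ g T v := by
  filter_upwards [ae_interior] with x hx
  rw [density₂, det_fderiv_interp v hJ hx, refDensity₂]

theorem integrableOn_refDensity₁ (hJ : ∀ x ∈ refTriangle, T.jac id x ≠ 0) (hp : 0 ≤ p) :
    IntegrableOn (refDensity₁ p ω T v) refTriangle := by
  refine ContinuousOn.integrableOn_compact refTriangle_isCompact ?_
  have h1 : Continuous (T.jac id) := T.continuous_jac id
  have h2 : Continuous (T.frobNum v) := T.continuous_frobNum v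
  have h3 : ContinuousOn (fun x => T.frobNum v x / T.jac id x ^ 2) refTriangle :=
    h2.continuousOn.div (h1.pow 2).continuousOn fun x hx => pow_ne_zero 2 (hJ x hx)
  exact h1.abs.continuousOn.mul
    (continuousOn_const.mul (h3.sqrt.rpow_const fun _ _ => Or.inr hp))

theorem integrableOn_density₁_interp (hJ : ∀ x ∈ refTriangle, T.jac id x ≠ 0) (hp : 0 ≤ p) :
    IntegrableOn (density₁ p ω (T.interp v)) T.carrier :=
  (integrableOn_carrier hJ _).mpr
    ((integrable_congr (refDensity₁_ae hJ)).mpr (integrableOn_refDensity₁ hJ hp))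

theorem energy₁_interp (hJ : ∀ x ∈ refTriangle, T.jac id x ≠ 0) :
    energy₁ p ω (T.interp v) T.carrier = ∫ x in refTriangle, refDensity₁ p ω T v x := by
  rw [energy₁, integral_carrier hJ, integral_congr_ae (refDensity₁_ae hJ)]

theorem energy₂_interp (hJ : ∀ x ∈ refTriangle, T.jac id x ≠ 0) :
    energy₂ g (T.interp v) T.carrier = ∫ x in refTriangle, refDensity₂ g T v x := by
  rw [energy₂, integral_carrier hJ, integral_congr_ae (refDensity₂_ae hJ)]

theorem ae_det_bounds_iff (hJ : ∀ x ∈ refTriangle, T.jac id x ≠ 0) {d D : ℝ} :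
    (∀ᵐ x ∂(volume.restrict T.carrier), d ≤ (fderiv ℝ (T.interp v) x).det ∧
      (fderiv ℝ (T.interp v) x).det ≤ D) ↔
    ∀ᵐ x ∂(volume.restrict refTriangle), T.jac v x / T.jac id x ∈ Icc d D := by
  rw [ae_carrier_iff hJ]
  refine eventually_congr ?_
  filter_upwards [ae_interior] with x hx
  rw [det_fderiv_interp v hJ hx, mem_Icc]

/-- The determinant bounds hold only almost everywhere, and `g` is continuous only on `[d, D]`. The
density is continuous on the compact set where the bounds hold, and that set is the triangle up to a
null set. -/
theorem integrableOn_refDensity₂ (hJ : ∀ x ∈ refTriangle, T.jac id x ≠ 0) {d D : ℝ}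
    (hg : ContinuousOn g (Icc d D))
    (hd : ∀ᵐ x ∂(volume.restrict refTriangle), T.jac v x / T.jac id x ∈ Icc d D) :
    IntegrableOn (refDensity₂ g T v) refTriangle := by
  have h1 : Continuous (T.jac id) := T.continuous_jac id
  have h2 : Continuous (T.jac v) := T.continuous_jac v
  have h3 : ContinuousOn (fun x => T.jac v x / T.jac id x) refTriangle :=
    h2.continuousOn.div h1.continuousOn hJ
  set Z : Set Plane := refTriangle ∩ (fun x => T.jac v x / T.jac id x) ⁻¹' Icc d D with hZ
  have hZc : IsCompact Z := refTriangle_isCompact.of_isClosed_subset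
    (h3.preimage_isClosed_of_isClosed refTriangle_isClosed isClosed_Icc) inter_subset_left
  have hint : IntegrableOn (refDensity₂ g T v) Z := by
    refine ContinuousOn.integrableOn_compact hZc ?_
    exact h1.abs.continuousOn.mul (hg.comp (h3.mono inter_subset_left) fun x hx => hx.2)
  refine hint.congr_set_ae ?_
  rw [ae_restrict_iff' refTriangle_measurableSet] at hd
  filter_upwards [hd] with x hx
  exact propext ⟨fun h => ⟨h, hx h⟩, fun h => h.1⟩

theorem integrableOn_density₂_interp (hJ : ∀ x ∈ refTriangle, T.jac id x ≠ 0) {d D : ℝ}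
    (hg : ContinuousOn g (Icc d D))
    (hd : ∀ᵐ x ∂(volume.restrict refTriangle), T.jac v x / T.jac id x ∈ Icc d D) :
    IntegrableOn (density₂ g (T.interp v)) T.carrier :=
  (integrableOn_carrier hJ _).mpr
    ((integrable_congr (refDensity₂_ae hJ)).mpr (integrableOn_refDensity₂ hJ hg hd))

end PolarTriangle

/-! ### Pointwise comparison of the densities -/

theorem abs_rpow_sub_one_le {x a : ℝ} (hx : 0 ≤ x) (h0 : 0 ≤ a) (h1 : a ≤ 1) :
    |x ^ a - 1| ≤ |x - 1| := by
  rcases le_total x 1 with hx1 | hx1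
  · have i1 : x ^ a ≤ 1 := Real.rpow_le_one hx hx1 h0
    have i2 : x ≤ x ^ a := Real.self_le_rpow_of_le_one hx hx1 h1
    rw [abs_of_nonpos (by linarith), abs_of_nonpos (by linarith)]
    linarith
  · have i1 : 1 ≤ x ^ a := Real.one_le_rpow hx1 h0
    have i2 : x ^ a ≤ x := Real.rpow_le_self_of_one_le hx1 h1
    rw [abs_of_nonneg (by linarith), abs_of_nonneg (by linarith)]
    linarith

/-- The exponents `p/2` and `p - 1` lie in `[0,1]`, where `|x^a - 1| ≤ |x - 1|`. The negative power
of `lam` is turned into `p - 1` by factoring out `lam^(1-p) ≤ 2`. -/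
theorem abs_rpow_mul_rpow_sub_one_le {p lam mu : ℝ} (hp : 1 ≤ p) (hp2 : p ≤ 2) (hl : 1 / 2 ≤ lam)
    (hm : 0 ≤ mu) : |lam ^ (1 - p) * mu ^ (p / 2) - 1| ≤ 2 * |mu - 1| + 2 * |lam - 1| := by
  have hl0 : 0 < lam := by linarith
  have h1 := abs_rpow_sub_one_le hm (by linarith : 0 ≤ p / 2) (by linarith)
  have h2 := abs_rpow_sub_one_le hl0.le (by linarith : 0 ≤ p - 1) (by linarith)
  have hlp : 0 ≤ lam ^ (1 - p) := Real.rpow_nonneg hl0.le _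
  have hl2 : lam ^ (1 - p) ≤ 2 := by
    have i1 : lam ^ (1 - p) ≤ (1 / 2) ^ (1 - p) :=
      Real.rpow_le_rpow_of_nonpos (by norm_num) hl (by linarith)
    have i2 : (1 / 2 : ℝ) ^ (1 - p) ≤ (1 / 2) ^ (-1 : ℝ) :=
      Real.rpow_le_rpow_of_exponent_ge (by norm_num) (by norm_num) (by linarith)
    rw [Real.rpow_neg_one] at i2
    norm_num at i2 ⊢
    linarith
  have hinv : lam ^ (1 - p) * lam ^ (p - 1) = 1 := by
    rw [← Real.rpow_add hl0]; simp
  have e : lam ^ (1 - p) * mu ^ (p / 2) - 1 =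
      lam ^ (1 - p) * (mu ^ (p / 2) - 1) - lam ^ (1 - p) * (lam ^ (p - 1) - 1) := by
    rw [mul_sub, mul_sub, hinv]; ring
  rw [e]
  refine abs_sub_le_add ?_ ?_ <;> rw [abs_mul, abs_of_nonneg hlp]
  · exact mul_le_mul hl2 h1 (abs_nonneg _) zero_le_two
  · exact mul_le_mul hl2 h2 (abs_nonneg _) zero_le_two

section Pointwise

variable {r r' r'' : ℝ → ℝ} {c B K e e₁ e₂ b G p ω : ℝ} {T : PolarTriangle} {ρ : Plane → ℝ}
  {x : Plane} {g : ℝ → ℝ}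

theorem ElementApprox.jac_pos (E : ElementApprox r r' K e e₁ e₂ b G T ρ x) (hG : 0 < G)
    (hρ : 0 < ρ x) : 0 < T.jac id x := by
  have := E.jac_lower
  have h : 0 < T.jac id x / G := by linarith
  exact (div_pos_iff_of_pos_right hG).mp h

/-- The pulled-back density is homogeneous: with normalized Jacobian `j` and numerator `m` it equals
`G ω j^(1-p) m^(p/2)`. It is compared with the exact one through the ratios `j/ρ` and `m/m₀`. -/
theorem ElementApprox.density₁ (E : ElementApprox r r' K e e₁ e₂ b G T ρ x) (hG : 0 < G)
    (hρ : ρ x ∈ Ioc (0 : ℝ) 1) (H : ProfileBounds r r' r'' c B) (hp : 1 ≤ p) (hp2 : p ≤ 2)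
    (hω : 0 ≤ ω) :
    |T.refDensity₁ p ω (radialMap r) x - G * (ρ x * radialDensity₁ p ω r r' (ρ x))| ≤
      4 * ω * B ^ 2 * K * (1 + 1 / c ^ 2) * (G * ((e₁ + e) * ρ x ^ (1 - p) +
        e * (b * ρ x ^ (-p)))) := by
  have hJ := E.jac_pos hG hρ.1
  have hc := H.c_pos
  have hc2 : 0 < c ^ 2 := by positivity
  obtain ⟨hM1, hM2⟩ := H.radialNum_bounds hρ
  set R := ρ x with hR
  set m₀ := radialNum r r' R with hm₀
  have hm₀0 : 0 < m₀ := hc2.trans_le hM1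
  set j := T.jac id x / G with hj
  set m := T.frobNum (radialMap r) x / G ^ 2 with hm
  have hj0 : 0 < j := div_pos hJ hG
  have hm0 : 0 ≤ m := div_nonneg (T.frobNum_nonneg _ x) (by positivity)
  have hRp : 0 < R := hρ.1
  have hRr : 0 ≤ R ^ (1 - p) := Real.rpow_nonneg hRp.le _
  have e1 : T.refDensity₁ p ω (radialMap r) x = G * (ω * (j ^ (1 - p) * m ^ (p / 2))) := by
    have hJG : T.jac id x = G * j := by rw [hj]; field_simp
    have hMG : T.frobNum (radialMap r) x = G ^ 2 * m := by rw [hm]; field_simp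
    have hdiv : G ^ 2 * m / (G * j) ^ 2 = m / j ^ 2 := by field_simp
    rw [PolarTriangle.refDensity₁, hJG, hMG, hdiv, abs_of_pos (mul_pos hG hj0),
      Real.sqrt_eq_rpow, ← Real.rpow_mul (by positivity), Real.div_rpow hm0 (by positivity),
      ← Real.rpow_natCast j 2, ← Real.rpow_mul hj0.le, show 1 / 2 * p = p / 2 by ring,
      show ((2 : ℕ) : ℝ) * (p / 2) = p by push_cast; ring, Real.rpow_sub hj0, Real.rpow_one]
    ring
  have e2 : R * radialDensity₁ p ω r r' R = ω * (R ^ (1 - p) * m₀ ^ (p / 2)) := by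
    rw [radialDensity₁_eq hRp hm₀0.le, Real.rpow_sub hRp, Real.rpow_one, Real.rpow_neg hRp.le]
    ring
  have e3 : j ^ (1 - p) * m ^ (p / 2) = R ^ (1 - p) * m₀ ^ (p / 2) *
      ((j / R) ^ (1 - p) * (m / m₀) ^ (p / 2)) := by
    rw [Real.div_rpow hj0.le hRp.le, Real.div_rpow hm0 hm₀0.le]
    have := (Real.rpow_pos_of_pos hRp (1 - p)).ne'
    have := (Real.rpow_pos_of_pos hm₀0 (p / 2)).ne'
    field_simp
  have h1 : 1 / 2 ≤ j / R := by
    rw [le_div_iff₀ hRp]; linarith [E.jac_lower]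
  have h2 := abs_rpow_mul_rpow_sub_one_le hp hp2 h1 (div_nonneg hm0 hm₀0.le)
  have h3 : |m / m₀ - 1| ≤ K * e₁ * (1 / c ^ 2) := by
    rw [div_sub_one hm₀0.ne', abs_div, abs_of_pos hm₀0, div_eq_mul_one_div]
    exact mul_le_mul E.frob (one_div_le_one_div_of_le hc2 hM1) (by positivity)
      ((abs_nonneg _).trans E.frob)
  -- The base radius turns into the more singular weight `b R^(-p)`, handled after integration by
  -- `integral_base_rpow_le`.
  have h4 : |j / R - 1| ≤ K * e * (1 + b / R) := by
    rw [div_sub_one hRp.ne', abs_div, abs_of_pos hRp, div_le_iff₀ hRp]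
    refine E.jac_rel.trans (le_of_eq ?_)
    rw [← hR]
    field_simp
  have hm₀B : m₀ ^ (p / 2) ≤ 2 * B ^ 2 := by
    have a1 := Real.rpow_le_rpow hm₀0.le hM2 (by linarith : 0 ≤ p / 2)
    have hB : 1 ≤ 2 * B ^ 2 := by nlinarith [H.one_le_B]
    refine a1.trans ?_
    conv_rhs => rw [← Real.rpow_one (2 * B ^ 2)]
    exact Real.rpow_le_rpow_of_exponent_le hB (by linarith)
  have hKe₁ : 0 ≤ K * e₁ := (abs_nonneg _).trans E.frob
  have hKeb : 0 ≤ K * e * (1 + b / R) := (abs_nonneg _).trans h4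
  have hc1 : 0 ≤ 1 / c ^ 2 := by positivity
  rw [e1, e2, ← mul_sub, abs_mul, abs_of_pos hG, ← mul_sub, abs_mul, abs_of_nonneg hω, e3,
    ← mul_sub_one, abs_mul, abs_of_nonneg (mul_nonneg hRr (Real.rpow_nonneg hm₀0.le _))]
  have hRb : R ^ (1 - p) * (1 + b / R) = R ^ (1 - p) + b * R ^ (-p) := by
    rw [Real.rpow_sub hRp, Real.rpow_one, Real.rpow_neg hRp.le]
    field_simp
  calc G * (ω * (R ^ (1 - p) * m₀ ^ (p / 2) *
        |(j / R) ^ (1 - p) * (m / m₀) ^ (p / 2) - 1|))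
      ≤ G * (ω * (R ^ (1 - p) * (2 * B ^ 2) *
        (2 * ((K * e₁) * (1 + 1 / c ^ 2)) + 2 * ((K * e * (1 + b / R)) * (1 + 1 / c ^ 2))))) := by
        have a1 : K * e₁ * (1 / c ^ 2) ≤ (K * e₁) * (1 + 1 / c ^ 2) :=
          mul_le_mul_of_nonneg_left (by linarith) hKe₁
        have a2 : K * e * (1 + b / R) ≤ (K * e * (1 + b / R)) * (1 + 1 / c ^ 2) :=
          le_mul_of_one_le_right hKeb (by linarith)
        gcongr
        exact h2.trans (by linarith)
    _ = 4 * ω * B ^ 2 * K * (1 + 1 / c ^ 2) * (G * (e₁ * R ^ (1 - p) +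
        e * (R ^ (1 - p) * (1 + b / R)))) := by ring
    _ = _ := by rw [hRb]; ring

theorem ElementApprox.density₂ (E : ElementApprox r r' K e e₁ e₂ b G T ρ x) (hG : 0 < G)
    (hρ : ρ x ∈ Ioc (0 : ℝ) 1) (H : ProfileBounds r r' r'' c B) {α β Lg Mg : ℝ} (hLg : 0 ≤ Lg)
    (hα : α ≤ c ^ 2) (hβ : B ^ 2 ≤ β)
    (hlip : ∀ a ∈ Icc α β, ∀ a' ∈ Icc α β, |g a - g a'| ≤ Lg * |a - a'|)
    (hbd : ∀ a ∈ Icc α β, |g a| ≤ Mg)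
    (hd : T.jac (radialMap r) x / T.jac id x ∈ Icc α β) :
    |T.refDensity₂ g (radialMap r) x - G * (ρ x * radialDensity₂ g r r' (ρ x))| ≤
      G * (K * e₂ * (Lg * (1 + B ^ 2) + Mg)) := by
  have hJ := E.jac_pos hG hρ.1
  have hdet := H.det_bounds hρ
  set R := ρ x with hR
  have hRp : 0 < R := hρ.1
  set j := T.jac id x / G with hj
  set ju := T.jac (radialMap r) x / G with hju
  set a := T.jac (radialMap r) x / T.jac id x with ha
  set a' := r R * r' R / R with ha'
  have hj0 : 0 < j := div_pos hJ hG
  have haj : a * j = ju := by rw [ha, hj, hju]; field_simp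
  have ha'R : a' * R = r R * r' R := by rw [ha']; field_simp
  have hmem : a' ∈ Icc α β := ⟨hα.trans hdet.1, hdet.2.trans hβ⟩
  have e1 : T.refDensity₂ g (radialMap r) x = G * (j * g a) := by
    rw [PolarTriangle.refDensity₂, abs_of_pos hJ, hj, ← ha]; field_simp
  have h1 := hlip a hd a' hmem
  have hKe : 0 ≤ K * e₂ := (abs_nonneg _).trans E.jac_abs
  have ha'0 : 0 ≤ a' := (sq_nonneg c).trans hdet.1
  -- The determinants are quotients by small radii, but their difference occurs multiplied by the
  -- Jacobian `j`. Clearing the denominator leaves only the absolute errors of the two Jacobians.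
  have h2 : j * |a - a'| ≤ K * e₂ * (1 + B ^ 2) := by
    have e : j * (a - a') = (ju - r R * r' R) - a' * (j - R) := by
      rw [← haj, ← ha'R]; ring
    have h3 : |a' * (j - R)| ≤ B ^ 2 * (K * e₂) := by
      rw [abs_mul, abs_of_nonneg ha'0]
      exact mul_le_mul hdet.2 E.jac_abs (abs_nonneg _) (sq_nonneg B)
    have h4 := abs_sub_le_add E.det h3
    rw [← hR, ← hju, ← e, abs_mul, abs_of_pos hj0] at h4
    linarith
  rw [e1, radialDensity₂, ← ha', ← mul_sub, abs_mul, abs_of_pos hG]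
  refine mul_le_mul_of_nonneg_left ?_ hG.le
  have e3 : j * g a - R * g a' = j * (g a - g a') + (j - R) * g a' := by ring
  have h5 : |j * (g a - g a')| ≤ Lg * (K * e₂ * (1 + B ^ 2)) := by
    rw [abs_mul, abs_of_pos hj0]
    calc j * |g a - g a'| ≤ j * (Lg * |a - a'|) := mul_le_mul_of_nonneg_left h1 hj0.le
      _ = Lg * (j * |a - a'|) := by ring
      _ ≤ _ := mul_le_mul_of_nonneg_left h2 hLg
  have h6 : |(j - R) * g a'| ≤ K * e₂ * Mg := by
    rw [abs_mul]
    exact mul_le_mul E.jac_abs (hbd a' hmem) (abs_nonneg _) hKe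
  rw [e3]
  have := abs_add_le_add h5 h6
  linarith

end Pointwise
end
noncomputable section

/-! ### Reference sums over a layer -/

theorem continuous_refRadius (ε τ : ℝ) (t : ElementType) : Continuous (refRadius ε τ t) := by
  have := continuous_coord
  cases t <;> unfold refRadius <;> fun_prop

theorem refRadius_mem {ε τ : ℝ} (hτ : 0 ≤ τ) (t : ElementType) {x : Plane}
    (hx : x ∈ refTriangle) : refRadius ε τ t x ∈ Icc ε (ε + τ) := by
  obtain ⟨h0, h1, h2⟩ := hx
  have key : ∀ w : ℝ, 0 ≤ w → w ≤ 1 → ε + τ * w ∈ Icc ε (ε + τ) := fun w w0 w1 =>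
    ⟨by linarith [mul_nonneg hτ w0], by linarith [mul_le_of_le_one_right hτ w1]⟩
  cases t
  · exact key _ (by linarith) h2
  · exact key _ (by linarith) (by linarith)
  · exact key _ h0 (by linarith)
  · exact key _ h1 (by linarith)

section Reference

variable {ε τ : ℝ} {k : ℝ → ℝ}

theorem continuousOn_affine (hτ : 0 ≤ τ) (hk : ContinuousOn k (Icc ε (ε + τ))) :
    ContinuousOn (fun s => k (ε + τ * s)) (Icc 0 1) :=
  hk.comp (by fun_prop) fun s hs => ⟨by linarith [mul_nonneg hτ hs.1],
    by linarith [mul_le_of_le_one_right hτ hs.2]⟩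

/-- The integrals over the reference triangle of a function of the radius. -/
theorem integral_refRadius (hτ : 0 ≤ τ) (hk : ContinuousOn k (Icc ε (ε + τ))) (t : ElementType) :
    ∫ x in refTriangle, k (refRadius ε τ t x) =
      if t = .A then ∫ s in (0 : ℝ)..1, s * k (ε + τ * s)
      else ∫ s in (0 : ℝ)..1, (1 - s) * k (ε + τ * s) := by
  have h := continuousOn_affine hτ hk
  cases t
  · exact setIntegral_refTriangle_add h
  · exact setIntegral_refTriangle_sub h
  · exact setIntegral_refTriangle_fst h
  · exact setIntegral_refTriangle_snd h

theorem integral_affine (k : ℝ → ℝ) :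
    τ * ∫ s in (0 : ℝ)..1, k (ε + τ * s) = ∫ R in ε..(ε + τ), k R := by
  have := intervalIntegral.smul_integral_comp_add_mul (a := 0) (b := 1) k τ ε
  simpa only [mul_zero, add_zero, mul_one, smul_eq_mul] using this

/-- Type A gives the weight `s` with area factor `2`. Type B, or types C and D together, give `1 -
s` with total factor `2`. The weights add up to one, so the sum is the same for both kinds of
layers. -/
theorem sum_reference (hτ : 0 ≤ τ) (hk : ContinuousOn k (Icc ε (ε + τ))) (S : ℝ) (K : LayerKind)
    (N : ℕ) : ∑ e ∈ layerIndex K N, areaFactor e.1 * (2 * S * τ) *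
      ∫ x in refTriangle, k (refRadius ε τ e.1 x) = 4 * N * S * ∫ R in ε..(ε + τ), k R := by
  have h := continuousOn_affine hτ hk
  have hi : ∀ f : ℝ → ℝ, ContinuousOn f (Icc 0 1) → IntervalIntegrable f volume 0 1 :=
    fun f hf => ContinuousOn.intervalIntegrable (by rwa [uIcc_of_le zero_le_one])
  have hadd : (∫ s in (0 : ℝ)..1, s * k (ε + τ * s)) +
      (∫ s in (0 : ℝ)..1, (1 - s) * k (ε + τ * s)) = ∫ s in (0 : ℝ)..1, k (ε + τ * s) := by
    rw [← intervalIntegral.integral_add (hi (fun s => s * k (ε + τ * s)) (continuousOn_id.mul h))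
      (hi (fun s => (1 - s) * k (ε + τ * s))
        ((continuousOn_const.sub continuousOn_id).mul h))]
    congr 1
    funext s
    ring
  rw [← integral_affine, ← hadd, layerIndex, Finset.sum_product]
  simp only [integral_refRadius hτ hk]
  cases K <;> simp [LayerKind.types, areaFactor] <;> ring

/-- Uniform bound for the integrals of a nonnegative function of the radius. -/
theorem integral_refRadius_le (hτ : 0 ≤ τ) (hk : ContinuousOn k (Icc ε (ε + τ)))
    (hk0 : ∀ R ∈ Icc ε (ε + τ), 0 ≤ k R) (t : ElementType) :
    ∫ x in refTriangle, k (refRadius ε τ t x) ≤ ∫ s in (0 : ℝ)..1, k (ε + τ * s) := by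
  have h := continuousOn_affine hτ hk
  have hi : ∀ f : ℝ → ℝ, ContinuousOn f (Icc 0 1) → IntervalIntegrable f volume 0 1 :=
    fun f hf => ContinuousOn.intervalIntegrable (by rwa [uIcc_of_le zero_le_one])
  have h0 : ∀ s ∈ Icc (0 : ℝ) 1, 0 ≤ k (ε + τ * s) := fun s hs =>
    hk0 _ ⟨by linarith [mul_nonneg hτ hs.1], by linarith [mul_le_of_le_one_right hτ hs.2]⟩
  rw [integral_refRadius hτ hk]
  split_ifs
  · exact intervalIntegral.integral_mono_on zero_le_one (hi _ (continuousOn_id.mul h)) (hi _ h)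
      fun s hs => mul_le_of_le_one_left (h0 s hs) hs.2
  · exact intervalIntegral.integral_mono_on zero_le_one
      (hi _ ((continuousOn_const.sub continuousOn_id).mul h)) (hi _ h)
      fun s hs => mul_le_of_le_one_left (h0 s hs) (by linarith [hs.1])

theorem continuousOn_rpow_Icc (hε : 0 < ε) (q : ℝ) :
    ContinuousOn (fun R : ℝ => R ^ q) (Icc ε (ε + τ)) :=
  continuousOn_id.rpow_const fun _ hR => Or.inl (hε.trans_le hR.1).ne'

/-- The extra singularity is compensated by the distribution of the radius: `(ε+τ) s` and `ε (1-s)`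
are both at most `ε + τ s`, which restores the exponent `1 - p`. -/
theorem integral_base_rpow_le (hε : 0 < ε) (hτ : 0 < τ) (p : ℝ) (t : ElementType) :
    ∫ x in refTriangle, baseRadius ε τ t * refRadius ε τ t x ^ (-p) ≤
      ∫ s in (0 : ℝ)..1, (ε + τ * s) ^ (1 - p) := by
  have hk := continuousOn_rpow_Icc (τ := τ) hε (-p)
  have hk1 := continuousOn_rpow_Icc (τ := τ) hε (1 - p)
  have h := continuousOn_affine hτ.le hk
  have h1 := continuousOn_affine hτ.le hk1
  have hi : ∀ f : ℝ → ℝ, ContinuousOn f (Icc 0 1) → IntervalIntegrable f volume 0 1 :=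
    fun f hf => ContinuousOn.intervalIntegrable (by rwa [uIcc_of_le zero_le_one])
  have hpos : ∀ s ∈ Icc (0 : ℝ) 1, 0 < ε + τ * s := fun s hs => by
    linarith [mul_nonneg hτ.le hs.1]
  have hrp : ∀ s ∈ Icc (0 : ℝ) 1, (ε + τ * s) ^ (1 - p) = (ε + τ * s) * (ε + τ * s) ^ (-p) := by
    intro s hs
    rw [Real.rpow_sub (hpos s hs), Real.rpow_one, Real.rpow_neg (hpos s hs).le]
    field_simp
  have hnn : 0 ≤ ∫ s in (0 : ℝ)..1, (ε + τ * s) ^ (1 - p) :=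
    intervalIntegral.integral_nonneg zero_le_one fun s hs => Real.rpow_nonneg (hpos s hs).le _
  have key : ∀ (β : ℝ) (w : ℝ → ℝ), Continuous w → (∀ s ∈ Icc (0 : ℝ) 1, β * w s ≤ ε + τ * s) →
      β * ∫ s in (0 : ℝ)..1, w s * (ε + τ * s) ^ (-p) ≤
        ∫ s in (0 : ℝ)..1, (ε + τ * s) ^ (1 - p) := by
    intro β w hw hβ
    rw [← intervalIntegral.integral_const_mul]
    refine intervalIntegral.integral_mono_on zero_le_one (hi _ (by fun_prop)) (hi _ h1) ?_
    intro s hs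
    rw [hrp s hs, ← mul_assoc]
    exact mul_le_mul_of_nonneg_right (hβ s hs) (Real.rpow_nonneg (hpos s hs).le _)
  rw [integral_const_mul, integral_refRadius hτ.le hk]
  cases t
  · refine key (ε + τ) (fun s => s) continuous_id fun s hs => ?_
    linarith [mul_le_of_le_one_right hε.le hs.2]
  · refine key ε (fun s => 1 - s) (by fun_prop) fun s hs => ?_
    linarith [mul_nonneg hε.le hs.1, mul_nonneg hτ.le hs.1]
  · simpa [baseRadius] using hnn
  · simpa [baseRadius] using hnn

theorem sum_const_le {N : ℕ} (K : LayerKind) {f : ElementType × Fin N → ℝ} {C : ℝ} (hC : 0 ≤ C)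
    (hf : ∀ e ∈ layerIndex K N, f e ≤ C) : ∑ e ∈ layerIndex K N, f e ≤ 3 * N * C := by
  refine (Finset.sum_le_card_nsmul _ _ C hf).trans ?_
  have hc : ((layerIndex K N).card : ℝ) ≤ 3 * N := by
    have : (layerIndex K N).card ≤ 3 * N := by
      rw [layerIndex, Finset.card_product, Finset.card_univ, Fintype.card_fin]
      refine Nat.mul_le_mul_right N ?_
      cases K <;> decide
    exact_mod_cast this
  rw [nsmul_eq_mul]
  exact mul_le_mul_of_nonneg_right hc hC

end Reference

/-! ### The mesh parameters -/

/-- The sine is squeezed between `y - y³/4` and `y` at `y = π/(2N)`; the cubic term is the relative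
error `N⁻²` in the angular sum. -/
theorem meshSin_bounds {N : ℕ} (hN : 0 < N) :
    N * meshSin N ≤ 2 ∧ |4 * N * meshSin N - 2 * Real.pi| ≤ 2 * Real.pi * (1 / (N : ℝ) ^ 2) ∧
      4 * N * meshSin N ≤ 2 * Real.pi := by
  have hN1 := one_le_cast hN
  have hN0 : (0 : ℝ) < N := by linarith
  have hpi := Real.pi_pos
  have hpi4 := Real.pi_le_four
  set y := Real.pi / N / 2 with hy
  have hy0 : 0 < y := by positivity
  have hNy : 2 * (N * y) = Real.pi := by rw [hy]; field_simp
  have h1 : meshSin N ≤ y := Real.sin_le hy0.le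
  have h1' := mul_le_mul_of_nonneg_left h1 hN0.le
  have h2 : y - y ^ 3 / 4 ≤ meshSin N := by
    have := Real.sin_gt_sub_cube hy0
    have := pow_pos hy0 3
    change _ ≤ Real.sin y
    linarith
  refine ⟨by linarith, ?_, by linarith⟩
  have h3 : N * (y - y ^ 3 / 4) ≤ N * meshSin N := mul_le_mul_of_nonneg_left h2 hN0.le
  have h4 : y ^ 2 ≤ 4 * (1 / (N : ℝ) ^ 2) := by
    have e : y ^ 2 = Real.pi ^ 2 / 4 * (1 / (N : ℝ) ^ 2) := by rw [hy]; field_simp; norm_num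
    rw [e]
    have : Real.pi ^ 2 / 4 ≤ 4 := by nlinarith
    exact mul_le_mul_of_nonneg_right this (by positivity)
  rw [abs_le]
  have e : N * (y - y ^ 3 / 4) = N * y - N * y * y ^ 2 / 4 := by ring
  rw [e] at h3
  have h5 : N * y * y ^ 2 ≤ N * y * (4 * (1 / (N : ℝ) ^ 2)) :=
    mul_le_mul_of_nonneg_left h4 (by positivity)
  have h6 : 0 ≤ 1 / (N : ℝ) ^ 2 := by positivity
  have h7 : N * y * (4 * (1 / (N : ℝ) ^ 2)) = 2 * Real.pi * (1 / (N : ℝ) ^ 2) := by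
    rw [← hNy]; ring
  constructor <;> nlinarith
end
noncomputable section

/-! ### Energies of the interpolant on a layer -/

theorem abs_setIntegral_sub_le {U : Set Plane} {F k β : Plane → ℝ} (hF : IntegrableOn F U)
    (hk : IntegrableOn k U) (hβ : IntegrableOn β U)
    (h : ∀ᵐ x ∂(volume.restrict U), |F x - k x| ≤ β x) :
    |(∫ x in U, F x) - ∫ x in U, k x| ≤ ∫ x in U, β x := by
  rw [← integral_sub hF hk]
  exact norm_integral_le_of_norm_le (f := fun x => F x - k x) hβ h

theorem integrableOn_comp_refRadius {ε τ : ℝ} {k : ℝ → ℝ} (hτ : 0 ≤ τ)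
    (hk : ContinuousOn k (Icc ε (ε + τ))) (t : ElementType) :
    IntegrableOn (fun x => k (refRadius ε τ t x)) refTriangle :=
  (hk.comp (continuous_refRadius ε τ t).continuousOn
    fun _ hx => refRadius_mem hτ t hx).integrableOn_compact refTriangle_isCompact

/-- The total mesh error `κ + κ² (ε + τ) / τ`. -/
def meshE (ε τ : ℝ) (N : ℕ) : ℝ := meshCos N + meshCos N ^ 2 * (ε + τ) / τ

/-- The scaling factor of an element. -/
def elementScale (τ : ℝ) (N : ℕ) (t : ElementType) : ℝ := areaFactor t * (2 * meshSin N * τ)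

section Layer

variable {ε τ c B p ω : ℝ} {N : ℕ} {r r' r'' g : ℝ → ℝ}

theorem meshE_nonneg (L : LayerParams ε τ N) : 0 ≤ meshE ε τ N := by
  have := L.eps_pos
  have := L.tau_pos
  have := meshCos_nonneg N
  rw [meshE]; positivity

theorem elementScale_bounds (P : SectorParams ε τ (Real.pi / N) (meshCos N) (meshSin N))
    (t : ElementType) : 0 < elementScale τ N t ∧ elementScale τ N t ≤ 4 * meshSin N * τ := by
  have := mul_pos P.S_pos P.τ_pos
  constructor <;> cases t <;> simp only [elementScale, areaFactor] <;> nlinarith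

theorem refRadius_mem_Ioc (L : LayerParams ε τ N) (t : ElementType) {x : Plane}
    (hx : x ∈ refTriangle) : refRadius ε τ t x ∈ Ioc (0 : ℝ) 1 := by
  have := refRadius_mem (ε := ε) L.tau_pos.le t hx
  exact ⟨L.eps_pos.trans_le this.1, this.2.trans L.le_one⟩

theorem Icc_subset_Ioc (L : LayerParams ε τ N) : Icc ε (ε + τ) ⊆ Ioc (0 : ℝ) 1 :=
  fun _ hR => ⟨L.eps_pos.trans_le hR.1, hR.2.trans L.le_one⟩

theorem layer_elementApprox (H : ProfileBounds r r' r'' c B) (L : LayerParams ε τ N)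
    (P : SectorParams ε τ (Real.pi / N) (meshCos N) (meshSin N)) (e : ElementType × Fin N)
    {x : Plane} (hx : x ∈ refTriangle) :
    ElementApprox r r' (1000000 * B ^ 2) (meshE ε τ N) (τ ^ 2 + meshE ε τ N)
      (τ ^ 2 + meshCos N * (ε + τ) + meshCos N ^ 2 / τ)
      (baseRadius ε τ e.1) (elementScale τ N e.1) (layerElement ε τ N e)
      (refRadius ε τ e.1) x :=
  layer_approx H L rfl rfl P.S_pos.ne' (P.small.trans (by norm_num)) e hx

theorem layer_jac_ne_zero (H : ProfileBounds r r' r'' c B) (L : LayerParams ε τ N)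
    (P : SectorParams ε τ (Real.pi / N) (meshCos N) (meshSin N)) (e : ElementType × Fin N) :
    ∀ x ∈ refTriangle, (layerElement ε τ N e).jac id x ≠ 0 := fun _ hx =>
  ((layer_elementApprox H L P e hx).jac_pos (elementScale_bounds P e.1).1
    (refRadius_mem_Ioc L e.1 hx).1).ne'

theorem integral_affine_rpow (hp2 : p < 2) :
    τ * ∫ s in (0 : ℝ)..1, (ε + τ * s) ^ (1 - p) = layerSize p ε τ / (2 - p) := by
  rw [integral_affine (fun R => R ^ (1 - p)), integral_rpow_layer hp2]

theorem layerSize_pos (L : LayerParams ε τ N) (hp : 1 ≤ p) (hp2 : p < 2) :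
    0 < layerSize p ε τ :=
  lt_of_lt_of_le (mul_pos (by linarith) L.tau_pos)
    (layerSize_ge L.eps_pos L.tau_pos L.le_one hp hp2)

/-- Weighted integrals of a singular density over an annulus. -/
theorem integral_mul_le_layerSize {f : ℝ → ℝ} {C : ℝ} (L : LayerParams ε τ N) (hp2 : p < 2)
    (hf : ContinuousOn f (Ioc 0 1)) (hf0 : ∀ R ∈ Ioc (0 : ℝ) 1, f R ≤ C * R ^ (-p)) :
    ∫ R in ε..(ε + τ), R * f R ≤ C * (layerSize p ε τ / (2 - p)) := by
  have hle : ε ≤ ε + τ := by linarith [L.tau_pos]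
  rw [← integral_rpow_layer hp2, ← intervalIntegral.integral_const_mul]
  refine intervalIntegral.integral_mono_on hle
    (intervalIntegrable_of_continuousOn_Ioc (continuousOn_id.mul hf) L.eps_pos hle L.le_one)
    (intervalIntegrable_of_continuousOn_Ioc
      (continuousOn_const.mul (continuousOn_rpow_Ioc _)) L.eps_pos hle L.le_one) ?_
  intro R hR
  have hR' := Icc_subset_Ioc L hR
  have := mul_le_mul_of_nonneg_left (hf0 R hR') hR'.1.le
  refine this.trans (le_of_eq ?_)
  rw [Real.rpow_sub hR'.1, Real.rpow_one, Real.rpow_neg hR'.1.le]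
  field_simp

theorem layerSize_le_integral_mul {f : ℝ → ℝ} {C : ℝ} (L : LayerParams ε τ N) (hp2 : p < 2)
    (hf : ContinuousOn f (Ioc 0 1)) (hf0 : ∀ R ∈ Ioc (0 : ℝ) 1, C * R ^ (-p) ≤ f R) :
    C * (layerSize p ε τ / (2 - p)) ≤ ∫ R in ε..(ε + τ), R * f R := by
  have h := integral_mul_le_layerSize (f := fun R => -f R) (C := -C) L hp2 hf.neg
    fun R hR => by linarith [hf0 R hR]
  simp only [mul_neg, intervalIntegral.integral_neg] at h
  linarith

theorem integral_mul_le_const {f : ℝ → ℝ} {C : ℝ} (L : LayerParams ε τ N)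
    (hf0 : ∀ R ∈ Ioc (0 : ℝ) 1, 0 ≤ f R ∧ f R ≤ C) :
    ∫ R in ε..(ε + τ), R * f R ≤ C * ((ε + τ) * τ) := by
  have hle : ε ≤ ε + τ := by linarith [L.tau_pos]
  have h := intervalIntegral.norm_integral_le_of_norm_le_const (a := ε) (b := ε + τ)
    (f := fun R => R * f R) (C := (ε + τ) * C) (by
      intro R hR
      rw [uIoc_of_le hle] at hR
      have hR' : R ∈ Ioc (0 : ℝ) 1 := Icc_subset_Ioc L ⟨hR.1.le, hR.2⟩
      obtain ⟨f0, f1⟩ := hf0 R hR'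
      rw [Real.norm_eq_abs, abs_of_nonneg (mul_nonneg hR'.1.le f0)]
      exact mul_le_mul hR.2 f1 f0 (by linarith [hR'.1, hR.2]))
  rw [add_sub_cancel_left, abs_of_pos L.tau_pos] at h
  have := (le_abs_self _).trans h
  linarith

/-- The error of the reference sums. -/
theorem sum_reference_sub_le {f : ℝ → ℝ} {I : ℝ} (L : LayerParams ε τ N) (K : LayerKind)
    (hf : ContinuousOn f (Ioc 0 1)) (hf0 : ∀ R ∈ Ioc (0 : ℝ) 1, 0 ≤ f R)
    (hI : ∫ R in ε..(ε + τ), R * f R ≤ I) :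
    |(∑ e ∈ layerIndex K N, elementScale τ N e.1 *
        ∫ x in refTriangle, refRadius ε τ e.1 x * f (refRadius ε τ e.1 x)) -
      2 * Real.pi * ∫ R in ε..(ε + τ), R * f R| ≤ 8 * I * (1 / (N : ℝ) ^ 2) := by
  have hk : ContinuousOn (fun R => R * f R) (Icc ε (ε + τ)) :=
    (continuousOn_id.mul hf).mono (Icc_subset_Ioc L)
  have h := sum_reference (k := fun R => R * f R) L.tau_pos.le hk (meshSin N) K N
  simp only [elementScale]
  rw [h, ← sub_mul, abs_mul]
  have hnn : 0 ≤ ∫ R in ε..(ε + τ), R * f R :=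
    intervalIntegral.integral_nonneg (by linarith [L.tau_pos]) fun R hR =>
      mul_nonneg (Icc_subset_Ioc L hR).1.le (hf0 R (Icc_subset_Ioc L hR))
  rw [abs_of_nonneg hnn]
  have h1 := (meshSin_bounds L.N_pos).2.1
  have h2 : 0 ≤ 1 / (N : ℝ) ^ 2 := by positivity
  have hpi := Real.pi_le_four
  have h3 : 2 * Real.pi * (1 / (N : ℝ) ^ 2) ≤ 8 * (1 / (N : ℝ) ^ 2) := by gcongr; linarith
  calc _ ≤ 8 * (1 / (N : ℝ) ^ 2) * I := mul_le_mul (h1.trans h3) hI hnn (by positivity)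
    _ = _ := by ring

/-- The pointwise density estimate is integrated on each element and summed; the comparison sum is
then `4 N S ∫ R f(R) dR`, and replacing `4 N S` by `2π` costs another `N⁻²`. -/
theorem interpEnergy₁_approx (H : ProfileBounds r r' r'' c B) (hp : 1 ≤ p) (hp2 : p < 2)
    (hω : 0 ≤ ω) : ∃ C ≥ 0, ∀ (K : LayerKind) (ε τ : ℝ) (N : ℕ), LayerParams ε τ N →
      SectorParams ε τ (Real.pi / N) (meshCos N) (meshSin N) →
      |interpEnergy₁ p ω (radialMap r) K ε τ N -
          2 * Real.pi * ∫ R in ε..(ε + τ), R * radialDensity₁ p ω r r' R| ≤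
        C * layerSize p ε τ * (τ ^ 2 + 1 / (N : ℝ) ^ 2 + ε / τ * (1 / (N : ℝ) ^ 4)) := by
  have hp2' : 0 < 2 - p := by linarith
  set K' := 4 * ω * B ^ 2 * (1000000 * B ^ 2) * (1 + 1 / c ^ 2) with hK'
  have hK'0 : 0 ≤ K' := by positivity
  refine ⟨432 * K' / (2 - p) + 8 * (ω * (2 * B ^ 2)) / (2 - p), by positivity, ?_⟩
  intro K ε τ N L P
  have hε := L.eps_pos
  have hτ := L.tau_pos
  have hA := layerSize_pos L hp hp2
  set η := τ ^ 2 + 1 / (N : ℝ) ^ 2 + ε / τ * (1 / (N : ℝ) ^ 4) with hη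
  have hη1 : 0 ≤ 1 / (N : ℝ) ^ 2 := by positivity
  have hη2 : 0 ≤ ε / τ * (1 / (N : ℝ) ^ 4) := by positivity
  have hη3 : 0 ≤ τ ^ 2 := sq_nonneg τ
  have hE0 := meshE_nonneg L
  have hE : meshE ε τ N ≤ 6 * (1 / (N : ℝ) ^ 2) + 4 * (ε / τ * (1 / (N : ℝ) ^ 4)) :=
    mesh_error_le L
  set I := ∫ s in (0 : ℝ)..1, (ε + τ * s) ^ (1 - p) with hI
  have hτI : τ * I = layerSize p ε τ / (2 - p) := integral_affine_rpow hp2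
  have hI0 : 0 ≤ I := by
    have : 0 ≤ τ * I := by rw [hτI]; positivity
    exact nonneg_of_mul_nonneg_right this hτ
  have hS0 := P.S_pos
  have hcf := continuousOn_radialDensity₁ (ω := ω) H (by linarith : 0 ≤ p)
  have hk : ContinuousOn (fun R => R * radialDensity₁ p ω r r' R) (Icc ε (ε + τ)) :=
    (continuousOn_id.mul hcf).mono (Icc_subset_Ioc L)
  have hr1 := continuousOn_rpow_Icc (τ := τ) hε (1 - p)
  have hr2 := continuousOn_rpow_Icc (τ := τ) hε (-p)
  have helem : ∀ e ∈ layerIndex K N,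
      |energy₁ p ω ((layerElement ε τ N e).interp (radialMap r)) (layerElement ε τ N e).carrier -
        elementScale τ N e.1 * ∫ x in refTriangle,
          refRadius ε τ e.1 x * radialDensity₁ p ω r r' (refRadius ε τ e.1 x)| ≤
      K' * (4 * meshSin N * τ * (18 * η * I)) := by
    intro e _
    obtain ⟨hG0, hG1⟩ := elementScale_bounds P e.1
    have hJ := layer_jac_ne_zero H L P e
    have i1 := integrableOn_comp_refRadius hτ.le hr1 e.1
    have i2 := (integrableOn_comp_refRadius hτ.le hr2 e.1).const_mul (baseRadius ε τ e.1)
    have i12 : IntegrableOn (fun x =>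
        (τ ^ 2 + meshE ε τ N + meshE ε τ N) * refRadius ε τ e.1 x ^ (1 - p) +
        meshE ε τ N * (baseRadius ε τ e.1 * refRadius ε τ e.1 x ^ (-p))) refTriangle :=
      (i1.const_mul _).add (i2.const_mul _)
    have i3 := integrableOn_comp_refRadius hτ.le hk e.1
    rw [PolarTriangle.energy₁_interp hJ, ← integral_const_mul]
    have h := abs_setIntegral_sub_le
      (β := fun x => K' * (elementScale τ N e.1 *
        ((τ ^ 2 + meshE ε τ N + meshE ε τ N) * refRadius ε τ e.1 x ^ (1 - p) +
        meshE ε τ N * (baseRadius ε τ e.1 * refRadius ε τ e.1 x ^ (-p)))))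
      (PolarTriangle.integrableOn_refDensity₁ (v := radialMap r) (ω := ω) hJ
        (by linarith : 0 ≤ p)) (i3.const_mul (elementScale τ N e.1))
      ((i12.const_mul _).const_mul _) (by
        rw [ae_restrict_iff' refTriangle_measurableSet]
        refine ae_of_all _ fun x hx => ?_
        exact (layer_elementApprox H L P e hx).density₁ hG0 (refRadius_mem_Ioc L e.1 hx) H hp
          hp2.le hω)
    refine h.trans ?_
    rw [integral_const_mul, integral_const_mul, integral_add (i1.const_mul _) (i2.const_mul _),
      integral_const_mul, integral_const_mul]
    have j1 : ∫ x in refTriangle, refRadius ε τ e.1 x ^ (1 - p) ≤ I :=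
      integral_refRadius_le hτ.le hr1
        (fun R hR => Real.rpow_nonneg (hε.trans_le hR.1).le _) e.1
    have j2 := integral_base_rpow_le hε hτ p e.1
    refine mul_le_mul_of_nonneg_left ?_ hK'0
    calc _ ≤ elementScale τ N e.1 * ((τ ^ 2 + meshE ε τ N + meshE ε τ N) * I +
          meshE ε τ N * I) := by gcongr
      _ = elementScale τ N e.1 * ((τ ^ 2 + 3 * meshE ε τ N) * I) := by ring
      _ ≤ 4 * meshSin N * τ * (18 * η * I) := by
        have : τ ^ 2 + 3 * meshE ε τ N ≤ 18 * η := by rw [hη]; linarith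
        gcongr
  have hsum : |interpEnergy₁ p ω (radialMap r) K ε τ N -
      ∑ e ∈ layerIndex K N, elementScale τ N e.1 * ∫ x in refTriangle,
        refRadius ε τ e.1 x * radialDensity₁ p ω r r' (refRadius ε τ e.1 x)| ≤
      432 * K' / (2 - p) * layerSize p ε τ * η := by
    rw [interpEnergy₁, ← Finset.sum_sub_distrib]
    refine (Finset.abs_sum_le_sum_abs _ _).trans ?_
    refine (sum_const_le K (by positivity) helem).trans ?_
    -- The number of elements is paid for by the factor `S` of the area scale, as `N S ≤ 2`; the
    -- factor `τ` turns `I` into the layer size.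
    have e1 : 3 * N * (K' * (4 * meshSin N * τ * (18 * η * I))) =
        216 * K' * (N * meshSin N) * η * (τ * I) := by ring
    rw [e1, hτI]
    have := (meshSin_bounds L.N_pos).1
    calc _ ≤ 216 * K' * 2 * η * (layerSize p ε τ / (2 - p)) := by gcongr
      _ = _ := by ring
  have href := sum_reference_sub_le L K hcf
    (fun R hR => (radialDensity₁_bounds H (by linarith) hp2.le hω hR).1.trans' (by
      have := H.c_pos
      have := Real.rpow_nonneg hR.1.le (-p)
      positivity))
    (integral_mul_le_layerSize L hp2 hcf fun R hR =>
      (radialDensity₁_bounds H (by linarith) hp2.le hω hR).2)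
  have hfin := abs_add_le_add hsum href
  rw [sub_add_sub_cancel] at hfin
  refine hfin.trans ?_
  have : 8 * (ω * (2 * B ^ 2) * (layerSize p ε τ / (2 - p))) * (1 / (N : ℝ) ^ 2) ≤
      8 * (ω * (2 * B ^ 2) * (layerSize p ε τ / (2 - p))) * η := by
    have : 1 / (N : ℝ) ^ 2 ≤ η := by rw [hη]; linarith
    gcongr
  refine (add_le_add le_rfl this).trans (le_of_eq ?_)
  ring

theorem IsCompressibility.exists_lipschitz (hg : IsCompressibility g) {α β : ℝ} (hα : 0 < α) :
    ∃ Lg ≥ 0, ∃ Mg ≥ 0, (∀ a ∈ Icc α β, ∀ a' ∈ Icc α β, |g a - g a'| ≤ Lg * |a - a'|) ∧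
      ∀ a ∈ Icc α β, |g a| ≤ Mg := by
  have hsub : Icc α β ⊆ Ioi 0 := fun a ha => hα.trans_le ha.1
  obtain ⟨L, hL⟩ := (isCompact_Icc (a := α) (b := β)).exists_bound_of_continuousOn
    ((hg.contDiff.continuousOn_deriv_of_isOpen isOpen_Ioi le_rfl).mono hsub)
  obtain ⟨M, hM⟩ := (isCompact_Icc (a := α) (b := β)).exists_bound_of_continuousOn
    (hg.contDiff.continuousOn.mono hsub)
  refine ⟨max L 0, le_max_right _ _, max M 0, le_max_right _ _, fun a ha a' ha' => ?_,
    fun a ha => (hM a ha).trans (le_max_left _ _)⟩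
  exact (convex_Icc α β).norm_image_sub_le_of_norm_deriv_le
    (fun x hx => (hg.contDiff.differentiableOn one_ne_zero).differentiableAt
      (Ioi_mem_nhds (hsub hx)))
    (fun x hx => (hL x hx).trans (le_max_left _ _)) ha' ha

/-- Here the pointwise errors are absolute, and the exact density is bounded. No singular weights
occur: the error is the number of elements times their area scale times the pointwise error. -/
theorem interpEnergy₂_approx (H : ProfileBounds r r' r'' c B) (hg : IsCompressibility g) {d D : ℝ}
    (hd : 0 < d) : ∃ C ≥ 0, ∀ (K : LayerKind) (ε τ : ℝ) (N : ℕ), LayerParams ε τ N →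
      SectorParams ε τ (Real.pi / N) (meshCos N) (meshSin N) →
      DetBounds d D (radialMap r) K ε τ N →
      (∀ e ∈ layerIndex K N,
        IntegrableOn (density₂ g ((layerElement ε τ N e).interp (radialMap r)))
          (layerElement ε τ N e).carrier) ∧
      |interpEnergy₂ g (radialMap r) K ε τ N -
          2 * Real.pi * ∫ R in ε..(ε + τ), R * radialDensity₂ g r r' R| ≤
        C * (τ ^ 3 + (ε + τ) * τ * (1 / (N : ℝ) ^ 2) + 1 / (N : ℝ) ^ 4) := by
  obtain ⟨C₂, hC₂, hf2⟩ := exists_radialDensity₂_bound H hg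
  have hc2 : 0 < c ^ 2 := pow_pos H.c_pos 2
  -- The interval is enlarged so that it contains both the interpolated and the exact determinants.
  have hα0 : 0 < min d (c ^ 2) := lt_min hd hc2
  obtain ⟨Lg, hLg, Mg, hMg, hlip, hbd⟩ := hg.exists_lipschitz (β := max D (B ^ 2)) hα0
  set K' := 1000000 * B ^ 2 * (Lg * (1 + B ^ 2) + Mg) with hK'
  have hK'0 : 0 ≤ K' := by positivity
  refine ⟨96 * K' + 8 * C₂, by positivity, ?_⟩
  intro K ε τ N L P hDet
  have hε := L.eps_pos
  have hτ := L.tau_pos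
  have hκ0 := meshCos_nonneg N
  have hS0 := P.S_pos
  have hae : ∀ e ∈ layerIndex K N, ∀ᵐ x ∂(volume.restrict refTriangle),
      (layerElement ε τ N e).jac (radialMap r) x / (layerElement ε τ N e).jac id x ∈
        Icc (min d (c ^ 2)) (max D (B ^ 2)) := fun e he =>
    ((PolarTriangle.ae_det_bounds_iff (layer_jac_ne_zero H L P e)).mp (hDet e he)).mono
      fun x hx => ⟨(min_le_left _ _).trans hx.1, hx.2.trans (le_max_left _ _)⟩
  have hgc : ContinuousOn g (Icc (min d (c ^ 2)) (max D (B ^ 2))) :=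
    hg.contDiff.continuousOn.mono fun a ha => hα0.trans_le ha.1
  refine ⟨fun e he => PolarTriangle.integrableOn_density₂_interp (layer_jac_ne_zero H L P e) hgc
    (hae e he), ?_⟩
  set e₂ := τ ^ 2 + meshCos N * (ε + τ) + meshCos N ^ 2 / τ with he₂
  have he₂0 : 0 ≤ e₂ := by positivity
  have hcf := continuousOn_radialDensity₂ H hg.contDiff.continuousOn
  have hk : ContinuousOn (fun R => R * radialDensity₂ g r r' R) (Icc ε (ε + τ)) :=
    (continuousOn_id.mul hcf).mono (Icc_subset_Ioc L)
  have hone : ∀ t : ElementType,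
      ∫ x in refTriangle, (fun _ : ℝ => (1 : ℝ)) (refRadius ε τ t x) ≤ 1 := by
    intro t
    refine (integral_refRadius_le (ε := ε) hτ.le (k := fun _ => 1) continuousOn_const
      (fun _ _ => zero_le_one) t).trans ?_
    simp
  have helem : ∀ e ∈ layerIndex K N,
      |energy₂ g ((layerElement ε τ N e).interp (radialMap r)) (layerElement ε τ N e).carrier -
        elementScale τ N e.1 * ∫ x in refTriangle,
          refRadius ε τ e.1 x * radialDensity₂ g r r' (refRadius ε τ e.1 x)| ≤
      4 * meshSin N * τ * (K' * e₂) := by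
    intro e he
    obtain ⟨hG0, hG1⟩ := elementScale_bounds P e.1
    have hJ := layer_jac_ne_zero H L P e
    have i1 := integrableOn_comp_refRadius (ε := ε) (k := fun _ => (1 : ℝ)) hτ.le
      continuousOn_const e.1
    have i3 := integrableOn_comp_refRadius hτ.le hk e.1
    rw [PolarTriangle.energy₂_interp hJ, ← integral_const_mul]
    have h := abs_setIntegral_sub_le
      (β := fun x => elementScale τ N e.1 * (K' * e₂) * 1)
      (PolarTriangle.integrableOn_refDensity₂ (v := radialMap r) hJ hgc (hae e he))
      (i3.const_mul (elementScale τ N e.1)) (i1.const_mul _) (by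
        have hm := (ae_restrict_iff' refTriangle_measurableSet).mp (hae e he)
        rw [ae_restrict_iff' refTriangle_measurableSet]
        filter_upwards [hm] with x hx hxT
        refine ((layer_elementApprox H L P e hxT).density₂ hG0 (refRadius_mem_Ioc L e.1 hxT) H
          hLg (min_le_right _ _) (le_max_right _ _) hlip hbd (hx hxT)).trans (le_of_eq ?_)
        rw [hK', he₂]; ring)
    refine h.trans ?_
    rw [integral_const_mul]
    have := hone e.1
    calc _ ≤ elementScale τ N e.1 * (K' * e₂) * 1 := by gcongr
      _ ≤ _ := by rw [mul_one]; gcongr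
  -- The factor `τ` of the area scale cancels the denominator in `κ² / τ`.
  have hτe : τ * e₂ ≤ 4 * (τ ^ 3 + (ε + τ) * τ * (1 / (N : ℝ) ^ 2) + 1 / (N : ℝ) ^ 4) := by
    have h1 := meshCos_le N
    have h2 : meshCos N ^ 2 ≤ 4 * (1 / (N : ℝ) ^ 4) := by
      have := pow_le_pow_left₀ hκ0 h1 2
      have e : (2 * (1 / (N : ℝ) ^ 2)) ^ 2 = 4 * (1 / (N : ℝ) ^ 4) := by
        have := one_le_cast L.N_pos
        field_simp; norm_num
      rwa [e] at this
    have e : τ * e₂ = τ ^ 3 + (ε + τ) * τ * meshCos N + meshCos N ^ 2 := by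
      rw [he₂]; field_simp
    have h3 := mul_le_mul_of_nonneg_left h1 (by positivity : 0 ≤ (ε + τ) * τ)
    have h4 : 0 ≤ (ε + τ) * τ * (1 / (N : ℝ) ^ 2) := by positivity
    have h5 : 0 ≤ τ ^ 3 := by positivity
    rw [e]; linarith
  set F := τ ^ 3 + (ε + τ) * τ * (1 / (N : ℝ) ^ 2) + 1 / (N : ℝ) ^ 4 with hF
  have hsum : |interpEnergy₂ g (radialMap r) K ε τ N -
      ∑ e ∈ layerIndex K N, elementScale τ N e.1 * ∫ x in refTriangle,
        refRadius ε τ e.1 x * radialDensity₂ g r r' (refRadius ε τ e.1 x)| ≤ 96 * K' * F := by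
    rw [interpEnergy₂, ← Finset.sum_sub_distrib]
    refine (Finset.abs_sum_le_sum_abs _ _).trans ?_
    refine (sum_const_le K (by positivity) helem).trans ?_
    have e1 : 3 * N * (4 * meshSin N * τ * (K' * e₂)) =
        12 * K' * (N * meshSin N) * (τ * e₂) := by ring
    rw [e1]
    have := (meshSin_bounds L.N_pos).1
    calc _ ≤ 12 * K' * 2 * (4 * F) := by gcongr
      _ = _ := by ring
  have href := sum_reference_sub_le L K hcf (fun R hR => (hf2 R hR).1)
    (integral_mul_le_const L hf2)
  have hfin := abs_add_le_add hsum href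
  rw [sub_add_sub_cancel] at hfin
  refine hfin.trans ?_
  have h1 : (ε + τ) * τ * (1 / (N : ℝ) ^ 2) ≤ F := by
    have h5 : 0 ≤ τ ^ 3 := by positivity
    have h6 : 0 ≤ 1 / (N : ℝ) ^ 4 := by positivity
    rw [hF]; linarith
  have h2 := mul_le_mul_of_nonneg_left h1 (by positivity : 0 ≤ 8 * C₂)
  linarith

end Layer
end
noncomputable section

/-! ### Exact energies -/

section Exact

variable {ε τ c B p ω : ℝ} {N : ℕ} {r r' r'' g : ℝ → ℝ}

/-- The curved inner edges dip slightly inside the circle of radius `ε`; half that radius is a safe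
distance from the origin. -/
theorem layerRegion_norm_bounds (L : LayerParams ε τ N)
    (P : SectorParams ε τ (Real.pi / N) (meshCos N) (meshSin N)) (K : LayerKind) :
    ∀ x ∈ layerRegion K ε τ N, ε / 2 ≤ ‖x‖ ∧ ‖x‖ ≤ 1 := by
  intro x hx
  obtain ⟨h1, h2⟩ := norm_bounds_of_mem_layerRegion P hx
  refine ⟨?_, h2.trans L.le_one⟩
  have h3 := (meshQ_bounds P).1
  rw [meshQ] at h3
  refine (pow_le_pow_iff_left₀ (by linarith [L.eps_pos]) (norm_nonneg x) two_ne_zero).mp ?_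
  refine le_trans ?_ h1
  have := mul_le_mul_of_nonneg_left h3 (sq_nonneg ε)
  nlinarith [sq_nonneg ε]

theorem annulus_norm_bounds (L : LayerParams ε τ N) :
    ∀ x ∈ annulus ε τ, ε / 2 ≤ ‖x‖ ∧ ‖x‖ ≤ 1 := fun x hx =>
  ⟨by linarith [hx.1, L.eps_pos], hx.2.trans L.le_one⟩

/-- The energies of the radial map in terms of its radial densities. -/
theorem radialMap_energies (H : ProfileBounds r r' r'' c B) (hg : ContinuousOn g (Ioi 0))
    (hp : 0 ≤ p) {a : ℝ} (ha : 0 < a) {U : Set Plane} (hU : IsCompact U)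
    (hUa : ∀ x ∈ U, a ≤ ‖x‖ ∧ ‖x‖ ≤ 1) :
    (IntegrableOn (density₁ p ω (radialMap r)) U ∧ IntegrableOn (density₂ g (radialMap r)) U) ∧
      energy₁ p ω (radialMap r) U = ∫ x in U, radialDensity₁ p ω r r' ‖x‖ ∧
      energy₂ g (radialMap r) U = ∫ x in U, radialDensity₂ g r r' ‖x‖ ∧
      energy p ω g (radialMap r) U =
        ∫ x in U, (fun R => radialDensity₁ p ω r r' R + radialDensity₂ g r r' R) ‖x‖ ∧
      energy p ω g (radialMap r) U = energy₁ p ω (radialMap r) U + energy₂ g (radialMap r) U := by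
  obtain ⟨h1, h2⟩ := density_radialMap_ae (p := p) (ω := ω) (g := g) H ha hU.measurableSet hUa
  have i1 := integrableOn_radial (continuousOn_radialDensity₁ (ω := ω) H hp) ha hU hUa
  have i2 := integrableOn_radial (continuousOn_radialDensity₂ H hg) ha hU hUa
  have j1 : IntegrableOn (density₁ p ω (radialMap r)) U := (integrable_congr h1).mpr i1
  have j2 : IntegrableOn (density₂ g (radialMap r)) U := (integrable_congr h2).mpr i2
  refine ⟨⟨j1, j2⟩, integral_congr_ae h1, integral_congr_ae h2, integral_congr_ae ?_,
    integral_add j1 j2⟩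
  filter_upwards [h1, h2] with x hx1 hx2
  rw [hx1, hx2]

theorem interpEnergy_eq_add {K : LayerKind} {u : Plane → Plane}
    (h1 : ∀ e ∈ layerIndex K N, IntegrableOn (density₁ p ω ((layerElement ε τ N e).interp u))
      (layerElement ε τ N e).carrier)
    (h2 : ∀ e ∈ layerIndex K N, IntegrableOn (density₂ g ((layerElement ε τ N e).interp u))
      (layerElement ε τ N e).carrier) :
    interpEnergy p ω g u K ε τ N = interpEnergy₁ p ω u K ε τ N + interpEnergy₂ g u K ε τ N := by
  rw [interpEnergy, interpEnergy₁, interpEnergy₂, ← Finset.sum_add_distrib]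
  exact Finset.sum_congr rfl fun e he => integral_add (h1 e he) (h2 e he)

end Exact

/-! ### Mesh conditions for orientation preservation -/

/-- The Jacobian errors are at most `s ε ≤ s ρ`. The numerator is then at least `c² ρ / 2` and at
most `(B²+1) ρ`, the denominator lies between `ρ/2` and `2ρ`, and the stated bounds are the
resulting quotients. -/
theorem detBounds_of_mesh {ε τ c B s : ℝ} {N : ℕ} {r r' r'' : ℝ → ℝ}
    (H : ProfileBounds r r' r'' c B) (L : LayerParams ε τ N)
    (P : SectorParams ε τ (Real.pi / N) (meshCos N) (meshSin N)) (K : LayerKind)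
    (hs : 1000000 * B ^ 2 * (τ ^ 2 + meshCos N * (ε + τ) + meshCos N ^ 2 / τ) ≤ s * ε)
    (hs1 : s ≤ c ^ 2 / 2) (hs2 : s ≤ 1) :
    DetBounds (c ^ 2 / 4) (2 * (B ^ 2 + 1)) (radialMap r) K ε τ N := by
  intro e _
  rw [PolarTriangle.ae_det_bounds_iff (layer_jac_ne_zero H L P e),
    ae_restrict_iff' refTriangle_measurableSet]
  refine ae_of_all _ fun x hx => ?_
  have E := layer_elementApprox H L P e hx
  have hG := (elementScale_bounds P e.1).1
  have hρ := refRadius_mem_Ioc L e.1 hx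
  have hρε := (refRadius_mem (ε := ε) L.tau_pos.le e.1 hx).1
  have hdet := H.det_bounds hρ
  have hε := L.eps_pos
  have hc2 : 0 < c ^ 2 := pow_pos H.c_pos 2
  set ρ := refRadius ε τ e.1 x
  set G := elementScale τ N e.1
  have hj := abs_le.mp (E.jac_abs.trans hs)
  have hju := abs_le.mp (E.det.trans hs)
  rw [mem_Icc, div_le_iff₀ hρ.1, le_div_iff₀ hρ.1] at hdet
  have s1 : s * ε ≤ c ^ 2 / 2 * ρ := mul_le_mul hs1 hρε hε.le (by positivity)
  have s2 : s * ε ≤ 1 * ρ := mul_le_mul hs2 hρε hε.le zero_le_one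
  have hlow := E.jac_lower
  have hjpos : 0 < (layerElement ε τ N e).jac id x / G := by linarith [hρ.1]
  have e1 : (layerElement ε τ N e).jac (radialMap r) x / (layerElement ε τ N e).jac id x =
      ((layerElement ε τ N e).jac (radialMap r) x / G) /
        ((layerElement ε τ N e).jac id x / G) := by
    field_simp
  rw [e1, mem_Icc, le_div_iff₀ hjpos, div_le_iff₀ hjpos]
  have hB2 : 0 ≤ B ^ 2 + 1 := by positivity
  constructor
  · have : c ^ 2 / 4 * ((layerElement ε τ N e).jac id x / G) ≤ c ^ 2 / 4 * (2 * ρ) :=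
      mul_le_mul_of_nonneg_left (by linarith) (by positivity)
    linarith
  · have := mul_le_mul_of_nonneg_left hlow (by positivity : 0 ≤ 2 * (B ^ 2 + 1))
    linarith

/-- Consequences of the mesh conditions `τ ≤ s ε^(1/2)` and `1/N ≤ min (s (ετ)^(1/4)) s`. -/
theorem mesh_conditions {ε τ s : ℝ} {N : ℕ} (L : LayerParams ε τ N) (hs0 : 0 < s) (hs1 : s ≤ 1)
    (h1 : τ ≤ s * ε ^ (1 / 2 : ℝ)) (h2 : 1 / (N : ℝ) ≤ min (s * (ε * τ) ^ (1 / 4 : ℝ)) s) :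
    1 / (N : ℝ) ≤ s ∧ ε / τ * (1 / (N : ℝ) ^ 4) ≤ s ∧
      τ ^ 2 + meshCos N * (ε + τ) + meshCos N ^ 2 / τ ≤ 9 * s * ε := by
  have hε := L.eps_pos
  have hτ := L.tau_pos
  have hσ := L.le_one
  have hN := one_le_cast L.N_pos
  have hN0 : 0 < 1 / (N : ℝ) := by positivity
  have hs2 : s ^ 2 ≤ s := by nlinarith
  have hs4 : s ^ 4 ≤ s := by
    have : s ^ 4 = s ^ 2 * s ^ 2 := by ring
    rw [this]
    exact (mul_le_mul hs2 (hs2.trans hs1) (sq_nonneg s) hs0.le).trans (by linarith)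
  have a1 := h2.trans (min_le_right _ _)
  have a2 : τ ^ 2 ≤ s ^ 2 * ε := by
    have := pow_le_pow_left₀ hτ.le h1 2
    rwa [mul_pow, ← Real.rpow_natCast (ε ^ (1 / 2 : ℝ)) 2, ← Real.rpow_mul hε.le,
      show (1 / 2 : ℝ) * ((2 : ℕ) : ℝ) = 1 by norm_num, Real.rpow_one] at this
  have a3 : 1 / (N : ℝ) ^ 4 ≤ s ^ 4 * (ε * τ) := by
    have := pow_le_pow_left₀ hN0.le (h2.trans (min_le_left _ _)) 4
    rwa [mul_pow, ← Real.rpow_natCast ((ε * τ) ^ (1 / 4 : ℝ)) 4, ← Real.rpow_mul (by positivity),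
      show (1 / 4 : ℝ) * ((4 : ℕ) : ℝ) = 1 by norm_num, Real.rpow_one, one_div_pow] at this
  have a4 : 1 / (N : ℝ) ^ 2 ≤ s ^ 2 := by
    have := pow_le_pow_left₀ hN0.le a1 2
    rwa [one_div_pow] at this
  have hn4 : 1 / (N : ℝ) ^ 4 = 1 / (N : ℝ) ^ 2 * (1 / (N : ℝ) ^ 2) := by field_simp
  have hn2 : 0 ≤ 1 / (N : ℝ) ^ 2 := by positivity
  have hτ1 : τ ≤ 1 := by linarith
  refine ⟨a1, ?_, ?_⟩
  · calc ε / τ * (1 / (N : ℝ) ^ 4) ≤ ε / τ * (s ^ 4 * (ε * τ)) := by gcongr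
      _ = s ^ 4 * (ε * ε) := by field_simp
      _ ≤ s * 1 := mul_le_mul hs4 (mul_le_one₀ (by linarith) hε.le (by linarith)) (by positivity)
          hs0.le
      _ = s := mul_one s
  · have hκ0 := meshCos_nonneg N
    have hκ := meshCos_le N
    have b1 : meshCos N * ε ≤ 2 * s * ε := by
      have : meshCos N ≤ 2 * s := by linarith
      gcongr
    -- Neither condition alone gives this; their combination does after squaring, from `N⁻⁴ ≤ s⁴ ε
    -- τ` and `τ² ≤ s² ε`.
    have b2 : 1 / (N : ℝ) ^ 2 * τ ≤ s * ε := by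
      refine (pow_le_pow_iff_left₀ (by positivity) (by positivity) two_ne_zero).mp ?_
      calc (1 / (N : ℝ) ^ 2 * τ) ^ 2 = 1 / (N : ℝ) ^ 4 * τ ^ 2 := by rw [hn4]; ring
        _ ≤ s ^ 4 * (ε * τ) * (s ^ 2 * ε) := by gcongr
        _ = s ^ 4 * s ^ 2 * ε ^ 2 * τ := by ring
        _ ≤ 1 * s ^ 2 * ε ^ 2 * 1 := by
          have : s ^ 4 ≤ 1 := hs4.trans hs1
          gcongr
        _ = (s * ε) ^ 2 := by ring
    have b3 : meshCos N * τ ≤ 2 * s * ε := by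
      have := mul_le_mul_of_nonneg_right hκ hτ.le
      linarith
    have b4 : meshCos N ^ 2 / τ ≤ 4 * s * ε := by
      rw [div_le_iff₀ hτ]
      have e : (2 * (1 / (N : ℝ) ^ 2)) ^ 2 = 4 * (1 / (N : ℝ) ^ 4) := by rw [hn4]; ring
      have c1 := pow_le_pow_left₀ hκ0 hκ 2
      rw [e] at c1
      have c2 : s ^ 4 * (ε * τ) ≤ s * (ε * τ) := by gcongr
      linarith
    have b5 : s ^ 2 * ε ≤ s * ε := by gcongr
    linarith
end

noncomputable section

/-! ### Energies on fine layers -/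

/-- The energies on one layer, with the energies of the interpolant compared to the layer size. -/
structure LayerEstimates (p ω : ℝ) (g r r' : ℝ → ℝ) (a b C : ℝ) (κ : LayerKind) (ε τ : ℝ)
    (N : ℕ) : Prop where
  sector : SectorParams ε τ (Real.pi / N) (meshCos N) (meshSin N)
  size_pos : 0 < layerSize p ε τ
  integrable : ∀ S ∈ ({layerRegion κ ε τ N, annulus ε τ} : Set (Set Plane)),
    IntegrableOn (density₁ p ω (radialMap r)) S ∧ IntegrableOn (density₂ g (radialMap r)) S
  interp₁ : |interpEnergy₁ p ω (radialMap r) κ ε τ N -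
      energy₁ p ω (radialMap r) (layerRegion κ ε τ N)| ≤
    C * layerSize p ε τ * (τ ^ 2 + 1 / (N : ℝ) ^ 2 + ε / τ * (1 / (N : ℝ) ^ 4))
  region : |energy p ω g (radialMap r) (layerRegion κ ε τ N) -
      energy p ω g (radialMap r) (annulus ε τ)| ≤
    C * layerSize p ε τ * (τ ^ 2 + 1 / (N : ℝ) ^ 2 + ε / τ * (1 / (N : ℝ) ^ 4))
  region₂ : |energy₂ g (radialMap r) (layerRegion κ ε τ N) -
    2 * Real.pi * ∫ R in ε..(ε + τ), R * radialDensity₂ g r r' R| ≤ C * (1 / (N : ℝ) ^ 4)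
  energy_eq : energy p ω g (radialMap r) (layerRegion κ ε τ N) =
    energy₁ p ω (radialMap r) (layerRegion κ ε τ N) +
      energy₂ g (radialMap r) (layerRegion κ ε τ N)
  lower₁ : a * layerSize p ε τ ≤ energy₁ p ω (radialMap r) (layerRegion κ ε τ N)
  bounds : ∀ S ∈ ({layerRegion κ ε τ N, annulus ε τ} : Set (Set Plane)),
    a * layerSize p ε τ ≤ energy p ω g (radialMap r) S ∧
      energy p ω g (radialMap r) S ≤ b * layerSize p ε τ

/-- Errors are first measured in units of the layer size. The threshold `δ` is fixed here, before
any determinant bounds are chosen, so that one threshold serves all parts of the theorem. -/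
theorem exists_layerEstimates {p ω c B : ℝ} {g r r' r'' : ℝ → ℝ}
    (H : ProfileBounds r r' r'' c B) (hg : IsCompressibility g) (hp₁ : 1 < p) (hp₂ : p < 2)
    (hω : 0 < ω) : ∃ δ > 0, δ ≤ 1 / 2000 ∧ ∃ a > 0, ∃ b > 0, ∃ C > 0,
      ∀ (κ : LayerKind) (ε τ : ℝ) (N : ℕ), FineLayer δ ε τ N →
        LayerEstimates p ω g r r' a b C κ ε τ N := by
  have hp2' : 0 < 2 - p := by linarith
  obtain ⟨C₂, hC₂, hf2⟩ := exists_radialDensity₂_bound H hg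
  obtain ⟨Ci, hCi, hI₁⟩ := interpEnergy₁_approx H hp₁.le hp₂ hω.le
  have hgc := hg.contDiff.continuousOn
  have hcf1 := continuousOn_radialDensity₁ (ω := ω) H (by linarith : 0 ≤ p)
  have hcf2 := continuousOn_radialDensity₂ H hgc
  set f₁ := radialDensity₁ p ω r r'
  set f₂ := radialDensity₂ g r r'
  have hB := H.one_le_B
  have hc := H.c_pos
  set a₁ := ω * c ^ p with ha₁
  have ha₁0 : 0 < a₁ := mul_pos hω (Real.rpow_pos_of_pos hc p)
  set b₁ := ω * (2 * B ^ 2) with hb₁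
  have hb₁0 : 0 < b₁ := by positivity
  have hf1 : ∀ R ∈ Ioc (0 : ℝ) 1, a₁ * R ^ (-p) ≤ f₁ R ∧ f₁ R ≤ b₁ * R ^ (-p) := fun R hR =>
    radialDensity₁_bounds H (by linarith) hp₂.le hω.le hR
  have hf1' : ∀ R ∈ Ioc (0 : ℝ) 1, 0 ≤ f₁ R ∧ f₁ R ≤ (b₁ + C₂) * R ^ (-p) := fun R hR => by
    have := Real.rpow_nonneg hR.1.le (-p)
    exact ⟨(mul_nonneg ha₁0.le this).trans (hf1 R hR).1,
      (hf1 R hR).2.trans (mul_le_mul_of_nonneg_right (by linarith) this)⟩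
  -- Since `R ≤ 1`, the bounded density of `E₂` is dominated by the same singular power, and the
  -- total energy is treated like `E₁`.
  have hf12 : ∀ R ∈ Ioc (0 : ℝ) 1, 0 ≤ f₁ R + f₂ R ∧ f₁ R + f₂ R ≤ (b₁ + C₂) * R ^ (-p) :=
    fun R hR => by
      have h1 : 1 ≤ R ^ (-p) :=
        Real.one_le_rpow_of_pos_of_le_one_of_nonpos hR.1 hR.2 (by linarith)
      have h2 := mul_le_mul_of_nonneg_left h1 hC₂.le
      exact ⟨add_nonneg (hf1' R hR).1 (hf2 R hR).1, by linarith [(hf1 R hR).2, (hf2 R hR).2]⟩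
  set Cs := 2048 * (b₁ + C₂) / (2 - p) with hCs
  have hCs0 : 0 < Cs := by positivity
  -- The second bound limits the shell energy to half of the lower energy bound of the annulus. The
  -- shell error contains no `τ²`, so `τ` itself need not be small.
  set δ := min (1 / 2000) (a₁ / (4 * Cs)) with hδ
  have hδ0 : 0 < δ := lt_min (by norm_num) (by positivity)
  have hδ1 : δ ≤ 1 / 2000 := min_le_left _ _
  have hδ2 : 2 * δ * Cs ≤ a₁ / 2 := by
    have : δ ≤ a₁ / (4 * Cs) := min_le_right _ _
    rw [le_div_iff₀ (by positivity)] at this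
    linarith
  set b₂ := 8 * ((b₁ + C₂) / (2 - p)) with hb₂
  have hb₂0 : 0 < b₂ := by positivity
  -- Passing from the annulus to the layer loses at most half of `a₁` below and adds at most as much
  -- above. The three summands of the last constant belong to interpolation, singular shells and
  -- bounded shells.
  refine ⟨δ, hδ0, hδ1, a₁ / 2, half_pos ha₁0, b₂ + a₁, by positivity, Ci + Cs + 2048 * C₂,
    by positivity, ?_⟩
  intro κ ε τ N F
  have L := F.toLayerParams
  have P := F.sectorParams hδ1
  have hA := layerSize_pos L hp₁.le hp₂
  have hε := L.eps_pos
  have hτ := L.tau_pos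
  obtain ⟨iL, eL1, eL2, eL, eL12⟩ := radialMap_energies (p := p) (ω := ω) H hgc (by linarith)
    (half_pos hε) (isCompact_layerRegion κ ε τ N) (layerRegion_norm_bounds L P κ)
  obtain ⟨iA, eA1, eA2, eA, -⟩ := radialMap_energies (p := p) (ω := ω) H hgc (by linarith)
    (half_pos hε) (isCompact_annulus ε τ) (annulus_norm_bounds L)
  have s1 := integral_layer_sub_annulus_singular hp₁.le hp₂ L P κ hcf1 hf1' (by positivity)
  have s2 := integral_layer_sub_annulus_bounded L P κ hcf2 hf2 hC₂.le
  have s12 := integral_layer_sub_annulus_singular hp₁.le hp₂ L P κ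
    (f := fun R => f₁ R + f₂ R) (hcf1.add hcf2) hf12 (by positivity)
  rw [← eL1, ← eA1] at s1
  rw [← eL2, setIntegral_annulus hε hτ] at s2
  rw [← eL, ← eA] at s12
  have i1 := hI₁ κ ε τ N L P
  have eA1' := eA1.trans (setIntegral_annulus hε hτ f₁)
  have eA' := eA.trans (setIntegral_annulus hε hτ fun R => f₁ R + f₂ R)
  rw [← eA1'] at i1
  have hτ2 : 0 ≤ τ ^ 2 := sq_nonneg τ
  have hn2 : 0 ≤ 1 / (N : ℝ) ^ 2 := by positivity
  have hn4 : 0 ≤ ε / τ * (1 / (N : ℝ) ^ 4) := by positivity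
  have hη' : 1 / (N : ℝ) ^ 2 + ε / τ * (1 / (N : ℝ) ^ 4) ≤ 2 * δ := by
    have h1 : 1 / (N : ℝ) ^ 2 ≤ δ := by
      have e : 1 / (N : ℝ) ^ 2 = 1 / N * (1 / N) := by
        have := one_le_cast L.N_pos
        field_simp
      rw [e]
      calc 1 / (N : ℝ) * (1 / N) ≤ δ * 1 :=
            mul_le_mul F.inv_N_le (F.inv_N_le.trans (by linarith)) (by positivity) hδ0.le
        _ = δ := mul_one δ
    linarith [F.ratio_le]
  have hle : ∀ {t : ℝ}, t ≤ Cs * layerSize p ε τ *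
      (1 / (N : ℝ) ^ 2 + ε / τ * (1 / (N : ℝ) ^ 4)) → t ≤ Cs * layerSize p ε τ *
        (τ ^ 2 + 1 / (N : ℝ) ^ 2 + ε / τ * (1 / (N : ℝ) ^ 4)) ∧
      t ≤ a₁ / 2 * layerSize p ε τ := by
    intro t ht
    refine ⟨ht.trans (mul_le_mul_of_nonneg_left (by linarith) (by positivity)), ht.trans ?_⟩
    calc Cs * layerSize p ε τ * (1 / (N : ℝ) ^ 2 + ε / τ * (1 / (N : ℝ) ^ 4))
        ≤ Cs * layerSize p ε τ * (2 * δ) := mul_le_mul_of_nonneg_left hη' (by positivity)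
      _ = 2 * δ * Cs * layerSize p ε τ := by ring
      _ ≤ _ := mul_le_mul_of_nonneg_right hδ2 hA.le
  have hpi3 := Real.pi_gt_three
  have hpi4 := Real.pi_le_four
  have hdiv : layerSize p ε τ ≤ layerSize p ε τ / (2 - p) := by
    rw [le_div_iff₀ hp2']
    exact mul_le_of_le_one_right hA.le (by linarith)
  have hlow : ∀ {I : ℝ}, a₁ * (layerSize p ε τ / (2 - p)) ≤ I →
      a₁ * layerSize p ε τ ≤ 2 * Real.pi * I := by
    intro I hI
    have h0 := (mul_le_mul_of_nonneg_left hdiv ha₁0.le).trans hI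
    have h1 : 0 ≤ I := le_trans (by positivity) h0
    exact h0.trans (le_mul_of_one_le_left h1 (by linarith))
  have l1 : a₁ * layerSize p ε τ ≤ energy₁ p ω (radialMap r) (annulus ε τ) := by
    rw [eA1']
    exact hlow (layerSize_le_integral_mul L hp₂ hcf1 fun R hR => (hf1 R hR).1)
  have l2 : a₁ * layerSize p ε τ ≤ energy p ω g (radialMap r) (annulus ε τ) := by
    rw [eA']
    exact hlow (layerSize_le_integral_mul (f := fun R => f₁ R + f₂ R) L hp₂ (hcf1.add hcf2)
      fun R hR => (hf1 R hR).1.trans (le_add_of_nonneg_right (hf2 R hR).1))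
  have u2 : energy p ω g (radialMap r) (annulus ε τ) ≤ b₂ * layerSize p ε τ := by
    have h := integral_mul_le_layerSize (f := fun R => f₁ R + f₂ R) L hp₂ (hcf1.add hcf2)
      fun R hR => (hf12 R hR).2
    rw [eA']
    have h1 : 0 ≤ (b₁ + C₂) * (layerSize p ε τ / (2 - p)) := by positivity
    calc _ ≤ 2 * Real.pi * ((b₁ + C₂) * (layerSize p ε τ / (2 - p))) :=
          mul_le_mul_of_nonneg_left h (by linarith)
      _ ≤ 8 * ((b₁ + C₂) * (layerSize p ε τ / (2 - p))) :=
          mul_le_mul_of_nonneg_right (by linarith) h1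
      _ = _ := by rw [hb₂]; ring
  have hs1 := hle s1
  have hs12 := hle s12
  have hs1a := abs_le.mp hs1.2
  have hs12a := abs_le.mp hs12.2
  have hpos : 0 < a₁ * layerSize p ε τ := by positivity
  have hη : 0 ≤ layerSize p ε τ * (τ ^ 2 + 1 / (N : ℝ) ^ 2 + ε / τ * (1 / (N : ℝ) ^ 4)) := by
    positivity
  refine
    { sector := P
      size_pos := hA
      integrable := ?_
      interp₁ := ?_
      region := ?_
      region₂ := s2.trans (mul_le_mul_of_nonneg_right (by linarith) (by positivity))
      energy_eq := eL12
      lower₁ := by linarith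
      bounds := ?_ }
  · rintro S (rfl | rfl)
    · exact iL
    · exact iA
  · have h := abs_sub_le_add i1 hs1.1
    rw [sub_sub_sub_cancel_right] at h
    have := mul_nonneg hC₂.le hη
    linarith
  · have := mul_nonneg hC₂.le hη
    have := mul_nonneg hCi hη
    linarith [hs12.1]
  · rintro S (rfl | rfl)
    · exact ⟨by linarith, by linarith⟩
    · exact ⟨by linarith, by linarith⟩

/-- A single small number `s` serves for all three mesh constants: `s ≤ δ` makes the layer fine, and
the second bound on `s` brings the Jacobian errors below the threshold of `detBounds_of_mesh`. -/
theorem exists_mesh_conditions {c B δ : ℝ} {r r' r'' : ℝ → ℝ} (H : ProfileBounds r r' r'' c B)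
    (hδ0 : 0 < δ) (hδ1 : δ ≤ 1 / 2000) : ∃ C₁ > 0, ∃ C₂ > 0, ∃ C₃ > 0, ∃ d > 0, ∃ D : ℝ,
      ∀ (κ : LayerKind) (ε τ : ℝ) (N : ℕ), LayerParams ε τ N → τ ≤ C₁ * ε ^ (1 / 2 : ℝ) →
        1 / (N : ℝ) ≤ min (C₂ * (ε * τ) ^ (1 / 4 : ℝ)) C₃ →
        FineLayer δ ε τ N ∧ DetBounds d D (radialMap r) κ ε τ N := by
  have hB := H.one_le_B
  have hc := H.c_pos
  have hm : 0 < min (c ^ 2 / 2) 1 := lt_min (by positivity) one_pos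
  have hB0 : 0 < 9 * (1000000 * B ^ 2) := by positivity
  set s := min δ (min (c ^ 2 / 2) 1 / (9 * (1000000 * B ^ 2))) with hs
  have hs0 : 0 < s := lt_min hδ0 (div_pos hm hB0)
  have hsδ : s ≤ δ := min_le_left _ _
  have hsm : 9 * (1000000 * B ^ 2) * s ≤ min (c ^ 2 / 2) 1 := by
    have : s ≤ min (c ^ 2 / 2) 1 / (9 * (1000000 * B ^ 2)) := min_le_right _ _
    rwa [le_div_iff₀ hB0, mul_comm] at this
  refine ⟨s, hs0, s, hs0, s, hs0, c ^ 2 / 4, by positivity, 2 * (B ^ 2 + 1), ?_⟩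
  intro κ ε τ N L h1 h2
  obtain ⟨m1, m2, m3⟩ := mesh_conditions L hs0 (by linarith) h1 h2
  have F : FineLayer δ ε τ N := ⟨L, m1.trans hsδ, m2.trans hsδ⟩
  refine ⟨F, detBounds_of_mesh H L (F.sectorParams hδ1) κ (s := min (c ^ 2 / 2) 1) ?_
    (min_le_left _ _) (min_le_right _ _)⟩
  calc _ ≤ 1000000 * B ^ 2 * (9 * s * ε) := by gcongr
    _ = 9 * (1000000 * B ^ 2) * s * ε := by ring
    _ ≤ _ := mul_le_mul_of_nonneg_right hsm L.eps_pos.le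

/-- The layer size is at least `(2-p) τ`. Dividing the absolute error of `E₂` by `τ` therefore gives
a relative error for `E`, at the price of `N⁻⁴/τ` in place of `(ε/τ) N⁻⁴`. -/
theorem LayerEstimates.interp_error {p ω a b C Cj c B ε τ : ℝ} {g r r' r'' : ℝ → ℝ}
    {κ : LayerKind} {N : ℕ} (H : ProfileBounds r r' r'' c B) (hp₁ : 1 < p) (hp₂ : p < 2)
    (ha : 0 < a) (hC : 0 < C) (hCj : 0 ≤ Cj) (F : LayerParams ε τ N)
    (E : LayerEstimates p ω g r r' a b C κ ε τ N)
    (hint : ∀ e ∈ layerIndex κ N,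
      IntegrableOn (density₂ g ((layerElement ε τ N e).interp (radialMap r)))
        (layerElement ε τ N e).carrier)
    (h3 : |interpEnergy₂ g (radialMap r) κ ε τ N -
        2 * Real.pi * ∫ R in ε..(ε + τ), R * radialDensity₂ g r r' R| ≤
      Cj * (τ ^ 3 + (ε + τ) * τ * (1 / (N : ℝ) ^ 2) + 1 / (N : ℝ) ^ 4)) :
    |interpEnergy₂ g (radialMap r) κ ε τ N -
        energy₂ g (radialMap r) (layerRegion κ ε τ N)| ≤
      (Cj + C) * (τ ^ 3 + (ε + τ) * τ * (1 / (N : ℝ) ^ 2) + 1 / (N : ℝ) ^ 4) ∧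
    |interpEnergy p ω g (radialMap r) κ ε τ N -
        energy p ω g (radialMap r) (layerRegion κ ε τ N)| ≤
      (C + (Cj + C) / (2 - p)) / a * energy p ω g (radialMap r) (layerRegion κ ε τ N) *
        (τ ^ 2 + 1 / (N : ℝ) ^ 2 + 1 / (N : ℝ) ^ 4 / τ) := by
  have hp2' : 0 < 2 - p := by linarith
  have hε := F.eps_pos
  have hτ := F.tau_pos
  have hσ := F.le_one
  have hA := E.size_pos
  set Φ := τ ^ 3 + (ε + τ) * τ * (1 / (N : ℝ) ^ 2) + 1 / (N : ℝ) ^ 4 with hΦ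
  have hn4 : 0 ≤ 1 / (N : ℝ) ^ 4 := by positivity
  have hn2 : 0 ≤ 1 / (N : ℝ) ^ 2 := by positivity
  have h4 : |interpEnergy₂ g (radialMap r) κ ε τ N -
      energy₂ g (radialMap r) (layerRegion κ ε τ N)| ≤ (Cj + C) * Φ := by
    have h := abs_sub_le_add h3 E.region₂
    rw [sub_sub_sub_cancel_right] at h
    have : 1 / (N : ℝ) ^ 4 ≤ Φ := by
      have : 0 ≤ τ ^ 3 + (ε + τ) * τ * (1 / (N : ℝ) ^ 2) := by positivity
      rw [hΦ]; linarith
    have := mul_le_mul_of_nonneg_left this hC.le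
    linarith
  refine ⟨h4, ?_⟩
  set θ := τ ^ 2 + 1 / (N : ℝ) ^ 2 + 1 / (N : ℝ) ^ 4 / τ with hθ
  have hθ0 : 0 ≤ θ := by positivity
  have hE := (E.bounds _ (Or.inl rfl)).1
  have hE0 : 0 ≤ energy p ω g (radialMap r) (layerRegion κ ε τ N) :=
    le_trans (by positivity) hE
  have hηθ : τ ^ 2 + 1 / (N : ℝ) ^ 2 + ε / τ * (1 / (N : ℝ) ^ 4) ≤ θ := by
    have : ε / τ * (1 / (N : ℝ) ^ 4) ≤ 1 / (N : ℝ) ^ 4 / τ := by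
      rw [div_mul_eq_mul_div]
      exact div_le_div_of_nonneg_right (mul_le_of_le_one_left hn4 (by linarith)) hτ.le
    rw [hθ]; linarith
  have hΦθ : Φ ≤ layerSize p ε τ / (2 - p) * θ := by
    have e : τ * θ = τ ^ 3 + τ * (1 / (N : ℝ) ^ 2) + 1 / (N : ℝ) ^ 4 := by
      rw [hθ]; field_simp
    have h5 : Φ ≤ τ * θ := by
      have : (ε + τ) * τ * (1 / (N : ℝ) ^ 2) ≤ 1 * τ * (1 / (N : ℝ) ^ 2) := by gcongr
      rw [e, hΦ]; linarith
    have h6 : τ ≤ layerSize p ε τ / (2 - p) := by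
      rw [le_div_iff₀ hp2']
      linarith [layerSize_ge hε hτ hσ hp₁.le hp₂]
    exact h5.trans (mul_le_mul_of_nonneg_right h6 hθ0)
  rw [interpEnergy_eq_add (fun e _ => PolarTriangle.integrableOn_density₁_interp
    (layer_jac_ne_zero H F E.sector e) (by linarith)) hint, E.energy_eq]
  have h := abs_add_le_add E.interp₁ h4
  rw [sub_add_sub_comm] at h
  refine h.trans ?_
  rw [← E.energy_eq]
  have hrel : layerSize p ε τ ≤ energy p ω g (radialMap r) (layerRegion κ ε τ N) / a := by
    rw [le_div_iff₀ ha]; linarith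
  calc _ ≤ C * layerSize p ε τ * θ + (Cj + C) * (layerSize p ε τ / (2 - p) * θ) := by gcongr
    _ = (C + (Cj + C) / (2 - p)) * layerSize p ε τ * θ := by ring
    _ ≤ (C + (Cj + C) / (2 - p)) *
        (energy p ω g (radialMap r) (layerRegion κ ε τ N) / a) * θ := by gcongr
    _ = _ := by ring

end

theorem mainTheorem3 (p ω : ℝ) (hp₁ : 1 < p) (hp₂ : p < 2) (hω : 0 < ω)
    (g : ℝ → ℝ) (hg : IsCompressibility g) (r : ℝ → ℝ) (hr : IsCavityProfile r) :
    ∃ δ > 0,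
      -- the energy `E₁` and the exact energy, on all fine meshes
      (∃ C > 0, ∀ (κ : LayerKind) (ε τ : ℝ) (N : ℕ), FineLayer δ ε τ N →
        (∀ e ∈ layerIndex κ N, InjOn (layerElement ε τ N e).geomMap refTriangle ∧
          IntegrableOn (density₁ p ω ((layerElement ε τ N e).interp (radialMap r)))
            (layerElement ε τ N e).carrier) ∧
        (∀ S ∈ ({layerRegion κ ε τ N, annulus ε τ} : Set (Set Plane)),
          IntegrableOn (density₁ p ω (radialMap r)) S ∧
            IntegrableOn (density₂ g (radialMap r)) S) ∧
        |interpEnergy₁ p ω (radialMap r) κ ε τ N -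
            energy₁ p ω (radialMap r) (layerRegion κ ε τ N)| ≤
          C * energy₁ p ω (radialMap r) (layerRegion κ ε τ N) *
            (τ ^ 2 + 1 / (N : ℝ) ^ 2 + ε / τ * (1 / (N : ℝ) ^ 4)) ∧
        |energy p ω g (radialMap r) (layerRegion κ ε τ N) -
            energy p ω g (radialMap r) (annulus ε τ)| ≤
          C * energy p ω g (radialMap r) (annulus ε τ) *
            (τ ^ 2 + 1 / (N : ℝ) ^ 2 + ε / τ * (1 / (N : ℝ) ^ 4)) ∧
        (∀ S ∈ ({layerRegion κ ε τ N, annulus ε τ} : Set (Set Plane)),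
          layerSize p ε τ ≤ C * energy p ω g (radialMap r) S ∧
            energy p ω g (radialMap r) S ≤ C * layerSize p ε τ)) ∧
      -- the energies `E₂` and `E`, on the fine meshes with an orientation-preserving interpolant
      (∀ d D : ℝ, 0 < d →
        ∃ C > 0, ∀ (κ : LayerKind) (ε τ : ℝ) (N : ℕ), FineLayer δ ε τ N →
          DetBounds d D (radialMap r) κ ε τ N →
          (∀ e ∈ layerIndex κ N,
            IntegrableOn (density₂ g ((layerElement ε τ N e).interp (radialMap r)))
              (layerElement ε τ N e).carrier) ∧
          |interpEnergy₂ g (radialMap r) κ ε τ N -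
              energy₂ g (radialMap r) (layerRegion κ ε τ N)| ≤
            C * (τ ^ 3 + (ε + τ) * τ * (1 / (N : ℝ) ^ 2) + 1 / (N : ℝ) ^ 4) ∧
          |interpEnergy p ω g (radialMap r) κ ε τ N -
              energy p ω g (radialMap r) (layerRegion κ ε τ N)| ≤
            C * energy p ω g (radialMap r) (layerRegion κ ε τ N) *
              (τ ^ 2 + 1 / (N : ℝ) ^ 2 + 1 / (N : ℝ) ^ 4 / τ)) ∧
      -- the mesh conditions under which the interpolant is orientation preserving
      (∃ C₁ > 0, ∃ C₂ > 0, ∃ C₃ > 0, ∃ d > 0, ∃ D : ℝ,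
        ∀ (κ : LayerKind) (ε τ : ℝ) (N : ℕ), LayerParams ε τ N →
          τ ≤ C₁ * ε ^ (1 / 2 : ℝ) →
          1 / (N : ℝ) ≤ min (C₂ * (ε * τ) ^ (1 / 4 : ℝ)) C₃ →
          FineLayer δ ε τ N ∧ DetBounds d D (radialMap r) κ ε τ N) := by
  obtain ⟨r'', c, B, H⟩ := hr.exists_bounds
  obtain ⟨δ, hδ0, hδ1, a, ha, b, hb, C, hC, hE⟩ := exists_layerEstimates H hg hp₁ hp₂ hω
  -- The summand `C / a` turns errors measured by the layer size into relative errors; `1 / a` and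
  -- `b` give the two-sided comparison of the energies with the layer size.
  refine ⟨δ, hδ0, ⟨C / a + 1 / a + b, by positivity, ?_⟩, ?_, exists_mesh_conditions H hδ0 hδ1⟩
  · intro κ ε τ N F
    have E := hE κ ε τ N F
    have hε := F.eps_pos
    have hτ := F.tau_pos
    have hA := E.size_pos
    have hη : 0 ≤ τ ^ 2 + 1 / (N : ℝ) ^ 2 + ε / τ * (1 / (N : ℝ) ^ 4) := by positivity
    have hCa : 0 < C / a := by positivity
    have ha' : 0 < 1 / a := by positivity
    have key : ∀ {t E : ℝ}, t ≤ C * layerSize p ε τ *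
        (τ ^ 2 + 1 / (N : ℝ) ^ 2 + ε / τ * (1 / (N : ℝ) ^ 4)) → a * layerSize p ε τ ≤ E →
        t ≤ (C / a + 1 / a + b) * E *
          (τ ^ 2 + 1 / (N : ℝ) ^ 2 + ε / τ * (1 / (N : ℝ) ^ 4)) := by
      intro t E ht hE
      have hE0 : 0 ≤ E := le_trans (by positivity) hE
      refine ht.trans (mul_le_mul_of_nonneg_right ?_ hη)
      calc C * layerSize p ε τ = C / a * (a * layerSize p ε τ) := by field_simp
        _ ≤ C / a * E := mul_le_mul_of_nonneg_left hE hCa.le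
        _ ≤ _ := mul_le_mul_of_nonneg_right (by linarith) hE0
    have hJ := layer_jac_ne_zero H F.toLayerParams E.sector
    refine ⟨fun e _ => ⟨PolarTriangle.geomMap_injOn (hJ e),
      PolarTriangle.integrableOn_density₁_interp (hJ e) (by linarith)⟩, E.integrable,
      key E.interp₁ E.lower₁, key E.region (E.bounds _ (Or.inr rfl)).1, fun S hS => ?_⟩
    obtain ⟨k1, k2⟩ := E.bounds S hS
    have hE0 : 0 ≤ energy p ω g (radialMap r) S := le_trans (by positivity) k1
    refine ⟨?_, k2.trans (mul_le_mul_of_nonneg_right (by linarith) hA.le)⟩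
    calc layerSize p ε τ = 1 / a * (a * layerSize p ε τ) := by field_simp
      _ ≤ 1 / a * energy p ω g (radialMap r) S := mul_le_mul_of_nonneg_left k1 ha'.le
      _ ≤ _ := mul_le_mul_of_nonneg_right (by linarith) hE0
  · intro d D hd
    obtain ⟨Cj, hCj, hI₂⟩ := interpEnergy₂_approx (D := D) H hg hd
    have hp2' : 0 < 2 - p := by linarith
    have hC1 : 0 < Cj + C := by positivity
    have hC2 : 0 < (C + (Cj + C) / (2 - p)) / a := by positivity
    refine ⟨Cj + C + (C + (Cj + C) / (2 - p)) / a, by positivity, ?_⟩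
    intro κ ε τ N F hDet
    have E := hE κ ε τ N F
    have hε := F.eps_pos
    have hτ := F.tau_pos
    obtain ⟨hint, h3⟩ := hI₂ κ ε τ N F.toLayerParams E.sector hDet
    obtain ⟨k1, k2⟩ := E.interp_error H hp₁ hp₂ ha hC hCj F.toLayerParams hint h3
    have hE0 : 0 ≤ energy p ω g (radialMap r) (layerRegion κ ε τ N) :=
      le_trans (mul_nonneg ha.le E.size_pos.le) (E.bounds _ (Or.inl rfl)).1
    refine ⟨hint, k1.trans (mul_le_mul_of_nonneg_right (by linarith) (by positivity)),
      k2.trans (mul_le_mul_of_nonneg_right (mul_le_mul_of_nonneg_right (by linarith) hE0)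
        (by positivity))⟩
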